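/- Fix an integer $l\ge 1$. **Crystals.** A crystal is a set $B$ with maps $\tilde e_i,\tilde f_i:B\to B\sqcup\{0\}$ ($i\in I$) such that for every $b$ and $i$ some power of $\tilde e_i$ and of $\tilde f_i$ kills $b$, and $\tilde f_ib=b'\iff \tilde e_ib'=b$. Put $\varepsilon_i(b)=\max\{n:\tilde e_i^nb\ne0\}$, $\varphi_i(b)=\max\{n:\tilde f_i^nb\ne0\}$. On $B\otimes B'$ (the set $B\times B'$), $\tilde e_i(b\otimes b')$ is $\tilde e_ib\otimes b'$ if $\varphi_i(b)\ge\varepsilon_i(b')$ and $b\otimes\tilde e_ib'$ otherwise; $\tilde f_i(b\otimes b')$ is $\tilde f_ib\otimes b'$ if $\varphi_i(b)>\varepsilon_i(b')$ and $b\otimes\tilde f_ib'$ otherwise. Let $\mathrm{Aff}(B)=\{z^db: d\in\mathbb Z,\ b\in B\}$. For crystals $B,B'$ with index set $\{0,1,2\}$, a combinatorial $R$ matrix is a map $R:\mathrm{Aff}(B)\otimes\mathrm{Aff}(B')\to\mathrm{Aff}(B')\otimes\mathrm{Aff}(B)$ of the form $$z^{d}b\otimes z^{d'}b'\mapsto z^{d'+H(b\otimes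 b')}\tilde b'\otimes z^{d-H(b\otimes b')}\tilde b,$$ where $\iota:b\otimes b'\mapsto\tilde b'\otimes\tilde b$ is a bijection $B\otimes B'\to B'\otimes B$ commuting with all $\tilde e_i,\tilde f_i$, and $H:B\otimes B'\to\mathbb Z$ satisfies, whenever $\tilde e_i(b\otimes b')\ne0$: $H(\tilde e_i(b\otimes b'))$ equals $H(b\otimes b')+1$ if $i=0$, $\varphi_0(b)\ge\varepsilon_0(b')$, $\varphi_0(\tilde b')\ge\varepsilon_0(\tilde b)$; equals $H(b\otimes b')-1$ if $i=0$, $\varphi_0(b)<\varepsilon_0(b')$, $\varphi_0(\tilde b')<\varepsilon_0(\tilde b)$; and equals $H(b\otimes b')$ otherwise. **The $U_q'(D_4^{(3)})$-crystal $B_l$.** Its elements are the tuples $b=(x_1,x_2,x_3,\bar x_3,\bar x_2,\bar x_1)$ of non-negative integers with $x_3\equiv\bar x_3 \pmod 2$ and $x_1+x_2+\frac{x_3+\bar x_3}2+\bar x_2+\bar x_1\le l$. Write $(x)_+=\max(x,0)$, $(x)_-=\min(x,0)$, $z_1=\bar x_1-x_1$, $z_2=\bar x_2-\bar x_3$, $z_3=x_3-x_2$,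 $z_4=(\bar x_3-x_3)/2$. The operators change the coordinates as follows (the result is $0$ if it is not in $B_l$). $\tilde e_0$: - $x_1-1$ if $z_1+(z_2+(3z_4+(z_3)_+)_+)_+<0$; - $x_3-1,\ \bar x_3-1,\ \bar x_1+1$ if $z_2+(3z_4+(z_1+z_3)_+)_+<0\le z_1$; - $x_3-2,\ \bar x_2+1$ if $3z_4+(z_3+(z_1)_+)_+<0\le z_2+(z_1)_-$; - $x_2-1,\ \bar x_3+2$ if $3z_4+(z_2+(z_1)_-)_-\ge0>z_3+(z_1)_+$; - $x_1-1,\ x_3+1,\ \bar x_3+1$ if $z_3+(3z_4+(z_1+z_2)_-)_-\ge0>z_1$; - $\bar x_1+1$ if $z_1+(z_3+(3z_4+(z_2)_-)_-)_-\ge0$. $\tilde f_0$: - $x_1+1$ if $z_1+(z_2+(3z_4+(z_3)_+)_+)_+\le0$; - $x_3+1,\ \bar x_3+1,\ \bar x_1-1$ if $z_2+(3z_4+(z_1+z_3)_+)_+\le0<z_1$; - $x_3+2,\ \bar x_2-1$ if $3z_4+(z_3+(z_1)_+)_+\le0<z_2+(z_1)_-$; - $x_2+1,\ \bar x_3-2$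 if $3z_4+(z_2+(z_1)_-)_->0\ge z_3+(z_1)_+$; - $x_1+1,\ x_3-1,\ \bar x_3-1$ if $z_3+(3z_4+(z_1+z_2)_-)_->0\ge z_1$; - $\bar x_1-1$ if $z_1+(z_3+(3z_4+(z_2)_-)_-)_->0$. $\tilde e_1$: $\bar x_2+1,\bar x_1-1$ if $\bar x_2-\bar x_3\ge(x_2-x_3)_+$; $x_3+1,\bar x_3-1$ if $\bar x_2-\bar x_3<0\le x_3-x_2$; $x_1+1,x_2-1$ if $(\bar x_2-\bar x_3)_+<x_2-x_3$. $\tilde f_1$: $x_1-1,x_2+1$ if $(\bar x_2-\bar x_3)_+\le x_2-x_3$; $x_3-1,\bar x_3+1$ if $\bar x_2-\bar x_3\le0<x_3-x_2$; $\bar x_2-1,\bar x_1+1$ if $\bar x_2-\bar x_3>(x_2-x_3)_+$. $\tilde e_2$: $\bar x_3+2,\bar x_2-1$ if $\bar x_3\ge x_3$; $x_2+1,x_3-2$ if $\bar x_3<x_3$. $\quad\tilde f_2$: $x_2-1,x_3+2$ if $\bar x_3\le x_3$; $\bar x_3-2,\bar x_2+1$ if $\bar x_3>x_3$. The tableau of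 $b$ is the row $1^{x_1}2^{x_2}3^{\lfloor x_3/2\rfloor}0^{r}\bar3^{\lfloor\bar x_3/2\rfloor}\bar2^{\bar x_2}\bar1^{\bar x_1}$, where $r\in\{0,1\}$, $r\equiv x_3 \pmod 2$; the tableau of the zero tuple is $(\phi)$. Put $u_l=(l,0,0,0,0,0)$. **Words.** Put $B(1)=\{1,2,3,0,\bar3,\bar2,\bar1\}$ and $B(10)=\{10,\ 1\bar3,\ 1\bar2,\ 2\bar2,\ 2\bar1,\ 3\bar1,\ 0\bar1\}$, $B(12)=\{12,\ 13,\ 23,\ 20,\ 2\bar3,\ 30,\ 3\bar3,\ 3\bar2,\ 00,\ 0\bar3,\ 0\bar2,\ \bar3\bar2,\ \bar3\bar1,\ \bar2\bar1\}$, $B(11)=\{11,\ 21,\ 22,\ 31,\ 32,\ 33,\ 01,\ 02,\ 03,\ \bar31,\ \bar32,\ \bar33,\ \bar30,\ \bar3\bar3,\ \bar21,\ \bar22,\ \bar23,\ \bar20,\ \bar2\bar3,\ \bar2\bar2,\ \bar11,\ \bar12,\ \bar13,\ \bar10,\ \bar1\bar3,\ \bar1\bar2,\ \bar1\bar1\}$,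 $B(112)=\{112,\ 113,\ 212,\ 213,\ 223,\ 220,\ 22\bar3,\ 312,\ 313,\ 323,\ 320,\ 32\bar3,\ 330,\ 33\bar3,\ 33\bar2,\ 012,\ 013,\ 023,\ 020,\ 02\bar3,\ 030,\ 03\bar3,\ 03\bar2,\ \bar312,\ \bar313,\ \bar323,\ \bar320,\ \bar32\bar3,\ \bar330,\ \bar33\bar3,\ \bar33\bar2,\ \bar300,\ \bar30\bar3,\ \bar30\bar2,\ \bar3\bar3\bar2,\ \bar3\bar3\bar1,\ \bar212,\ \bar213,\ \bar223,\ \bar220,\ \bar22\bar3,\ \bar230,\ \bar23\bar3,\ \bar23\bar2,\ \bar200,\ \bar20\bar3,\ \bar20\bar2,\ \bar2\bar3\bar2,\ \bar2\bar3\bar1,\ \bar2\bar2\bar1,\ \bar112,\ \bar113,\ \bar123,\ \bar120,\ \bar12\bar3,\ \bar130,\ \bar13\bar3,\ \bar13\bar2,\ \bar100,\ \bar10\bar3,\ \bar10\bar2,\ \bar1\bar3\bar2,\ \bar1\bar3\bar1,\ \bar1\bar2\bar1\}$, $B(121)=\{121,\ 131,\ 122,\ 231,\ 201,\ 2\bar31,\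 2\bar32,\ 132,\ 133,\ 301,\ 3\bar31,\ 3\bar32,\ 3\bar21,\ 3\bar22,\ 3\bar23,\ 232,\ 233,\ 001,\ 0\bar31,\ 0\bar32,\ 0\bar21,\ 0\bar22,\ 0\bar23,\ 202,\ 203,\ 2\bar33,\ 2\bar30,\ 2\bar3\bar3,\ \bar3\bar21,\ \bar3\bar22,\ \bar3\bar23,\ \bar3\bar11,\ \bar3\bar12,\ \bar3\bar13,\ \bar3\bar10,\ \bar3\bar1\bar3,\ 302,\ 303,\ 3\bar33,\ 3\bar30,\ 3\bar3\bar3,\ 3\bar20,\ 3\bar2\bar3,\ 3\bar2\bar2,\ \bar2\bar11,\ \bar2\bar12,\ \bar2\bar13,\ \bar2\bar10,\ \bar2\bar1\bar3,\ \bar2\bar1\bar2,\ 002,\ 003,\ 0\bar33,\ 0\bar30,\ 0\bar3\bar3,\ 0\bar20,\ 0\bar2\bar3,\ 0\bar2\bar2,\ \bar3\bar20,\ \bar3\bar2\bar3,\ \bar3\bar2\bar2,\ \bar3\bar1\bar2,\ \bar3\bar1\bar1,\ \bar2\bar1\bar1\}$. Let $\xi:B(10)\to B(1)$ and $\eta:B(121)\to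 B(112)$ be the bijections sending the $j$-th listed element to the $j$-th listed element. **Column insertion** $(\beta\to T)$ of a letter into a tableau with at most two rows: insert $\beta$ into the leftmost column of $T$. If $T=\emptyset$, the result is the single box $\beta$. Otherwise: - Column $\alpha$ with $\alpha\beta\in B(12)$: the column becomes $\alpha$ over $\beta$; stop. - Column $\alpha$ with $\alpha\beta\in B(11)$: the column becomes $\beta$, and $\alpha$ is inserted into the remaining columns. - Column $\alpha$ with $\alpha\beta\in B(10)$: the column is removed, and $\xi(\alpha\beta)$ is inserted into the remaining columns. - Column $\alpha_1$ over $\alpha_2$ with $\alpha_1\alpha_2\beta\in B(121)$: the column becomes $\alpha'$ over $\beta'$ and $\gamma'$ is inserted into the remaining columns, where $\gamma'\alpha'\beta'=\eta(\alpha_1\alpha_2\beta)$. - Column $\alpha$ with $\alpha=\phi$ or $\beta=\phi$ or $(\alpha,\beta)=(1,\bar1)$: the column is removed if $(\alpha,\beta)=(\phi,\phi)$ or $(1,\bar1)$; otherwise it becomes the one of $\alpha,\beta$ that is not $\phi$; stop. **Reverse bumping** of a tableau of shape $(p+q,q)$, $q\in\{0,1\}$: repeatedly take the rightmost box of the first row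 and move its letter $x$ leftwards through the columns. A column $\beta$ (with $x\beta\in B(11)$) becomes $x$ and sends on $\beta$; a column $\alpha'$ over $\beta'$ becomes $\alpha$ over $\beta$ and sends on $\gamma$, where $\alpha\beta\gamma=\eta^{-1}(x\alpha'\beta')$. The letter that leaves the first column is bumped out. When only one column $\alpha$ over $\beta$ (with $\alpha\beta\in B(12)$) is left, $\beta$ is bumped out and then $\alpha$. Call the letters bumped out, in this order, $t_1,\dots,t_N$, $N=p+2q$. **Algorithm.** Let $b_1\otimes b_2\in B_l\otimes B_1$ have tableaux $(\alpha_1\,\dots\,\alpha_n)$ and $(\beta)$, and let $b_1*b_2=(\beta\to b_1)$, with first row of length $(b_1*b_2)_1$. Put $\gamma=\xi(\alpha_1\beta)$ if $\alpha_1\beta\in B(10)$, and call $b_1\otimes b_2$ *special* if $\alpha_1\beta\in B(10)$ and either $n=1$ or $\alpha_2\gamma\in B(11)$. Set $$H(b_1\otimes b_2)=\begin{cases}-2&\text{if } b_1\otimes b_2\text{ is special},\\ \max(-2,\ (b_1*b_2)_1-l-1)&\text{otherwise.}\end{cases}$$ Let $t_1,\dots,t_N$ be obtained from $b_1*b_2$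 by reverse bumping, and $\mathscr T_r=t_1\,t_2\dots t_r$. Put - (I) $b_2'\otimes b_1'=(t_N)\otimes(\mathscr T_{N-1})$; - (II) $b_2'\otimes b_1'=(t')\otimes(\mathscr T_{N-1}\,t'')$ with $t't''=\xi^{-1}(t_N)$; - (III) $b_2'\otimes b_1'=(1)\otimes(\mathscr T_N\,\bar1)$; - (IV) $b_2'\otimes b_1'=(\mathscr T_N)\otimes(\phi)$; - (V) $b_2'\otimes b_1'=(\phi)\otimes(\mathscr T_N)$; in the following cases. - $\alpha_1\beta\in B(11)$: III if $n<l-1$, V if $n=l-1$, I if $n=l$. - $\alpha_1\beta\in B(12)$: II if $n<l$, I if $n=l$. - $\alpha_1\beta\in B(10)$: II if $b_1\otimes b_2$ is special, I otherwise. - $(\alpha_1,\beta)=(1,\bar1)$: III if $n=1$, IV if $n=2$, I if $n>2$. - $b_1\ne(\phi)$, $b_2=(\phi)$: IV if $l=1$; V if $l\ne1$, $n<l$; I if $l\neq 1$, $n=l$. - $b_1=(\phi)$, $b_2\ne(\phi)$: V if $l=1$, III if $l\ne1$. - $b_1=b_2=(\phi)$: $b_2'\otimes b_1'=(\phi)\otimes(\phi)$.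 **Theorem.** For every $b_1\otimes b_2\in B_l\otimes B_1$ all steps of the algorithm can be carried out, and $b_2'\otimes b_1'\in B_1\otimes B_l$. The map $$R:\mathrm{Aff}(B_l)\otimes\mathrm{Aff}(B_1)\to\mathrm{Aff}(B_1)\otimes\mathrm{Aff}(B_l),\qquad z^{\gamma_1}b_1\otimes z^{\gamma_2}b_2\mapsto z^{\gamma_2+H(b_1\otimes b_2)}b_2'\otimes z^{\gamma_1-H(b_1\otimes b_2)}b_1'$$ is the combinatorial $R$ matrix normalized by $H(u_l\otimes u_1)=0$: it is a combinatorial $R$ matrix whose energy function satisfies this normalization, and it is the only one. -/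

import Mathlib

namespace D43

/-! ## Crystals -/

/-- The iterate `g ∘ ⋯ ∘ g` (`n` times) of a partial map, the value `none` playing the role of `0`. -/
def iter {B : Type} (g : B → Option B) : ℕ → B → Option B
  | 0, b => some b
  | n + 1, b => (iter g n b).bind g

/-- A crystal: Kashiwara operators `e i`, `f i : B → B ⊔ {0}`, with `none` for `0`. -/
structure Crystal (I B : Type) where
  e : I → B → Option B
  f : I → B → Option B
  nilpotent : ∀ i b, ∃ n, 0 < n ∧ iter (e i) n b = none ∧ iter (f i) n b = none
  inverse : ∀ i b b', f i b = some b' ↔ e i b' = some b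

/-- `max {n ≥ 0 | gⁿ b ≠ 0}`. -/
noncomputable def stringLength {B : Type} (g : B → Option B) (b : B) : ℕ :=
  sSup {n | iter g n b ≠ none}

namespace Crystal

variable {I B B' : Type}

noncomputable def ε (C : Crystal I B) (i : I) (b : B) : ℕ := stringLength (C.e i) b

noncomputable def φ (C : Crystal I B) (i : I) (b : B) : ℕ := stringLength (C.f i) b

end Crystal

theorem iter_succ' {B : Type} (g : B → Option B) (n : ℕ) (b : B) :
    iter g (n + 1) b = (g b).bind (iter g n) := by
  induction n with
  | zero => simp [iter]
  | succ n ih =>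
    rw [iter, ih]
    cases h : g b with
    | none => simp
    | some c => simp [iter]

theorem iter_none_mono {B : Type} {g : B → Option B} {b : B} {m n : ℕ} (h : m ≤ n)
    (hm : iter g m b = none) : iter g n b = none := by
  induction n, h using Nat.le_induction with
  | base => exact hm
  | succ n _ ih => simp [iter, ih]

theorem bddAbove_of_none {B : Type} {g : B → Option B} {b : B} {n : ℕ}
    (h : iter g n b = none) : BddAbove {n | iter g n b ≠ none} := by
  refine ⟨n, fun m hm => ?_⟩
  by_contra hlt
  exact hm (iter_none_mono (by omega) h)

theorem stringLength_none {B : Type} {g : B → Option B} {b : B} (h : g b = none) :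
    stringLength g b = 0 := by
  have h1 : iter g 1 b = none := by simp [iter, h]
  refine Nat.le_zero.mp (csSup_le ⟨0, by simp [iter]⟩ fun m hm => ?_)
  by_contra hlt
  exact hm (iter_none_mono (by omega) h1)

theorem stringLength_some {B : Type} {g : B → Option B} {b c : B} (h : g b = some c)
    {n : ℕ} (hn : iter g n c = none) : stringLength g b = stringLength g c + 1 := by
  have hs : ∀ k, iter g (k + 1) b = iter g k c := fun k => by rw [iter_succ', h]; rfl
  have hb : BddAbove {n | iter g n c ≠ none} := bddAbove_of_none hn
  have hb' : BddAbove {n | iter g n b ≠ none} := bddAbove_of_none (n := n + 1) (by rw [hs, hn])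
  apply le_antisymm
  · refine csSup_le ⟨0, by simp [iter]⟩ fun m hm => ?_
    rcases m with _ | m
    · omega
    · have : m ≤ stringLength g c := le_csSup hb (by simpa [hs] using hm)
      omega
  · have hmem : stringLength g c ∈ {n | iter g n c ≠ none} :=
      Nat.sSup_mem ⟨0, by simp [iter]⟩ hb
    exact le_csSup hb' (by simpa [hs] using hmem)

theorem iter_eq_none_of_measure {B : Type} {g : B → Option B} (μ : B → ℕ)
    (h : ∀ b c, g b = some c → μ c < μ b) (n : ℕ) (b : B) (hb : μ b < n) :
    iter g n b = none := by
  induction n generalizing b with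
  | zero => omega
  | succ n ih =>
    rw [iter_succ']
    cases hg : g b with
    | none => rfl
    | some c => exact ih c (by have := h b c hg; omega)

namespace Crystal

variable {I B B' : Type}

theorem φ_f (C : Crystal I B) {i : I} {b c : B} (h : C.f i b = some c) :
    C.φ i b = C.φ i c + 1 := by
  obtain ⟨n, -, -, hn⟩ := C.nilpotent i c
  exact stringLength_some h hn

theorem ε_e (C : Crystal I B) {i : I} {b c : B} (h : C.e i b = some c) :
    C.ε i b = C.ε i c + 1 := by
  obtain ⟨n, -, hn, -⟩ := C.nilpotent i c
  exact stringLength_some h hn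

open Classical in
/-- `e i` on `B ⊗ B'`; the pair `(b, b')` stands for `b ⊗ b'`. -/
noncomputable def tensorE (C : Crystal I B) (C' : Crystal I B') (i : I) (x : B × B') :
    Option (B × B') :=
  if C'.ε i x.2 ≤ C.φ i x.1 then (C.e i x.1).map (fun c => (c, x.2))
  else (C'.e i x.2).map (fun c => (x.1, c))

open Classical in
/-- `f i` on `B ⊗ B'`. -/
noncomputable def tensorF (C : Crystal I B) (C' : Crystal I B') (i : I) (x : B × B') :
    Option (B × B') :=
  if C'.ε i x.2 < C.φ i x.1 then (C.f i x.1).map (fun c => (c, x.2))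
  else (C'.f i x.2).map (fun c => (x.1, c))

theorem tensor_inverse (C : Crystal I B) (C' : Crystal I B') (i : I) (x y : B × B') :
    tensorF C C' i x = some y ↔ tensorE C C' i y = some x := by
  obtain ⟨b, c⟩ := x
  obtain ⟨b', c'⟩ := y
  unfold tensorE tensorF
  dsimp only
  constructor
  · intro h
    split_ifs at h with h1
    · obtain ⟨d, hd, hd'⟩ := Option.map_eq_some_iff.mp h
      obtain ⟨rfl, rfl⟩ := Prod.mk.inj hd'
      have := C.φ_f hd
      rw [if_pos (by omega), (C.inverse i b d).mp hd]
      rfl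
    · obtain ⟨d, hd, hd'⟩ := Option.map_eq_some_iff.mp h
      obtain ⟨rfl, rfl⟩ := Prod.mk.inj hd'
      have he := (C'.inverse i c d).mp hd
      have := C'.ε_e he
      rw [if_neg (by omega), he]
      rfl
  · intro h
    split_ifs at h with h1
    · obtain ⟨d, hd, hd'⟩ := Option.map_eq_some_iff.mp h
      obtain ⟨rfl, rfl⟩ := Prod.mk.inj hd'
      have hf := (C.inverse i d b').mpr hd
      have := C.φ_f hf
      rw [if_pos (by omega), hf]
      rfl
    · obtain ⟨d, hd, hd'⟩ := Option.map_eq_some_iff.mp h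
      obtain ⟨rfl, rfl⟩ := Prod.mk.inj hd'
      have hf := (C'.inverse i d c').mpr hd
      have := C'.ε_e hd
      rw [if_neg (by omega), hf]
      rfl

/-- The tensor product of two crystals. -/
noncomputable def tensor (C : Crystal I B) (C' : Crystal I B') : Crystal I (B × B') where
  e := tensorE C C'
  f := tensorF C C'
  nilpotent i x := by
    have he : ∀ x y : B × B', tensorE C C' i x = some y →
        C.ε i y.1 + C'.ε i y.2 < C.ε i x.1 + C'.ε i x.2 := by
      intro x y h
      unfold tensorE at h
      split_ifs at h
      all_goals
        obtain ⟨d, hd, rfl⟩ := Option.map_eq_some_iff.mp h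
        have := Crystal.ε_e _ hd
        dsimp only
        omega
    have hf : ∀ x y : B × B', tensorF C C' i x = some y →
        C.φ i y.1 + C'.φ i y.2 < C.φ i x.1 + C'.φ i x.2 := by
      intro x y h
      unfold tensorF at h
      split_ifs at h
      all_goals
        obtain ⟨d, hd, rfl⟩ := Option.map_eq_some_iff.mp h
        have := Crystal.φ_f _ hd
        dsimp only
        omega
    refine ⟨C.ε i x.1 + C'.ε i x.2 + (C.φ i x.1 + C'.φ i x.2) + 1, by omega, ?_, ?_⟩
    · exact iter_eq_none_of_measure (fun x => C.ε i x.1 + C'.ε i x.2) he _ _ (by omega)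
    · exact iter_eq_none_of_measure (fun x => C.φ i x.1 + C'.φ i x.2) hf _ _ (by omega)
  inverse := tensor_inverse C C'

/-- `ι : B ⊗ B' → B' ⊗ B` is an isomorphism of crystals. -/
def IsIso (C : Crystal I B) (C' : Crystal I B') (ι : B × B' → B' × B) : Prop :=
  Function.Bijective ι ∧
    ∀ i x, (C'.tensor C).e i (ι x) = ((C.tensor C').e i x).map ι ∧
      (C'.tensor C).f i (ι x) = ((C.tensor C').f i x).map ι

open Classical in
/-- `H` is an energy function for the isomorphism `ι : b ⊗ b' ↦ (ι (b, b')).1 ⊗ (ι (b, b')).2`;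
`o` is the affine index. -/
def IsEnergy (C : Crystal I B) (C' : Crystal I B') (o : I) (ι : B × B' → B' × B)
    (H : B × B' → ℤ) : Prop :=
  ∀ i x y, (C.tensor C').e i x = some y →
    H y =
      if i = o ∧ C'.ε o x.2 ≤ C.φ o x.1 ∧ C.ε o (ι x).2 ≤ C'.φ o (ι x).1 then H x + 1
      else if i = o ∧ C.φ o x.1 < C'.ε o x.2 ∧ C'.φ o (ι x).1 < C.ε o (ι x).2 then H x - 1
      else H x

end Crystal

/-- The affinization as a set: `(d, b)` stands for `z^d b`. -/
abbrev Aff (B : Type) : Type := ℤ × B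

/-- `z^d b ⊗ z^{d'} b' ↦ z^{d' + H(b ⊗ b')} b̃' ⊗ z^{d - H(b ⊗ b')} b̃`, where
`ι(b ⊗ b') = b̃' ⊗ b̃`. -/
def affineMap {B B' : Type} (ι : B × B' → B' × B) (H : B × B' → ℤ) (x : Aff B × Aff B') :
    Aff B' × Aff B :=
  ((x.2.1 + H (x.1.2, x.2.2), (ι (x.1.2, x.2.2)).1),
    (x.1.1 - H (x.1.2, x.2.2), (ι (x.1.2, x.2.2)).2))

/-- `R` is a combinatorial `R` matrix `Aff(B) ⊗ Aff(B') → Aff(B') ⊗ Aff(B)` whose energy function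
vanishes at `u`. -/
def IsNormalizedCombinatorialR {I B B' : Type} (C : Crystal I B) (C' : Crystal I B') (o : I) (u : B × B')
    (R : Aff B × Aff B' → Aff B' × Aff B) : Prop :=
  ∃ (ι : B × B' → B' × B) (H : B × B' → ℤ),
    C.IsIso C' ι ∧ C.IsEnergy C' o ι H ∧ H u = 0 ∧ R = affineMap ι H

/-! ## The crystals `B_l` -/

/-- `(x₁, x₂, x₃, x̄₃, x̄₂, x̄₁)`, with `yᵢ` for `x̄ᵢ`. -/
@[ext]
structure Coord where
  x1 : ℤ
  x2 : ℤ
  x3 : ℤ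
  y3 : ℤ
  y2 : ℤ
  y1 : ℤ

namespace Coord

/-- `s(b)`; the division is exact when `x₃ ≡ x̄₃ mod 2`. -/
def s (b : Coord) : ℤ := b.x1 + b.x2 + (b.x3 + b.y3) / 2 + b.y2 + b.y1

/-- The conditions cutting out `B_l`. -/
def Mem (l : ℕ) (b : Coord) : Prop :=
  0 ≤ b.x1 ∧ 0 ≤ b.x2 ∧ 0 ≤ b.x3 ∧ 0 ≤ b.y3 ∧ 0 ≤ b.y2 ∧ 0 ≤ b.y1 ∧
    b.x3 % 2 = b.y3 % 2 ∧ b.s ≤ l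

instance (l : ℕ) (b : Coord) : Decidable (b.Mem l) := by
  unfold Mem
  infer_instance

def z1 (b : Coord) : ℤ := b.y1 - b.x1
def z2 (b : Coord) : ℤ := b.y2 - b.y3
def z3 (b : Coord) : ℤ := b.x3 - b.x2
/-- The division is exact when `x₃ ≡ x̄₃ mod 2`. -/
def z4 (b : Coord) : ℤ := (b.y3 - b.x3) / 2

end Coord

/-- `(x)₊` -/
def pos (x : ℤ) : ℤ := max x 0
/-- `(x)₋` -/
def neg (x : ℤ) : ℤ := min x 0

open Coord in
/-- The change of coordinates made by `e₀`, before checking that the result lies in `B_l`. The six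
conditions exclude one another and cover all cases. -/
def rawE0 (b : Coord) : Option Coord :=
  if z1 b + pos (z2 b + pos (3 * z4 b + pos (z3 b))) < 0 then
    some { b with x1 := b.x1 - 1 }
  else if z2 b + pos (3 * z4 b + pos (z1 b + z3 b)) < 0 ∧ 0 ≤ z1 b then
    some { b with x3 := b.x3 - 1, y3 := b.y3 - 1, y1 := b.y1 + 1 }
  else if 3 * z4 b + pos (z3 b + pos (z1 b)) < 0 ∧ 0 ≤ z2 b + neg (z1 b) then
    some { b with x3 := b.x3 - 2, y2 := b.y2 + 1 }
  else if 3 * z4 b + neg (z2 b + neg (z1 b)) ≥ 0 ∧ 0 > z3 b + pos (z1 b) then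
    some { b with x2 := b.x2 - 1, y3 := b.y3 + 2 }
  else if z3 b + neg (3 * z4 b + neg (z1 b + z2 b)) ≥ 0 ∧ 0 > z1 b then
    some { b with x1 := b.x1 - 1, x3 := b.x3 + 1, y3 := b.y3 + 1 }
  else if z1 b + neg (z3 b + neg (3 * z4 b + neg (z2 b))) ≥ 0 then
    some { b with y1 := b.y1 + 1 }
  else none

open Coord in
/-- The change of coordinates made by `f₀`. -/
def rawF0 (b : Coord) : Option Coord :=
  if z1 b + pos (z2 b + pos (3 * z4 b + pos (z3 b))) ≤ 0 then
    some { b with x1 := b.x1 + 1 }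
  else if z2 b + pos (3 * z4 b + pos (z1 b + z3 b)) ≤ 0 ∧ 0 < z1 b then
    some { b with x3 := b.x3 + 1, y3 := b.y3 + 1, y1 := b.y1 - 1 }
  else if 3 * z4 b + pos (z3 b + pos (z1 b)) ≤ 0 ∧ 0 < z2 b + neg (z1 b) then
    some { b with x3 := b.x3 + 2, y2 := b.y2 - 1 }
  else if 3 * z4 b + neg (z2 b + neg (z1 b)) > 0 ∧ 0 ≥ z3 b + pos (z1 b) then
    some { b with x2 := b.x2 + 1, y3 := b.y3 - 2 }
  else if z3 b + neg (3 * z4 b + neg (z1 b + z2 b)) > 0 ∧ 0 ≥ z1 b then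
    some { b with x1 := b.x1 + 1, x3 := b.x3 - 1, y3 := b.y3 - 1 }
  else if z1 b + neg (z3 b + neg (3 * z4 b + neg (z2 b))) > 0 then
    some { b with y1 := b.y1 - 1 }
  else none

def rawE1 (b : Coord) : Option Coord :=
  if b.y2 - b.y3 ≥ pos (b.x2 - b.x3) then some { b with y2 := b.y2 + 1, y1 := b.y1 - 1 }
  else if b.y2 - b.y3 < 0 ∧ 0 ≤ b.x3 - b.x2 then
    some { b with x3 := b.x3 + 1, y3 := b.y3 - 1 }
  else if pos (b.y2 - b.y3) < b.x2 - b.x3 then some { b with x1 := b.x1 + 1, x2 := b.x2 - 1 }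
  else none

def rawF1 (b : Coord) : Option Coord :=
  if pos (b.y2 - b.y3) ≤ b.x2 - b.x3 then some { b with x1 := b.x1 - 1, x2 := b.x2 + 1 }
  else if b.y2 - b.y3 ≤ 0 ∧ 0 < b.x3 - b.x2 then
    some { b with x3 := b.x3 - 1, y3 := b.y3 + 1 }
  else if b.y2 - b.y3 > pos (b.x2 - b.x3) then some { b with y2 := b.y2 - 1, y1 := b.y1 + 1 }
  else none

def rawE2 (b : Coord) : Option Coord :=
  if b.y3 ≥ b.x3 then some { b with y3 := b.y3 + 2, y2 := b.y2 - 1 }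
  else some { b with x2 := b.x2 + 1, x3 := b.x3 - 2 }

def rawF2 (b : Coord) : Option Coord :=
  if b.y3 ≤ b.x3 then some { b with x2 := b.x2 - 1, x3 := b.x3 + 2 }
  else some { b with y3 := b.y3 - 2, y2 := b.y2 + 1 }

def rawE : Fin 3 → Coord → Option Coord
  | 0 => rawE0
  | 1 => rawE1
  | 2 => rawE2

def rawF : Fin 3 → Coord → Option Coord
  | 0 => rawF0
  | 1 => rawF1
  | 2 => rawF2

/-- The set underlying `B_l`. -/
def Elt (l : ℕ) : Type := {b : Coord // b.Mem l}

/-- A tuple as an element of `B_l`, or `0` if it does not lie in `B_l`. -/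
def ofCoord (l : ℕ) (b : Coord) : Option (Elt l) :=
  if h : b.Mem l then some ⟨b, h⟩ else none

def opE (l : ℕ) (i : Fin 3) (b : Elt l) : Option (Elt l) := (rawE i b.1).bind (ofCoord l)

def opF (l : ℕ) (i : Fin 3) (b : Elt l) : Option (Elt l) := (rawF i b.1).bind (ofCoord l)

theorem ofCoord_eq_some {l : ℕ} {b : Coord} {c : Elt l} : ofCoord l b = some c ↔ b = c.1 := by
  unfold ofCoord
  constructor
  · intro h
    split_ifs at h with hb
    rw [← Option.some.inj h]
  · rintro rfl
    rw [dif_pos c.2]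
    rfl

theorem opE_eq_some {l : ℕ} {i : Fin 3} {b c : Elt l} :
    opE l i b = some c ↔ rawE i b.1 = some c.1 := by
  simp [opE, Option.bind_eq_some_iff, ofCoord_eq_some]

theorem opF_eq_some {l : ℕ} {i : Fin 3} {b c : Elt l} :
    opF l i b = some c ↔ rawF i b.1 = some c.1 := by
  simp [opF, Option.bind_eq_some_iff, ofCoord_eq_some]

theorem add_pos_lt (a b : ℤ) : a + pos b < 0 ↔ a < 0 ∧ a + b < 0 := by
  unfold pos
  omega

theorem add_pos_le (a b : ℤ) : a + pos b ≤ 0 ↔ a ≤ 0 ∧ a + b ≤ 0 := by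
  unfold pos
  omega

theorem le_add_neg (a b : ℤ) : 0 ≤ a + neg b ↔ 0 ≤ a ∧ 0 ≤ a + b := by
  unfold neg
  omega

theorem lt_add_neg (a b : ℤ) : 0 < a + neg b ↔ 0 < a ∧ 0 < a + b := by
  unfold neg
  omega

theorem raw_inverse0 (b c : Coord) (hb : b.x3 % 2 = b.y3 % 2) (hc : c.x3 % 2 = c.y3 % 2) :
    rawF0 b = some c ↔ rawE0 c = some b := by
  obtain ⟨x1, x2, x3, y3, y2, y1⟩ := b
  obtain ⟨u1, u2, u3, v3, v2, v1⟩ := c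
  have hk : 2 * ((y3 - x3) / 2) = y3 - x3 := by dsimp only at hb; omega
  have hm : 2 * ((v3 - u3) / 2) = v3 - u3 := by dsimp only at hc; omega
  clear hb hc
  unfold rawF0 rawE0
  simp only [gt_iff_lt, ge_iff_le, Coord.z1, Coord.z2, Coord.z3, Coord.z4]
  generalize (y3 - x3) / 2 = k at hk ⊢
  generalize (v3 - u3) / 2 = m at hm ⊢
  simp only [← add_assoc, add_pos_lt, add_pos_le, le_add_neg, lt_add_neg]
  constructor
  · intro h
    split_ifs at h with h1 h2 h3 h4 h5 h6
    · simp only [Option.some.injEq, Coord.mk.injEq] at h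
      rw [if_pos (by omega)]
      simp only [Option.some.injEq, Coord.mk.injEq]
      omega
    · simp only [Option.some.injEq, Coord.mk.injEq] at h
      clear h1
      rw [if_neg (by omega), if_pos (by omega)]
      simp only [Option.some.injEq, Coord.mk.injEq]
      omega
    · simp only [Option.some.injEq, Coord.mk.injEq] at h
      clear h1 h2
      rw [if_neg (by omega), if_neg (by omega), if_pos (by omega)]
      simp only [Option.some.injEq, Coord.mk.injEq]
      omega
    · simp only [Option.some.injEq, Coord.mk.injEq] at h
      clear h1 h2 h3
      rw [if_neg (by omega), if_neg (by omega), if_neg (by omega), if_pos (by omega)]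
      simp only [Option.some.injEq, Coord.mk.injEq]
      omega
    · simp only [Option.some.injEq, Coord.mk.injEq] at h
      clear h1 h2 h3 h4
      rw [if_neg (by omega), if_neg (by omega), if_neg (by omega), if_neg (by omega), if_pos (by omega)]
      simp only [Option.some.injEq, Coord.mk.injEq]
      omega
    · simp only [Option.some.injEq, Coord.mk.injEq] at h
      clear h1 h2 h3 h4 h5
      rw [if_neg (by omega), if_neg (by omega), if_neg (by omega), if_neg (by omega), if_neg (by omega), if_pos (by omega)]
      simp only [Option.some.injEq, Coord.mk.injEq]
      omega
  · intro h
    split_ifs at h with h1 h2 h3 h4 h5 h6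
    · simp only [Option.some.injEq, Coord.mk.injEq] at h
      rw [if_pos (by omega)]
      simp only [Option.some.injEq, Coord.mk.injEq]
      omega
    · simp only [Option.some.injEq, Coord.mk.injEq] at h
      clear h1
      rw [if_neg (by omega), if_pos (by omega)]
      simp only [Option.some.injEq, Coord.mk.injEq]
      omega
    · simp only [Option.some.injEq, Coord.mk.injEq] at h
      clear h1 h2
      rw [if_neg (by omega), if_neg (by omega), if_pos (by omega)]
      simp only [Option.some.injEq, Coord.mk.injEq]
      omega
    · simp only [Option.some.injEq, Coord.mk.injEq] at h
      clear h1 h2 h3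
      rw [if_neg (by omega), if_neg (by omega), if_neg (by omega), if_pos (by omega)]
      simp only [Option.some.injEq, Coord.mk.injEq]
      omega
    · simp only [Option.some.injEq, Coord.mk.injEq] at h
      clear h1 h2 h3 h4
      rw [if_neg (by omega), if_neg (by omega), if_neg (by omega), if_neg (by omega), if_pos (by omega)]
      simp only [Option.some.injEq, Coord.mk.injEq]
      omega
    · simp only [Option.some.injEq, Coord.mk.injEq] at h
      clear h1 h2 h3 h4 h5
      rw [if_neg (by omega), if_neg (by omega), if_neg (by omega), if_neg (by omega), if_neg (by omega), if_pos (by omega)]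
      simp only [Option.some.injEq, Coord.mk.injEq]
      omega

theorem raw_inverse {l : ℕ} (i : Fin 3) (b c : Coord) (hb : b.Mem l) (hc : c.Mem l) :
    rawF i b = some c ↔ rawE i c = some b := by
  have hb' : b.x3 % 2 = b.y3 % 2 := hb.2.2.2.2.2.2.1
  have hc' : c.x3 % 2 = c.y3 % 2 := hc.2.2.2.2.2.2.1
  fin_cases i
  · exact raw_inverse0 b c hb' hc'
  · obtain ⟨x1, x2, x3, y3, y2, y1⟩ := b
    obtain ⟨u1, u2, u3, v3, v2, v1⟩ := c
    unfold rawF rawE rawF1 rawE1 pos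
    constructor
    all_goals
      intro h
      dsimp only at h ⊢
      split_ifs at h
      all_goals
        simp only [Option.some.injEq, Coord.mk.injEq] at h
        split_ifs
        all_goals
          try simp only [Option.some.injEq, Coord.mk.injEq]
          omega
  · obtain ⟨x1, x2, x3, y3, y2, y1⟩ := b
    obtain ⟨u1, u2, u3, v3, v2, v1⟩ := c
    unfold rawF rawE rawF2 rawE2
    dsimp only
    dsimp only at hb' hc'
    split_ifs
    all_goals
      simp only [Option.some.injEq, Coord.mk.injEq]
      omega

theorem op_inverse (l : ℕ) (i : Fin 3) (b c : Elt l) :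
    opF l i b = some c ↔ opE l i c = some b := by
  rw [opF_eq_some, opE_eq_some]
  exact raw_inverse i b.1 c.1 b.2 c.2

/-- A quantity that every `f i` lowers and every `e i` raises. -/
def level : Fin 3 → Coord → ℤ
  | 0, b => 3 * b.y1 + 2 * b.y2 + b.y3 - b.x3 - 2 * b.x2 - 3 * b.x1
  | 1, b => 3 * b.x1 + b.x3 - b.y3 + b.y2
  | 2, b => b.x2 + b.y3

theorem level_lt {l : ℕ} {i : Fin 3} {b c : Elt l} (h : opF l i b = some c) :
    level i c.1 < level i b.1 := by
  rw [opF_eq_some] at h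
  obtain ⟨⟨x1, x2, x3, y3, y2, y1⟩, hb⟩ := b
  obtain ⟨⟨u1, u2, u3, v3, v2, v1⟩, hc⟩ := c
  fin_cases i
  · unfold rawF rawF0 at h
    dsimp only [level] at h ⊢
    split_ifs at h
    all_goals
      simp only [Option.some.injEq, Coord.mk.injEq] at h
      omega
  · unfold rawF rawF1 at h
    dsimp only [level] at h ⊢
    split_ifs at h
    all_goals
      simp only [Option.some.injEq, Coord.mk.injEq] at h
      omega
  · unfold rawF rawF2 at h
    dsimp only [level] at h ⊢
    split_ifs at h
    all_goals
      simp only [Option.some.injEq, Coord.mk.injEq] at h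
      omega

theorem level_bound {l : ℕ} (i : Fin 3) (b : Elt l) :
    -(6 * l : ℤ) ≤ level i b.1 ∧ level i b.1 ≤ 6 * l := by
  obtain ⟨⟨x1, x2, x3, y3, y2, y1⟩, hb⟩ := b
  simp only [Coord.Mem, Coord.s] at hb
  fin_cases i <;> dsimp only [level] <;> omega

/-- The `U'_q(D₄⁽³⁾)`-crystal `B_l`. -/
def crystal (l : ℕ) : Crystal (Fin 3) (Elt l) where
  e := opE l
  f := opF l
  nilpotent i b := by
    have hb := level_bound i b
    refine ⟨12 * l + 1, by omega, ?_, ?_⟩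
    · refine iter_eq_none_of_measure (fun c => (6 * l - level i c.1).toNat) ?_ _ b (by omega)
      intro c d h
      have h1 := level_lt ((op_inverse l i d c).mpr h)
      have := level_bound i c
      have := level_bound i d
      omega
    · refine iter_eq_none_of_measure (fun c => (level i c.1 + 6 * l).toNat) ?_ _ b (by omega)
      intro c d h
      have h1 := level_lt h
      have := level_bound i c
      have := level_bound i d
      omega
  inverse := op_inverse l

/-- `u_l = (l, 0, 0, 0, 0, 0)`. -/
def u (l : ℕ) : Elt l := ⟨⟨l, 0, 0, 0, 0, 0⟩, by simp [Coord.Mem, Coord.s]⟩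

/-! ## Tableaux, column insertion and reverse bumping -/

/-- The letters `1, 2, 3, 0, 3̄, 2̄, 1̄` (with `mᵢ` for `ī`) and `ϕ`. -/
inductive Letter
  | n1 | n2 | n3 | n0 | m3 | m2 | m1 | phi
  deriving DecidableEq

open Letter

/-- The one-row tableau of an element of `B_l`; the zero tuple is the tableau `(ϕ)`. -/
def row (b : Coord) : List Letter :=
  let w := List.replicate b.x1.toNat n1 ++ List.replicate b.x2.toNat n2 ++
    List.replicate (b.x3 / 2).toNat n3 ++ List.replicate (b.x3 % 2).toNat n0 ++
    List.replicate (b.y3 / 2).toNat m3 ++ List.replicate b.y2.toNat m2 ++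
    List.replicate b.y1.toNat m1
  if w = [] then [phi] else w

/-- The element of `B_l` whose tableau is the row `w`, if there is one. -/
def ofRow (l : ℕ) (w : List Letter) : Option (Elt l) :=
  let c : Coord :=
    { x1 := w.count n1
      x2 := w.count n2
      x3 := 2 * w.count n3 + w.count n0
      y3 := 2 * w.count m3 + w.count n0
      y2 := w.count m2
      y1 := w.count m1 }
  if row c = w then ofCoord l c else none

def B1 : List Letter := [n1, n2, n3, n0, m3, m2, m1]

def B10 : List (List Letter) :=
  [[n1, n0], [n1, m3], [n1, m2], [n2, m2], [n2, m1], [n3, m1], [n0, m1]]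

def B12 : List (List Letter) :=
  [[n1, n2], [n1, n3], [n2, n3], [n2, n0], [n2, m3], [n3, n0], [n3, m3], [n3, m2],
   [n0, n0], [n0, m3], [n0, m2], [m3, m2], [m3, m1], [m2, m1]]

def B11 : List (List Letter) :=
  [[n1, n1], [n2, n1], [n2, n2], [n3, n1], [n3, n2], [n3, n3], [n0, n1], [n0, n2],
   [n0, n3], [m3, n1], [m3, n2], [m3, n3], [m3, n0], [m3, m3], [m2, n1], [m2, n2],
   [m2, n3], [m2, n0], [m2, m3], [m2, m2], [m1, n1], [m1, n2], [m1, n3], [m1, n0],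
   [m1, m3], [m1, m2], [m1, m1]]

def B112 : List (List Letter) :=
  [[n1, n1, n2], [n1, n1, n3], [n2, n1, n2], [n2, n1, n3], [n2, n2, n3], [n2, n2, n0],
   [n2, n2, m3], [n3, n1, n2], [n3, n1, n3], [n3, n2, n3], [n3, n2, n0], [n3, n2, m3],
   [n3, n3, n0], [n3, n3, m3], [n3, n3, m2], [n0, n1, n2], [n0, n1, n3], [n0, n2, n3],
   [n0, n2, n0], [n0, n2, m3], [n0, n3, n0], [n0, n3, m3], [n0, n3, m2], [m3, n1, n2],
   [m3, n1, n3], [m3, n2, n3], [m3, n2, n0], [m3, n2, m3], [m3, n3, n0], [m3, n3, m3],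
   [m3, n3, m2], [m3, n0, n0], [m3, n0, m3], [m3, n0, m2], [m3, m3, m2], [m3, m3, m1],
   [m2, n1, n2], [m2, n1, n3], [m2, n2, n3], [m2, n2, n0], [m2, n2, m3], [m2, n3, n0],
   [m2, n3, m3], [m2, n3, m2], [m2, n0, n0], [m2, n0, m3], [m2, n0, m2], [m2, m3, m2],
   [m2, m3, m1], [m2, m2, m1], [m1, n1, n2], [m1, n1, n3], [m1, n2, n3], [m1, n2, n0],
   [m1, n2, m3], [m1, n3, n0], [m1, n3, m3], [m1, n3, m2], [m1, n0, n0], [m1, n0, m3],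
   [m1, n0, m2], [m1, m3, m2], [m1, m3, m1], [m1, m2, m1]]

def B121 : List (List Letter) :=
  [[n1, n2, n1], [n1, n3, n1], [n1, n2, n2], [n2, n3, n1], [n2, n0, n1], [n2, m3, n1],
   [n2, m3, n2], [n1, n3, n2], [n1, n3, n3], [n3, n0, n1], [n3, m3, n1], [n3, m3, n2],
   [n3, m2, n1], [n3, m2, n2], [n3, m2, n3], [n2, n3, n2], [n2, n3, n3], [n0, n0, n1],
   [n0, m3, n1], [n0, m3, n2], [n0, m2, n1], [n0, m2, n2], [n0, m2, n3], [n2, n0, n2],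
   [n2, n0, n3], [n2, m3, n3], [n2, m3, n0], [n2, m3, m3], [m3, m2, n1], [m3, m2, n2],
   [m3, m2, n3], [m3, m1, n1], [m3, m1, n2], [m3, m1, n3], [m3, m1, n0], [m3, m1, m3],
   [n3, n0, n2], [n3, n0, n3], [n3, m3, n3], [n3, m3, n0], [n3, m3, m3], [n3, m2, n0],
   [n3, m2, m3], [n3, m2, m2], [m2, m1, n1], [m2, m1, n2], [m2, m1, n3], [m2, m1, n0],
   [m2, m1, m3], [m2, m1, m2], [n0, n0, n2], [n0, n0, n3], [n0, m3, n3], [n0, m3, n0],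
   [n0, m3, m3], [n0, m2, n0], [n0, m2, m3], [n0, m2, m2], [m3, m2, n0], [m3, m2, m3],
   [m3, m2, m2], [m3, m1, m2], [m3, m1, m1], [m2, m1, m1]]

def ξ (w : List Letter) : Option Letter := (B10.zip B1).lookup w

def ξInv (α : Letter) : Option (List Letter) := (B1.zip B10).lookup α

def η (w : List Letter) : Option (List Letter) := (B121.zip B112).lookup w

def ηInv (w : List Letter) : Option (List Letter) := (B112.zip B121).lookup w

/-- A tableau as its list of columns from left to right, each column read from top to bottom. -/
abbrev Tableau : Type := List (List Letter)

/-- The column insertion `(β → T)`; `none` in the situations that the algorithm does not cover. -/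
def columnInsert : Letter → Tableau → Option Tableau
  | β, [] => some [[β]]
  | β, [α] :: T =>
    if [α, β] ∈ B12 then some ([α, β] :: T)
    else if [α, β] ∈ B11 then (columnInsert α T).map (fun T' => [β] :: T')
    else
      match ξ [α, β] with
      | some γ => columnInsert γ T
      | none =>
        if (α = phi ∧ β = phi) ∨ (α = n1 ∧ β = m1) then some T
        else if α = phi then some ([β] :: T)
        else if β = phi then some ([α] :: T)
        else none
  | γ, [α, β] :: T =>
    match η [α, β, γ] with
    | some [γ', α', β'] => (columnInsert γ' T).map (fun T' => [α', β'] :: T')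
    | _ => none
  | _, _ :: _ => none

/-- The letter `x` enters a column from the right; the result is the new column and the letter
that leaves it to the left. -/
def reverseColumn : List Letter → Letter → Option (List Letter × Letter)
  | [β], x => if [x, β] ∈ B11 then some ([x], β) else none
  | [α', β'], x =>
    match ηInv [x, α', β'] with
    | some [α, β, γ] => some ([α, β], γ)
    | _ => none
  | _, _ => none

/-- The letter `x` enters `T` from the right and moves to the left through all columns; the result
is the letter that leaves `T` and the new tableau. -/
def reverseInsert : Letter → Tableau → Option (Letter × Tableau)
  | x, [] => some (x, [])
  | x, c :: T =>
    (reverseInsert x T).bind fun r =>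
      (reverseColumn c r.1).map fun r' => (r'.2, r'.1 :: r.2)

/-- One step of reverse bumping: the rightmost box of the first row is bumped out; when a single
column of height two is left, its lower box is taken off. -/
def bumpStep (T : Tableau) : Option (Letter × Tableau) :=
  match T with
  | [[α, β]] => if [α, β] ∈ B12 then some (β, [[α]]) else none
  | _ =>
    match T.getLast? with
    | some [x] => reverseInsert x T.dropLast
    | _ => none

/-- The letters `t₁, …, t_N` bumped out of a tableau with `N` boxes. -/
def bumpOut : ℕ → Tableau → Option (List Letter)
  | 0, T => if T = [] then some [] else none
  | N + 1, T => (bumpStep T).bind fun r => (bumpOut N r.2).map fun t => r.1 :: t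

/-- The number `p + 2q` of boxes. -/
def size (T : Tableau) : ℕ := (T.map List.length).sum

/-! ## The algorithm -/

/-- `α₁β ∈ B(10)`, and `α₂γ ∈ B(11)` for `γ = ξ(α₁β)` unless there is no `α₂`. -/
def Special : List Letter → Letter → Prop
  | [α₁], β => [α₁, β] ∈ B10
  | α₁ :: α₂ :: _, β => ∃ γ, ξ [α₁, β] = some γ ∧ [α₂, γ] ∈ B11
  | [], _ => False

instance (A : List Letter) (β : Letter) : Decidable (Special A β) :=
  match A with
  | [] => inferInstanceAs (Decidable False)
  | [α₁] => inferInstanceAs (Decidable ([α₁, β] ∈ B10))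
  | α₁ :: α₂ :: _ =>
    match h : ξ [α₁, β] with
    | none => isFalse (by simp [Special, h])
    | some γ => decidable_of_iff ([α₂, γ] ∈ B11) (by simp [Special, h])

/-- The value of `H` computed from `b₁ = (α₁ … αₙ) ∈ B_l`, `b₂ = (β)` and `b₁ * b₂`; the first row
of a tableau has as many boxes as the tableau has columns. -/
def energy (l : ℕ) (A : List Letter) (β : Letter) (T : Tableau) : ℤ :=
  if Special A β then -2 else max (-2) ((T.length : ℤ) - l - 1)

inductive OutputCase
  | I | II | III | IV | V | other

open OutputCase in
def outputCase (l : ℕ) (A : List Letter) (β : Letter) : OutputCase :=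
  match A with
  | [] => other
  | α₁ :: _ =>
    let n := A.length
    if α₁ ≠ phi ∧ β ≠ phi then
      if [α₁, β] ∈ B11 then (if n + 1 < l then III else if n + 1 = l then V else I)
      else if [α₁, β] ∈ B12 then (if n < l then II else I)
      else if [α₁, β] ∈ B10 then (if Special A β then II else I)
      else if α₁ = n1 ∧ β = m1 then (if n = 1 then III else if n = 2 then IV else I)
      else other
    else if α₁ ≠ phi ∧ β = phi then (if l = 1 then IV else if n < l then V else I)
    else if α₁ = phi ∧ β ≠ phi then (if l = 1 then V else III)
    else other

/-- The rows `(b₂', b₁')` formed from the letters `t₁, …, t_N`. -/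
def output (k : OutputCase) (t : List Letter) : Option (List Letter × List Letter) :=
  match k with
  | .I => t.getLast?.map fun x => ([x], t.dropLast)
  | .II =>
    match t.getLast?.bind ξInv with
    | some [t', t''] => some ([t'], t.dropLast ++ [t''])
    | _ => none
  | .III => some ([n1], t ++ [m1])
  | .IV => some (t, [phi])
  | .V => some ([phi], t)
  | .other => some ([phi], [phi])

/-- The algorithm on `b₁ ⊗ b₂`, with the rows of `b₁`, `b₂` as input; the result is
`(H(b₁ ⊗ b₂), b₂', b₁')`. -/
def algorithm (l : ℕ) (A B : List Letter) : Option (ℤ × Elt 1 × Elt l) :=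
  match B with
  | [β] =>
    (columnInsert β (A.map fun α => [α])).bind fun T =>
      (bumpOut (size T) T).bind fun t =>
        (output (outputCase l A β) t).bind fun r =>
          (ofRow 1 r.1).bind fun b₂' =>
            (ofRow l r.2).map fun b₁' => (energy l A β T, b₂', b₁')
  | _ => none

/-- The algorithm on `Aff(B_l) ⊗ Aff(B_1)`; `none` means that some step cannot be carried out. -/
def algorithmR (l : ℕ) (x : Aff (Elt l) × Aff (Elt 1)) : Option (Aff (Elt 1) × Aff (Elt l)) :=
  (algorithm l (row x.1.2.1) (row x.2.2.1)).map fun r =>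
    ((x.2.1 + r.1, r.2.1), (x.1.1 - r.1, r.2.2))

end D43

/-! Pad the row of `b₁` with letters `ϕ` to length `l`. An element of `B_l` then is a vector `v` of
eight multiplicities, `l` enters only through their sum, and everything in sight is piecewise simple
in `v`. The algorithm exchanges a bounded number of letters, and which ones is decided by comparing
multiplicities with constants of size at most 3 (the trees `shape`): when a run of equal letters
passes through a column of height two, the column becomes stationary after a few steps. The action
of `e i` on `B_l` depends on where a list of linear partial sums attains its maximum for the last
time, as in a signature rule, and `ε i` and `φ i` are linear once this place is known
(`exists_describes`).

The compatibility of the algorithm with `e i`, together with the change of `H`, therefore splits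
into finitely many cases, each a system of linear inequalities in `v` in which constant offsets have
to agree. An impossible case is refuted by adding at most three of its inequalities and estimating
the sum over a box. The kernel carries this out once for all `l` (`verify_all`), and `verify_sound`
translates the outcome.

That the trees compute the algorithm is shown in two steps. Insertion and reverse bumping are
reduced to the short list `Rule` (`follows`); the main point is that a row passing through a column
of height two comes out as a row (`exists_pass`). A symbolic run of the rules is then compared with
the trees by the same decision procedure (`result_of_rule`). Both steps meet in `algorithm_shape`.

The rest is an argument on the crystal graph. `B_l ⊗ B_1` is connected (`tensor_induction`), and
`u_l ⊗ u_1` is its only element with `ε 0 = 2l + 2` (`eq_u_of_ε_tensor`). A map that commutes with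
the `e i` and preserves weights is therefore injective: injectivity at `u_l ⊗ u_1` spreads along the
arrows (`injective_of_matches`). Finiteness makes it bijective, and compatibility with the `f i`
follows. In the same way two isomorphisms agree at `u_l ⊗ u_1`, hence everywhere, and so do two
energy functions with the same value there (`combinatorialR_unique`). -/

namespace D43
open Letter

set_option maxRecDepth 10000

/-! ## A decision procedure for the crystal identities

The algorithm changes the multiplicities of the letters in a row by a bounded amount, which depends
on the multiplicities only through a decision tree (`shape`). The action of `e i` is governed by
the signs of linear forms in them. `verify` explores all combinations, keeping track of the
conditions met so far, and checks on every feasible branch that the two ways around the square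
`ι ∘ e i = e i ∘ ι` agree. It is written with recursors and binary arithmetic so that the kernel
can evaluate it. -/

/-- A natural number for every letter. -/
structure V8 where
  (a b c d e f g h : ℕ)

/-- The condition `q ≤ ∑ (16 - t x) v x + p`; the number `T` packs `t` into digits of 16 bits. -/
structure Con where
  t : V8
  T : ℕ
  p : ℕ
  q : ℕ

/-- What is known of `v`: lower and upper bounds and further conditions. The `mask` marks the
letters without upper bound. -/
structure St where
  lo : V8
  w : V8
  mask : ℕ
  cs : List Con

noncomputable section
def V8.get (v : V8) (x : Letter) : ℕ := Letter.rec v.a v.b v.c v.d v.e v.f v.g v.h x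
def V8.set (v : V8) (x : Letter) (m : ℕ) : V8 :=
  Letter.rec ⟨m, v.b, v.c, v.d, v.e, v.f, v.g, v.h⟩ ⟨v.a, m, v.c, v.d, v.e, v.f, v.g, v.h⟩
    ⟨v.a, v.b, m, v.d, v.e, v.f, v.g, v.h⟩ ⟨v.a, v.b, v.c, m, v.e, v.f, v.g, v.h⟩
    ⟨v.a, v.b, v.c, v.d, m, v.f, v.g, v.h⟩ ⟨v.a, v.b, v.c, v.d, v.e, m, v.g, v.h⟩
    ⟨v.a, v.b, v.c, v.d, v.e, v.f, m, v.h⟩ ⟨v.a, v.b, v.c, v.d, v.e, v.f, v.g, m⟩ x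
/-- The mark of the letter `x` in a mask. -/
def bit (x : Letter) : ℕ := Letter.rec (32768) (2147483648) (140737488355328) (9223372036854775808) (604462909807314587353088) (39614081257132168796771975168) (2596148429267413814265248164610048) (170141183460469231731687303715884105728) x

def addV (p n : V8) : V8 :=
  ⟨Nat.add p.a n.a, Nat.add p.b n.b, Nat.add p.c n.c, Nat.add p.d n.d, Nat.add p.e n.e,
    Nat.add p.f n.f, Nat.add p.g n.g, Nat.add p.h n.h⟩
/-- Upper bounds for the positive and the negative part of `∑ (K - s x) v x + p - n` over a box. -/
def boundPos (K : ℕ) (s w : V8) (p : ℕ) : ℕ :=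
  (Nat.add (Nat.add (Nat.add (Nat.add (Nat.add (Nat.add (Nat.add (Nat.add p (Nat.mul (Nat.sub K
    s.a) w.a)) (Nat.mul (Nat.sub K s.b) w.b)) (Nat.mul (Nat.sub K s.c) w.c)) (Nat.mul (Nat.sub K
    s.d) w.d)) (Nat.mul (Nat.sub K s.e) w.e)) (Nat.mul (Nat.sub K s.f) w.f)) (Nat.mul (Nat.sub K
    s.g) w.g)) (Nat.mul (Nat.sub K s.h) w.h))

def boundNeg (K : ℕ) (s lo : V8) (n : ℕ) : ℕ :=
  (Nat.add (Nat.add (Nat.add (Nat.add (Nat.add (Nat.add (Nat.add (Nat.add n (Nat.mul (Nat.sub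
    s.a K) lo.a)) (Nat.mul (Nat.sub s.b K) lo.b)) (Nat.mul (Nat.sub s.c K) lo.c)) (Nat.mul
    (Nat.sub s.d K) lo.d)) (Nat.mul (Nat.sub s.e K) lo.e)) (Nat.mul (Nat.sub s.f K) lo.f))
    (Nat.mul (Nat.sub s.g K) lo.g)) (Nat.mul (Nat.sub s.h K) lo.h))

/-- `∑ (K - s x) v x + p < n` on the whole box. -/
def negCore (K : ℕ) (s lo w : V8) (p n : ℕ) : Bool :=
  Bool.rec false (Nat.blt (boundPos K s w p) (boundNeg K s lo n)) (Nat.ble (boundNeg K s lo n) 100000)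

def andB (b c : Bool) : Bool := Bool.rec false c b
def orB (b c : Bool) : Bool := Bool.rec c true b
/-! A sum of conditions can only be violated on the whole box if the letters without upper bound
have no positive coefficient in it; this is read off from the packed numbers first. -/

def test1 (g : Con) (lo w : V8) (mask : ℕ) : Bool :=
  andB (Nat.beq (Nat.land (Nat.add g.T 170060701631106684296214925499431944176) mask) mask)
    (negCore 16 g.t lo w g.p g.q)
def test2 (f g : Con) (lo w : V8) (mask : ℕ) : Bool :=
  andB (Nat.beq (Nat.land (Nat.add (Nat.add f.T g.T) 169977623613700183717662793146965196768) mask) mask)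
    (negCore 32 (addV f.t g.t) lo w (Nat.add f.p g.p) (Nat.add f.q g.q))
def test3 (f g h : Con) (lo w : V8) (mask : ℕ) : Bool :=
  andB (Nat.beq (Nat.land (Nat.add (Nat.add (Nat.add f.T g.T) h.T) 169894545596293683139110660794498449360) mask) mask)
    (negCore 48 (addV (addV f.t g.t) h.t) lo w (Nat.add (Nat.add f.p g.p) h.p) (Nat.add (Nat.add f.q g.q) h.q))

def anyOf (p : Con → Bool) (cs : List Con) : Bool :=
  List.rec false (fun g _ ih => Bool.rec ih true (p g)) cs
def anyTail (p : Con → List Con → Bool) (cs : List Con) : Bool :=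
  List.rec false (fun g gs ih => Bool.rec ih true (p g (g :: gs))) cs
def any1 (lo w : V8) (mask : ℕ) (cs : List Con) : Bool := anyOf (fun g => test1 g lo w mask) cs
def any2 (f : Con) (lo w : V8) (mask : ℕ) (cs : List Con) : Bool :=
  anyOf (fun g => test2 f g lo w mask) cs
-- The inner searches start at the current condition itself, so a condition may be counted two or
-- three times in a sum.
def deep (lo w : V8) (mask : ℕ) (cs : List Con) : Bool :=
  anyTail (fun f fs => anyTail (fun g gs => anyOf (fun h => test3 f g h lo w mask) gs) fs) cs

/-- A check that may rely on what is known. -/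
def Proc := St → Bool
/-- The end of a branch: `b` holds or the branch is not feasible. -/
def ret (b : Bool) : Proc := fun st => Bool.rec (deep st.lo st.w st.mask st.cs) true b
-- Called after a bound has become sharper, which may turn a condition recorded earlier into a
-- contradiction.
def go (r : Proc) (lo w : V8) (mask : ℕ) (cs : List Con) : Bool :=
  Bool.rec (r ⟨lo, w, mask, cs⟩) true (any1 lo w mask cs)
def ge (x : Letter) (m : ℕ) (r : Proc) : Proc := fun st =>
  Bool.rec (Bool.rec (go r (st.lo.set x m) st.w st.mask st.cs) (Nat.ble m 1000000) (Nat.blt (st.w.get x) m))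
    (r st) (Nat.ble m (st.lo.get x))
def lt (x : Letter) (m : ℕ) (r : Proc) : Proc := fun st =>
  Bool.rec (Bool.rec (go r st.lo (st.w.set x (Nat.pred m)) (Nat.sub st.mask (Nat.land st.mask (bit x))) st.cs) true (Nat.ble m (st.lo.get x)))
    (r st) (Nat.blt (st.w.get x) m)
-- Sums of two conditions are tried at once; the costlier search through triples is left to `ret`.
def assume (c : Con) (r : Proc) : Proc := fun st =>
  orB (test1 c st.lo st.w st.mask)
    (orB (any2 c st.lo st.w st.mask st.cs) (r ⟨st.lo, st.w, st.mask, c :: st.cs⟩))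
def both (r s : Proc) : Proc := fun st => Bool.rec false (s st) (r st)

/-- A change of multiplicities. -/
structure Off where
  p : V8
  n : V8

def askAt (x : Letter) (m : ℕ) (y n : Proc) : Proc := both (ge x m y) (lt x m n)
-- The question concerns the multiplicity after the offset `d`, while all knowledge is kept in terms
-- of the initial vector, so the threshold is moved back. If the subtraction is truncated, the
-- condition holds trivially.
def askPos (d : Off) (x : Letter) (m : ℕ) (y n : Proc) : Proc :=
  askAt x (Nat.sub (Nat.add m (d.n.get x)) (d.p.get x)) y n

/-- A decision tree: a node asks for `m ≤ v a`, a leaf holds a letter `α`, the letters that are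
added and removed, and the energy. -/
inductive DTree
  | out (α : Letter) (plus minus : List Letter) (H : ℤ)
  | br (a : Letter) (m : ℕ) (y n : DTree)

def incs (w : List Letter) (d : V8) : V8 :=
  List.rec d (fun x _ ih => ih.set x (Nat.succ (ih.get x))) w

def Off.shift (plus minus : List Letter) (d : Off) : Off := ⟨incs plus d.p, incs minus d.n⟩

def DTree.prog (d : Off) (k : Letter → Off → ℤ → Proc) (t : DTree) : Proc :=
  DTree.rec (fun α p m H => k α (d.shift p m) H) (fun a m _ _ y n => askPos d a m y n) t

/-- The algorithm on `B_l ⊗ {β}`. -/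
def shape : Letter → DTree
  | n1 =>
    .br phi 1 (.br phi 2 (.out n1 [n1, m1] [phi, phi] (-2)) (.out phi [n1] [phi] (-1))) (.br m1 1
    (.out m1 [n1] [m1] 0) (.br m2 1 (.out m2 [n1] [m2] 0) (.br m3 1 (.out m3 [n1] [m3] 0) (.br n0
    1 (.out n0 [n1] [n0] 0) (.br n3 1 (.out n3 [n1] [n3] 0) (.br n2 1 (.out n2 [n1] [n2] 0) (.br
    n1 1 (.out n1 [] [] 0) (.out phi [n1] [phi] 0))))))))
  | n2 =>
    .br phi 1 (.br n1 1 (.br n0 1 (.br m1 1 (.out n2 [n2, n3, m3, m2] [n1, n0, m1, phi] (-2))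
    (.out n1 [n2, n3, m3] [n1, n0, phi] (-2))) (.br m1 1 (.out n2 [n2, n0, m2] [n1, m1, phi] (-2))
    (.out n1 [n2, n0] [n1, phi] (-2)))) (.br phi 2 (.out n1 [n2, m1] [phi, phi] (-2)) (.out phi
    [n2] [phi] (-1)))) (.br m1 1 (.br n1 1 (.br n0 1 (.br m1 2 (.out m3 [n2, n3, m3, m2] [n1, n0,
    m1, m1] (-1)) (.out n0 [n2, n3, m3] [n1, n0, m1] (-1))) (.br m1 2 (.out m3 [n2, n0, m2] [n1,
    m1, m1] (-1)) (.out n0 [n2, n0] [n1, m1] (-1)))) (.out m1 [n2] [m1] 0)) (.br m2 1 (.br n1 1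
    (.br n0 1 (.out n3 [n2, n3, m3] [n1, n0, m2] (-1)) (.out n3 [n2, n0] [n1, m2] (-1))) (.out m2
    [n2] [m2] 0)) (.br n1 1 (.br n0 1 (.out n2 [n2, n3] [n1, n0] (-1)) (.br m3 1 (.out n2 [n2, n0]
    [n1, m3] (-1)) (.out n1 [n2] [n1] (-1)))) (.br m3 1 (.out m3 [n2] [m3] 0) (.br n0 1 (.out n0
    [n2] [n0] 0) (.br n3 1 (.out n3 [n2] [n3] 0) (.br n2 1 (.out n2 [] [] 0) (.out phi [n2] [phi]
    0))))))))
  | n3 =>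
    .br phi 1 (.br n2 1 (.br n0 1 (.br m2 1 (.out n3 [n1, n1, m1, m1] [n2, n0, m2, phi] (-2)) (.br
    m3 1 (.out n2 [n1, n1, m1, m1] [n2, n0, m3, phi] (-2)) (.br n3 1 (.out n2 [n1, n1, m2, m2]
    [n2, n3, n0, phi] (-2)) (.br n2 2 (.out n2 [n1, n1, m3, m2] [n2, n2, n0, phi] (-2)) (.out n2
    [n1, m2] [n2, phi] (-2)))))) (.br n3 1 (.br m3 1 (.br m2 1 (.out n3 [n1, n1, n0, m1, m1] [n2,
    n3, m3, m2, phi] (-2)) (.br m3 2 (.out n2 [n1, n1, n0, m1, m1] [n2, n3, m3, m3, phi] (-2))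
    (.out n2 [n1, n1, m2, m1] [n2, n3, m3, phi] (-2)))) (.br n3 2 (.br m1 1 (.out n2 [n1, n1, m2,
    m2, m2] [n2, n3, n3, m1, phi] (-2)) (.out n1 [n1, n1, m2, m2] [n2, n3, n3, phi] (-2))) (.br n2
    2 (.br m1 1 (.out n2 [n1, n1, m3, m2, m2] [n2, n2, n3, m1, phi] (-2)) (.out n1 [n1, n1, m3,
    m2] [n2, n2, n3, phi] (-2))) (.br m1 1 (.out n2 [n1, n0, m2, m2] [n2, n3, m1, phi] (-2)) (.out
    n1 [n1, n0, m2] [n2, n3, phi] (-2)))))) (.br n2 3 (.br m1 1 (.out n2 [n1, n1, m3, m3, m2] [n2,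
    n2, n2, m1, phi] (-2)) (.out n1 [n1, n1, m3, m3] [n2, n2, n2, phi] (-2))) (.br n2 2 (.br m1 1
    (.out n2 [n1, n0, m3, m2] [n2, n2, m1, phi] (-2)) (.out n1 [n1, n0, m3] [n2, n2, phi] (-2)))
    (.br m1 1 (.out n2 [n3, m3, m2] [n2, m1, phi] (-2)) (.out n1 [n3, m3] [n2, phi] (-2)))))))
    (.br n1 1 (.br n0 1 (.br m1 1 (.out n2 [n3, n3, m3, m2] [n1, n0, m1, phi] (-2)) (.out n1 [n3,
    n3, m3] [n1, n0, phi] (-2))) (.br m1 1 (.out n2 [n3, n0, m2] [n1, m1, phi] (-2)) (.out n1 [n3,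
    n0] [n1, phi] (-2)))) (.br phi 2 (.out n1 [n3, m1] [phi, phi] (-2)) (.out phi [n3] [phi]
    (-1))))) (.br n2 1 (.br n0 1 (.br m2 1 (.out m2 [n1, n1, m1] [n2, n0, m2] (-1)) (.br m3 1
    (.out m3 [n1, n1, m1] [n2, n0, m3] (-1)) (.br n3 1 (.br m1 1 (.out m3 [n1, n1, m2, m2] [n2,
    n3, n0, m1] (-1)) (.out n0 [n1, n1, m2] [n2, n3, n0] (-1))) (.br n2 2 (.br m1 1 (.out m3 [n1,
    n1, m3, m2] [n2, n2, n0, m1] (-1)) (.out n0 [n1, n1, m3] [n2, n2, n0] (-1))) (.br m1 1 (.out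
    m3 [n1, m2] [n2, m1] (-1)) (.out n0 [n1] [n2] (-1))))))) (.br n3 1 (.br m3 1 (.br m2 1 (.out
    m2 [n1, n1, n0, m1] [n2, n3, m3, m2] (-1)) (.br m3 2 (.out m3 [n1, n1, n0, m1] [n2, n3, m3,
    m3] (-1)) (.out m3 [n1, n1, m2] [n2, n3, m3] (-1)))) (.br n3 2 (.br m1 2 (.out m3 [n1, n1, m2,
    m2, m2] [n2, n3, n3, m1, m1] (-1)) (.br m1 1 (.out n0 [n1, n1, m2, m2] [n2, n3, n3, m1] (-1))
    (.out n3 [n1, n1, m2] [n2, n3, n3] (-1)))) (.br m1 2 (.br n2 2 (.out m3 [n1, n1, m3, m2, m2]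
    [n2, n2, n3, m1, m1] (-1)) (.out m3 [n1, n0, m2, m2] [n2, n3, m1, m1] (-1))) (.br m1 1 (.br n2
    2 (.out n0 [n1, n1, m3, m2] [n2, n2, n3, m1] (-1)) (.out n0 [n1, n0, m2] [n2, n3, m1] (-1)))
    (.br n2 2 (.out n3 [n1, n1, m3] [n2, n2, n3] (-1)) (.out n3 [n1, n0] [n2, n3] (-1))))))) (.br
    n2 3 (.br m1 2 (.out m3 [n1, n1, m3, m3, m2] [n2, n2, n2, m1, m1] (-1)) (.br m1 1 (.out n0
    [n1, n1, m3, m3] [n2, n2, n2, m1] (-1)) (.br m2 1 (.out n3 [n1, n1, m3, m3] [n2, n2, n2, m2]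
    (-1)) (.out n2 [n1, n1, m3] [n2, n2, n2] (-1))))) (.br n2 2 (.br m1 2 (.out m3 [n1, n0, m3,
    m2] [n2, n2, m1, m1] (-1)) (.br m1 1 (.out n0 [n1, n0, m3] [n2, n2, m1] (-1)) (.br m2 1 (.out
    n3 [n1, n0, m3] [n2, n2, m2] (-1)) (.out n2 [n1, n0] [n2, n2] (-1))))) (.br m1 2 (.out m3 [n3,
    m3, m2] [n2, m1, m1] (-1)) (.br m1 1 (.out n0 [n3, m3] [n2, m1] (-1)) (.br m2 1 (.out n3 [n3,
    m3] [n2, m2] (-1)) (.out n2 [n3] [n2] (-1))))))))) (.br m1 1 (.br n1 1 (.br n0 1 (.br m1 2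
    (.out m3 [n3, n3, m3, m2] [n1, n0, m1, m1] (-1)) (.out n0 [n3, n3, m3] [n1, n0, m1] (-1)))
    (.br m1 2 (.out m3 [n3, n0, m2] [n1, m1, m1] (-1)) (.out n0 [n3, n0] [n1, m1] (-1)))) (.out m1
    [n3] [m1] 0)) (.br m2 1 (.br n1 1 (.br n0 1 (.out n3 [n3, n3, m3] [n1, n0, m2] (-1)) (.out n3
    [n3, n0] [n1, m2] (-1))) (.out m2 [n3] [m2] 0)) (.br n1 1 (.br n0 1 (.out n2 [n3, n3] [n1, n0]
    (-1)) (.br m3 1 (.out n2 [n3, n0] [n1, m3] (-1)) (.out n1 [n3] [n1] (-1)))) (.br m3 1 (.out m3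
    [n3] [m3] 0) (.br n0 1 (.out n0 [n3] [n0] 0) (.br n3 1 (.out n3 [] [] 0) (.out phi [n3] [phi]
    0))))))))
  | n0 =>
    .br n1 1 (.br m1 1 (.out n0 [] [] (-2)) (.br m2 1 (.out n3 [m1] [m2] (-2)) (.br m3 1 (.out n2
    [m1] [m3] (-2)) (.br n0 1 (.out n2 [m2] [n0] (-2)) (.br n3 1 (.out n1 [m2] [n3] (-2)) (.br n2
    1 (.out n1 [m3] [n2] (-2)) (.out n1 [n0] [n1] (-2)))))))) (.br phi 1 (.br n0 1 (.br m2 1 (.out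
    n3 [n1, m1, m1] [n0, m2, phi] (-2)) (.br m3 1 (.out n2 [n1, m1, m1] [n0, m3, phi] (-2)) (.br
    n3 1 (.out n2 [n1, m2, m2] [n3, n0, phi] (-2)) (.br n2 1 (.out n2 [n1, m3, m2] [n2, n0, phi]
    (-2)) (.out n2 [m2] [phi] (-2)))))) (.br n3 1 (.br m3 1 (.br m2 1 (.out n3 [n1, n0, m1, m1]
    [n3, m3, m2, phi] (-2)) (.br m3 2 (.out n2 [n1, n0, m1, m1] [n3, m3, m3, phi] (-2)) (.out n2
    [n1, m2, m1] [n3, m3, phi] (-2)))) (.br n3 2 (.br m1 1 (.out n2 [n1, m2, m2, m2] [n3, n3, m1,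
    phi] (-2)) (.out n1 [n1, m2, m2] [n3, n3, phi] (-2))) (.br n2 1 (.br m1 1 (.out n2 [n1, m3,
    m2, m2] [n2, n3, m1, phi] (-2)) (.out n1 [n1, m3, m2] [n2, n3, phi] (-2))) (.br m1 1 (.out n2
    [n0, m2, m2] [n3, m1, phi] (-2)) (.out n1 [n0, m2] [n3, phi] (-2)))))) (.br n2 2 (.br m1 1
    (.out n2 [n1, m3, m3, m2] [n2, n2, m1, phi] (-2)) (.out n1 [n1, m3, m3] [n2, n2, phi] (-2)))
    (.br n2 1 (.br m1 1 (.out n2 [n0, m3, m2] [n2, m1, phi] (-2)) (.out n1 [n0, m3] [n2, phi]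
    (-2))) (.br phi 2 (.out n1 [n0, m1] [phi, phi] (-2)) (.out phi [n0] [phi] (-1))))))) (.br n0 1
    (.br m2 1 (.out m2 [n1, m1] [n0, m2] (-1)) (.br m3 1 (.out m3 [n1, m1] [n0, m3] (-1)) (.br n3
    1 (.br m1 1 (.out m3 [n1, m2, m2] [n3, n0, m1] (-1)) (.out n0 [n1, m2] [n3, n0] (-1))) (.br m1
    1 (.br n2 1 (.out m3 [n1, m3, m2] [n2, n0, m1] (-1)) (.out m3 [m2] [m1] (-1))) (.br n2 1 (.out
    n0 [n1, m3] [n2, n0] (-1)) (.out n0 [] [] (-1))))))) (.br n3 1 (.br m3 1 (.br m2 1 (.out m2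
    [n1, n0, m1] [n3, m3, m2] (-1)) (.br m3 2 (.out m3 [n1, n0, m1] [n3, m3, m3] (-1)) (.out m3
    [n1, m2] [n3, m3] (-1)))) (.br n3 2 (.br m1 2 (.out m3 [n1, m2, m2, m2] [n3, n3, m1, m1] (-1))
    (.br m1 1 (.out n0 [n1, m2, m2] [n3, n3, m1] (-1)) (.out n3 [n1, m2] [n3, n3] (-1)))) (.br m1
    2 (.br n2 1 (.out m3 [n1, m3, m2, m2] [n2, n3, m1, m1] (-1)) (.out m3 [n0, m2, m2] [n3, m1,
    m1] (-1))) (.br m1 1 (.br n2 1 (.out n0 [n1, m3, m2] [n2, n3, m1] (-1)) (.out n0 [n0, m2] [n3,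
    m1] (-1))) (.br n2 1 (.out n3 [n1, m3] [n2, n3] (-1)) (.out n3 [n0] [n3] (-1))))))) (.br n2 2
    (.br m1 2 (.out m3 [n1, m3, m3, m2] [n2, n2, m1, m1] (-1)) (.br m1 1 (.out n0 [n1, m3, m3]
    [n2, n2, m1] (-1)) (.br m2 1 (.out n3 [n1, m3, m3] [n2, n2, m2] (-1)) (.out n2 [n1, m3] [n2,
    n2] (-1))))) (.br m1 1 (.br n2 1 (.br m1 2 (.out m3 [n0, m3, m2] [n2, m1, m1] (-1)) (.out n0
    [n0, m3] [n2, m1] (-1))) (.out m1 [n0] [m1] 0)) (.br m2 1 (.br n2 1 (.out n3 [n0, m3] [n2, m2]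
    (-1)) (.out m2 [n0] [m2] 0)) (.br n2 1 (.out n2 [n0] [n2] (-1)) (.br m3 1 (.out m3 [n0] [m3]
    0) (.out phi [n0] [phi] 0)))))))))
  | m3 =>
    .br n1 2 (.br n0 1 (.br m1 2 (.out m3 [n2, n3, m3, m2, phi] [n1, n1, n0, m1, m1] (-2)) (.br m1
    1 (.out n0 [n2, n3, m3, phi] [n1, n1, n0, m1] (-2)) (.br m2 1 (.out n3 [n2, n3, m3, phi] [n1,
    n1, n0, m2] (-2)) (.out n2 [n2, n3, phi] [n1, n1, n0] (-2))))) (.br m1 2 (.out m3 [n2, n0, m2,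
    phi] [n1, n1, m1, m1] (-2)) (.br m1 1 (.out n0 [n2, n0, phi] [n1, n1, m1] (-2)) (.br m2 1
    (.out n3 [n2, n0, phi] [n1, n1, m2] (-2)) (.br m3 1 (.out n2 [n2, n0, phi] [n1, n1, m3] (-2))
    (.out n1 [n2, phi] [n1, n1] (-2))))))) (.br n1 1 (.br m1 1 (.out n0 [n2] [n1] (-2)) (.br m2 1
    (.out n3 [n2, m1] [n1, m2] (-2)) (.br m3 1 (.out n2 [n2, m1] [n1, m3] (-2)) (.br n0 1 (.out n2
    [n2, m2] [n1, n0] (-2)) (.br n3 1 (.out n1 [n2, m2] [n1, n3] (-2)) (.out n1 [m3] [n1]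
    (-2))))))) (.br phi 1 (.br n0 1 (.br m2 1 (.out n3 [n2, m1, m1] [n0, m2, phi] (-2)) (.br m3 1
    (.out n2 [n2, m1, m1] [n0, m3, phi] (-2)) (.br n3 1 (.out n2 [n2, m2, m2] [n3, n0, phi] (-2))
    (.out n2 [m3, m2] [n0, phi] (-2))))) (.br n3 1 (.br m3 1 (.br m2 1 (.out n3 [n2, n0, m1, m1]
    [n3, m3, m2, phi] (-2)) (.br m3 2 (.out n2 [n2, n0, m1, m1] [n3, m3, m3, phi] (-2)) (.out n2
    [n2, m2, m1] [n3, m3, phi] (-2)))) (.br n3 2 (.br m1 1 (.out n2 [n2, m2, m2, m2] [n3, n3, m1,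
    phi] (-2)) (.out n1 [n2, m2, m2] [n3, n3, phi] (-2))) (.br m1 1 (.out n2 [m3, m2, m2] [n3, m1,
    phi] (-2)) (.out n1 [m3, m2] [n3, phi] (-2))))) (.br n2 1 (.br m1 1 (.out n2 [m3, m3, m2] [n2,
    m1, phi] (-2)) (.out n1 [m3, m3] [n2, phi] (-2))) (.br phi 2 (.out n1 [m3, m1] [phi, phi]
    (-2)) (.out phi [m3] [phi] (-1)))))) (.br n0 1 (.br m2 1 (.out m2 [n2, m1] [n0, m2] (-1)) (.br
    m3 1 (.out m3 [n2, m1] [n0, m3] (-1)) (.br n3 1 (.br m1 1 (.out m3 [n2, m2, m2] [n3, n0, m1]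
    (-1)) (.out n0 [n2, m2] [n3, n0] (-1))) (.br m1 1 (.out m3 [m3, m2] [n0, m1] (-1)) (.out n0
    [m3] [n0] (-1)))))) (.br n3 1 (.br m3 1 (.br m2 1 (.out m2 [n2, n0, m1] [n3, m3, m2] (-1))
    (.br m3 2 (.out m3 [n2, n0, m1] [n3, m3, m3] (-1)) (.out m3 [n2, m2] [n3, m3] (-1)))) (.br n3
    2 (.br m1 2 (.out m3 [n2, m2, m2, m2] [n3, n3, m1, m1] (-1)) (.br m1 1 (.out n0 [n2, m2, m2]
    [n3, n3, m1] (-1)) (.out n3 [n2, m2] [n3, n3] (-1)))) (.br m1 2 (.out m3 [m3, m2, m2] [n3, m1,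
    m1] (-1)) (.br m1 1 (.out n0 [m3, m2] [n3, m1] (-1)) (.out n3 [m3] [n3] (-1)))))) (.br m1 1
    (.br n2 1 (.br m1 2 (.out m3 [m3, m3, m2] [n2, m1, m1] (-1)) (.out n0 [m3, m3] [n2, m1] (-1)))
    (.out m1 [m3] [m1] 0)) (.br m2 1 (.br n2 1 (.out n3 [m3, m3] [n2, m2] (-1)) (.out m2 [m3] [m2]
    0)) (.br n2 1 (.out n2 [m3] [n2] (-1)) (.br m3 1 (.out m3 [] [] 0) (.out phi [m3] [phi]
    0)))))))))
  | m2 =>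
    .br n2 1 (.br n0 1 (.br m2 1 (.out m2 [n1, m1, phi] [n2, n0, m2] (-2)) (.br m3 1 (.out m3 [n1,
    m1, phi] [n2, n0, m3] (-2)) (.br n3 1 (.br m1 1 (.out m3 [n1, m2, m2, phi] [n2, n3, n0, m1]
    (-2)) (.out n0 [n1, m2, phi] [n2, n3, n0] (-2))) (.br n2 2 (.br m1 1 (.out m3 [n1, m3, m2,
    phi] [n2, n2, n0, m1] (-2)) (.out n0 [n1, m3, phi] [n2, n2, n0] (-2))) (.br m1 1 (.out m3 [m2,
    phi] [n2, m1] (-2)) (.out n0 [phi] [n2] (-2))))))) (.br n3 1 (.br m3 1 (.br m2 1 (.out m2 [n1,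
    n0, m1, phi] [n2, n3, m3, m2] (-2)) (.br m3 2 (.out m3 [n1, n0, m1, phi] [n2, n3, m3, m3]
    (-2)) (.out m3 [n1, m2, phi] [n2, n3, m3] (-2)))) (.br n3 2 (.br m1 2 (.out m3 [n1, m2, m2,
    m2, phi] [n2, n3, n3, m1, m1] (-2)) (.br m1 1 (.out n0 [n1, m2, m2, phi] [n2, n3, n3, m1]
    (-2)) (.out n3 [n1, m2, phi] [n2, n3, n3] (-2)))) (.br m1 2 (.br n2 2 (.out m3 [n1, m3, m2,
    m2, phi] [n2, n2, n3, m1, m1] (-2)) (.out m3 [n0, m2, m2, phi] [n2, n3, m1, m1] (-2))) (.br m1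
    1 (.br n2 2 (.out n0 [n1, m3, m2, phi] [n2, n2, n3, m1] (-2)) (.out n0 [n0, m2, phi] [n2, n3,
    m1] (-2))) (.br n2 2 (.out n3 [n1, m3, phi] [n2, n2, n3] (-2)) (.out n3 [n0, phi] [n2, n3]
    (-2))))))) (.br n2 3 (.br m1 2 (.out m3 [n1, m3, m3, m2, phi] [n2, n2, n2, m1, m1] (-2)) (.br
    m1 1 (.out n0 [n1, m3, m3, phi] [n2, n2, n2, m1] (-2)) (.br m2 1 (.out n3 [n1, m3, m3, phi]
    [n2, n2, n2, m2] (-2)) (.out n2 [n1, m3, phi] [n2, n2, n2] (-2))))) (.br n2 2 (.br m1 2 (.out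
    m3 [n0, m3, m2, phi] [n2, n2, m1, m1] (-2)) (.br m1 1 (.out n0 [n0, m3, phi] [n2, n2, m1]
    (-2)) (.br m2 1 (.out n3 [n0, m3, phi] [n2, n2, m2] (-2)) (.out n2 [n0, phi] [n2, n2] (-2)))))
    (.br m1 1 (.br n1 1 (.br m1 2 (.out m3 [n3, m3, m2, phi] [n1, n2, m1, m1] (-2)) (.out n0 [n3,
    m3, phi] [n1, n2, m1] (-2))) (.out n0 [n0] [n2] (-2))) (.br m2 1 (.br n1 1 (.out n3 [n3, m3,
    phi] [n1, n2, m2] (-2)) (.out n3 [n0, m1] [n2, m2] (-2))) (.br n1 1 (.out n2 [n3, phi] [n1,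
    n2] (-2)) (.br m3 1 (.out n2 [n0, m1] [n2, m3] (-2)) (.out n2 [m2] [n2] (-2)))))))))) (.br n1
    2 (.br n0 1 (.br m1 2 (.out m3 [n3, n3, m3, m2, phi] [n1, n1, n0, m1, m1] (-2)) (.br m1 1
    (.out n0 [n3, n3, m3, phi] [n1, n1, n0, m1] (-2)) (.br m2 1 (.out n3 [n3, n3, m3, phi] [n1,
    n1, n0, m2] (-2)) (.out n2 [n3, n3, phi] [n1, n1, n0] (-2))))) (.br m1 2 (.out m3 [n3, n0, m2,
    phi] [n1, n1, m1, m1] (-2)) (.br m1 1 (.out n0 [n3, n0, phi] [n1, n1, m1] (-2)) (.br m2 1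
    (.out n3 [n3, n0, phi] [n1, n1, m2] (-2)) (.br m3 1 (.out n2 [n3, n0, phi] [n1, n1, m3] (-2))
    (.out n1 [n3, phi] [n1, n1] (-2))))))) (.br n1 1 (.br m1 1 (.out n0 [n3] [n1] (-2)) (.br m2 1
    (.out n3 [n3, m1] [n1, m2] (-2)) (.br m3 1 (.out n2 [n3, m1] [n1, m3] (-2)) (.br n0 1 (.out n2
    [n3, m2] [n1, n0] (-2)) (.out n1 [m2] [n1] (-2)))))) (.br phi 1 (.br n0 1 (.br m2 1 (.out n3
    [n3, m1, m1] [n0, m2, phi] (-2)) (.br m3 1 (.out n2 [n3, m1, m1] [n0, m3, phi] (-2)) (.out n2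
    [m2, m2] [n0, phi] (-2)))) (.br m3 1 (.br m2 1 (.out n3 [n0, m1, m1] [m3, m2, phi] (-2)) (.br
    m3 2 (.out n2 [n0, m1, m1] [m3, m3, phi] (-2)) (.out n2 [m2, m1] [m3, phi] (-2)))) (.br n3 1
    (.br m1 1 (.out n2 [m2, m2, m2] [n3, m1, phi] (-2)) (.out n1 [m2, m2] [n3, phi] (-2))) (.br
    phi 2 (.out n1 [m2, m1] [phi, phi] (-2)) (.out phi [m2] [phi] (-1)))))) (.br n0 1 (.br m2 1
    (.out m2 [n3, m1] [n0, m2] (-1)) (.br m3 1 (.out m3 [n3, m1] [n0, m3] (-1)) (.br m1 1 (.out m3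
    [m2, m2] [n0, m1] (-1)) (.out n0 [m2] [n0] (-1))))) (.br m3 1 (.br m2 1 (.out m2 [n0, m1] [m3,
    m2] (-1)) (.br m3 2 (.out m3 [n0, m1] [m3, m3] (-1)) (.out m3 [m2] [m3] (-1)))) (.br m1 1 (.br
    n3 1 (.br m1 2 (.out m3 [m2, m2, m2] [n3, m1, m1] (-1)) (.out n0 [m2, m2] [n3, m1] (-1)))
    (.out m1 [m2] [m1] 0)) (.br n3 1 (.out n3 [m2] [n3] (-1)) (.br m2 1 (.out m2 [] [] 0) (.out
    phi [m2] [phi] 0)))))))))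
  | m1 =>
    .br n1 1 (.br m1 1 (.out m1 [phi, phi] [n1, m1] (-2)) (.br m2 1 (.out m2 [phi, phi] [n1, m2]
    (-2)) (.br m3 1 (.out m3 [phi, phi] [n1, m3] (-2)) (.br n0 1 (.out n0 [phi, phi] [n1, n0]
    (-2)) (.br n3 1 (.out n3 [phi, phi] [n1, n3] (-2)) (.br n2 1 (.out n2 [phi, phi] [n1, n2]
    (-2)) (.br n1 2 (.out n1 [phi, phi] [n1, n1] (-2)) (.out n1 [m1] [n1] (-2))))))))) (.br n0 1
    (.br m2 1 (.out m2 [m1, phi] [n0, m2] (-2)) (.br m3 1 (.out m3 [m1, phi] [n0, m3] (-2)) (.br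
    n3 1 (.br m1 1 (.out m3 [m2, m2, phi] [n3, n0, m1] (-2)) (.out n0 [m2, phi] [n3, n0] (-2)))
    (.br n2 1 (.br m1 1 (.out m3 [m3, m2, phi] [n2, n0, m1] (-2)) (.out n0 [m3, phi] [n2, n0]
    (-2))) (.out n0 [m1] [n0] (-2)))))) (.br n3 1 (.br m3 1 (.br m2 1 (.out m2 [n0, m1, phi] [n3,
    m3, m2] (-2)) (.br m3 2 (.out m3 [n0, m1, phi] [n3, m3, m3] (-2)) (.out m3 [m2, phi] [n3, m3]
    (-2)))) (.br n3 2 (.br m1 2 (.out m3 [m2, m2, m2, phi] [n3, n3, m1, m1] (-2)) (.br m1 1 (.out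
    n0 [m2, m2, phi] [n3, n3, m1] (-2)) (.out n3 [m2, phi] [n3, n3] (-2)))) (.br m1 1 (.br n2 1
    (.br m1 2 (.out m3 [m3, m2, m2, phi] [n2, n3, m1, m1] (-2)) (.out n0 [m3, m2, phi] [n2, n3,
    m1] (-2))) (.out n0 [m2] [n3] (-2))) (.br n2 1 (.out n3 [m3, phi] [n2, n3] (-2)) (.out n3 [m1]
    [n3] (-2)))))) (.br n2 2 (.br m1 2 (.out m3 [m3, m3, m2, phi] [n2, n2, m1, m1] (-2)) (.br m1 1
    (.out n0 [m3, m3, phi] [n2, n2, m1] (-2)) (.br m2 1 (.out n3 [m3, m3, phi] [n2, n2, m2] (-2))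
    (.out n2 [m3, phi] [n2, n2] (-2))))) (.br n2 1 (.br m1 1 (.out n0 [m3] [n2] (-2)) (.br m2 1
    (.out n3 [m3, m1] [n2, m2] (-2)) (.out n2 [m1] [n2] (-2)))) (.br phi 1 (.br m2 1 (.out n3 [m1,
    m1] [m2, phi] (-2)) (.br m3 1 (.out n2 [m1, m1] [m3, phi] (-2)) (.br phi 2 (.out n1 [m1, m1]
    [phi, phi] (-2)) (.out phi [m1] [phi] (-1))))) (.br m2 1 (.out m2 [m1] [m2] (-1)) (.br m3 1
    (.out m3 [m1] [m3] (-1)) (.br m1 1 (.out m1 [] [] 0) (.out phi [m1] [phi] 0)))))))))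
  | phi =>
    .br phi 1 (.out phi [] [] (-2)) (.br m1 1 (.out m1 [phi] [m1] (-1)) (.br m2 1 (.out m2 [phi]
    [m2] (-1)) (.br m3 1 (.out m3 [phi] [m3] (-1)) (.br n0 1 (.out n0 [phi] [n0] (-1)) (.br n3 1
    (.out n3 [phi] [n3] (-1)) (.br n2 1 (.out n2 [phi] [n2] (-1)) (.br n1 1 (.out n1 [phi] [n1]
    (-1)) (.out phi [] [] (-1)))))))))

/-- A linear form in the multiplicities. -/
structure Lin where
  p : V8
  n : V8

/-- `ε i` and `φ i` on `B_1`. -/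
def ep : Fin 3 → Letter → ℕ
  | 0, n1 => 2   | 0, n2 => 1   | 0, n3 => 1   | 0, n0 => 0   | 0, m3 => 0   | 0, m2 => 0   | 0, m1 => 0   | 0, phi => 1
  | 1, n1 => 0   | 1, n2 => 1   | 1, n3 => 0   | 1, n0 => 1   | 1, m3 => 2   | 1, m2 => 0   | 1, m1 => 1   | 1, phi => 0
  | 2, n1 => 0   | 2, n2 => 0   | 2, n3 => 1   | 2, n0 => 0   | 2, m3 => 0   | 2, m2 => 1   | 2, m1 => 0   | 2, phi => 0

def ph : Fin 3 → Letter → ℕ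
  | 0, n1 => 0   | 0, n2 => 0   | 0, n3 => 0   | 0, n0 => 0   | 0, m3 => 1   | 0, m2 => 1   | 0, m1 => 2   | 0, phi => 1
  | 1, n1 => 1   | 1, n2 => 0   | 1, n3 => 2   | 1, n0 => 1   | 1, m3 => 0   | 1, m2 => 1   | 1, m1 => 0   | 1, phi => 0
  | 2, n1 => 0   | 2, n2 => 1   | 2, n3 => 0   | 2, n0 => 0   | 2, m3 => 1   | 2, m2 => 0   | 2, m1 => 0   | 2, phi => 0

/-- The partial sums that govern the action of `e i`. -/
def prefixes : Fin 3 → List Lin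
  | 0 => [⟨⟨0, 0, 0, 0, 0, 0, 0, 0⟩, ⟨0, 0, 0, 0, 0, 0, 0, 0⟩⟩,
    ⟨⟨0, 0, 0, 0, 0, 0, 1, 0⟩, ⟨1, 0, 0, 0, 0, 0, 0, 0⟩⟩,
    ⟨⟨0, 0, 0, 0, 0, 1, 1, 0⟩, ⟨1, 0, 0, 1, 2, 0, 0, 0⟩⟩,
    ⟨⟨0, 0, 0, 0, 1, 1, 1, 0⟩, ⟨1, 0, 3, 1, 0, 0, 0, 0⟩⟩,
    ⟨⟨0, 0, 0, 0, 1, 1, 1, 0⟩, ⟨1, 1, 1, 0, 0, 0, 0, 0⟩⟩,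
    ⟨⟨0, 0, 0, 0, 1, 1, 2, 0⟩, ⟨2, 1, 1, 0, 0, 0, 0, 0⟩⟩]
  | 1 => [⟨⟨0, 0, 0, 0, 0, 0, 0, 0⟩, ⟨0, 0, 0, 0, 0, 0, 0, 0⟩⟩,
    ⟨⟨0, 0, 2, 1, 0, 0, 0, 0⟩, ⟨0, 1, 0, 0, 0, 0, 0, 0⟩⟩,
    ⟨⟨0, 0, 2, 0, 0, 1, 0, 0⟩, ⟨0, 1, 0, 0, 2, 0, 0, 0⟩⟩]
  | 2 => [⟨⟨0, 0, 0, 0, 0, 0, 0, 0⟩, ⟨0, 0, 0, 0, 0, 0, 0, 0⟩⟩,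
    ⟨⟨0, 0, 0, 0, 1, 0, 0, 0⟩, ⟨0, 0, 1, 0, 0, 0, 0, 0⟩⟩]

/-- `φ i`, where the partial sum with the same number is the largest. -/
def phiForms : Fin 3 → List Lin
  | 0 => [⟨⟨0, 0, 0, 0, 0, 0, 0, 1⟩, ⟨0, 0, 0, 0, 0, 0, 0, 0⟩⟩,
    ⟨⟨0, 0, 0, 0, 0, 0, 1, 1⟩, ⟨1, 0, 0, 0, 0, 0, 0, 0⟩⟩,
    ⟨⟨0, 0, 0, 0, 0, 1, 1, 1⟩, ⟨1, 0, 0, 1, 2, 0, 0, 0⟩⟩,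
    ⟨⟨0, 0, 0, 0, 1, 1, 1, 1⟩, ⟨1, 0, 3, 1, 0, 0, 0, 0⟩⟩,
    ⟨⟨0, 0, 0, 0, 1, 1, 1, 1⟩, ⟨1, 1, 1, 0, 0, 0, 0, 0⟩⟩,
    ⟨⟨0, 0, 0, 0, 1, 1, 2, 1⟩, ⟨2, 1, 1, 0, 0, 0, 0, 0⟩⟩]
  | 1 => [⟨⟨1, 0, 0, 0, 0, 0, 0, 0⟩, ⟨0, 0, 0, 0, 0, 0, 0, 0⟩⟩,
    ⟨⟨1, 0, 2, 1, 0, 0, 0, 0⟩, ⟨0, 1, 0, 0, 0, 0, 0, 0⟩⟩,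
    ⟨⟨1, 0, 2, 0, 0, 1, 0, 0⟩, ⟨0, 1, 0, 0, 2, 0, 0, 0⟩⟩]
  | 2 => [⟨⟨0, 1, 0, 0, 0, 0, 0, 0⟩, ⟨0, 0, 0, 0, 0, 0, 0, 0⟩⟩,
    ⟨⟨0, 1, 0, 0, 1, 0, 0, 0⟩, ⟨0, 0, 1, 0, 0, 0, 0, 0⟩⟩]

/-- `ε i`, where the partial sum with the same number is the largest. -/
def epsForms : Fin 3 → List Lin
  | 0 => [⟨⟨2, 1, 1, 0, 0, 0, 0, 1⟩, ⟨0, 0, 0, 0, 1, 1, 2, 0⟩⟩,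
    ⟨⟨1, 1, 1, 0, 0, 0, 0, 1⟩, ⟨0, 0, 0, 0, 1, 1, 1, 0⟩⟩,
    ⟨⟨1, 1, 1, 0, 0, 0, 0, 1⟩, ⟨0, 0, 0, 1, 3, 0, 1, 0⟩⟩,
    ⟨⟨1, 1, 0, 0, 0, 0, 0, 1⟩, ⟨0, 0, 2, 1, 0, 0, 1, 0⟩⟩,
    ⟨⟨1, 0, 0, 0, 0, 0, 0, 1⟩, ⟨0, 0, 0, 0, 0, 0, 1, 0⟩⟩,
    ⟨⟨0, 0, 0, 0, 0, 0, 0, 1⟩, ⟨0, 0, 0, 0, 0, 0, 0, 0⟩⟩]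
  | 1 => [⟨⟨0, 1, 0, 0, 2, 0, 1, 0⟩, ⟨0, 0, 2, 0, 0, 1, 0, 0⟩⟩,
    ⟨⟨0, 0, 0, 1, 2, 0, 1, 0⟩, ⟨0, 0, 0, 0, 0, 1, 0, 0⟩⟩,
    ⟨⟨0, 0, 0, 0, 0, 0, 1, 0⟩, ⟨0, 0, 0, 0, 0, 0, 0, 0⟩⟩]
  | 2 => [⟨⟨0, 0, 1, 0, 0, 1, 0, 0⟩, ⟨0, 0, 0, 0, 1, 0, 0, 0⟩⟩,
    ⟨⟨0, 0, 0, 0, 0, 1, 0, 0⟩, ⟨0, 0, 0, 0, 0, 0, 0, 0⟩⟩]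

def dot (s t : V8) (z : ℕ) : ℕ :=
  Nat.add (Nat.mul s.a t.a) (Nat.add (Nat.mul s.b t.b) (Nat.add (Nat.mul s.c t.c)
  (Nat.add (Nat.mul s.d t.d) (Nat.add (Nat.mul s.e t.e) (Nat.add (Nat.mul s.f t.f)
  (Nat.add (Nat.mul s.g t.g) (Nat.add (Nat.mul s.h t.h) z)))))))

/-- The positive and the negative part of the value of `f` at the offset `d`. -/
def Lin.pv (f : Lin) (d : Off) : ℕ := dot f.p d.p (dot f.n d.n 0)
def Lin.nv (f : Lin) (d : Off) : ℕ := dot f.p d.n (dot f.n d.p 0)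

def bias1 (p n : ℕ) : ℕ := Nat.sub (Nat.add 16 n) p
def bias (p n : V8) : V8 :=
  ⟨bias1 p.a n.a, bias1 p.b n.b, bias1 p.c n.c, bias1 p.d n.d, bias1 p.e n.e, bias1 p.f n.f,
    bias1 p.g n.g, bias1 p.h n.h⟩
def pack (t : V8) : ℕ :=
  Nat.add t.a (Nat.mul 65536 (Nat.add t.b (Nat.mul 65536 (Nat.add t.c (Nat.mul 65536 (Nat.add t.d (Nat.mul 65536
  (Nat.add t.e (Nat.mul 65536 (Nat.add t.f (Nat.mul 65536 (Nat.add t.g (Nat.mul 65536 t.h)))))))))))))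
def con (p n : V8) (c d : ℕ) : Con := ⟨bias p n, pack (bias p n), c, d⟩

/-- The negation of `q ≤ f + p` is `p + 1 ≤ -f + q`, a condition of the same kind. -/
def ask (f : Lin) (p q : ℕ) (y n : Proc) : Proc :=
  both (assume (con f.p f.n p q) y) (assume (con f.n f.p q (Nat.succ p)) n)

/-- Assumes `s ≥ g + t` at `v + d`. -/
def geP (s g : Lin) (d : Off) (t : ℕ) (r : Proc) : Proc :=
  assume (con (addV s.p g.n) (addV s.n g.p) (Nat.add (s.pv d) (g.nv d)) (Nat.add (Nat.add (s.nv d) (g.pv d)) t)) r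

def geAll (s : Lin) (d : Off) (t : ℕ) (l : List Lin) (r : Proc) : Proc :=
  List.rec r (fun g _ ih => geP s g d t ih) l

/-- A linear form `s` with the forms `pre` before and `post` after it in a list. -/
structure Row where
  j : ℕ
  s : Lin
  pre : List Lin
  post : List Lin

def rowsAux : ℕ → List Lin → List Lin → List Row
  | _, _, [] => []
  | j, pre, s :: post => ⟨j, s, pre, post⟩ :: rowsAux (j + 1) (s :: pre) post
def rows (i : Fin 3) : List Row := rowsAux 0 [] (prefixes i)

def yes : Proc := fun _ => true

/-- Distinguishes cases according to the last form that is the largest at `v + d`. -/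
def argmaxP (d : Off) (k : ℕ → Lin → Proc) (rs : List Row) : Proc :=
  List.rec yes (fun r _ ih => both (geAll r.s d 0 r.pre (geAll r.s d 1 r.post (k r.j r.s))) ih) rs

/-- `s ≥ g + t` at `d`. -/
def constGe (s g : Lin) (d : Off) (t : ℕ) : Bool :=
  Nat.ble (Nat.add (Nat.add (s.nv d) (g.pv d)) t) (Nat.add (s.pv d) (g.nv d))

def branch (c : Bool) (r s : Proc) : Proc := Bool.rec s r c

/-- `geAll`, without the conditions that follow from those at `v`. -/
def geAll' (s : Lin) (d : Off) (t : ℕ) (l : List Lin) (r : Proc) : Proc :=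
  List.rec r (fun g _ ih => branch (constGe s g d 0) ih (geP s g d t ih)) l

/-- `argmaxP`, given that the form `s0` with the number `j0` is the last largest one at `v`. -/
def argmaxQ (d : Off) (j0 : ℕ) (s0 : Lin) (k : ℕ → Lin → Proc) (rs : List Row) : Proc :=
  List.rec yes (fun r _ ih => both
    (branch (Nat.beq r.j j0) (geAll' r.s d 0 r.pre (geAll' r.s d 1 r.post (k r.j r.s)))
      (branch (constGe r.s s0 d 1)
        (geP r.s s0 d (Bool.rec 0 1 (Nat.blt r.j j0))
          (geAll r.s d 0 r.pre (geAll r.s d 1 r.post (k r.j r.s)))) yes)) ih) rs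

/-- The action of `e i` on multiplicities. -/
inductive Act
  | move (plus minus : List Letter)
  | split (y n : Act)

def act : Fin 3 → ℕ → Act
  | 0, 0 => .move [phi] [n1]
  | 0, 1 => .split (.move [m1] [n0]) (.move [n0, m1] [n3, m3])
  | 0, 2 => .move [m2] [n3]
  | 0, 3 => .move [m3] [n2]
  | 0, 4 => .split (.move [n3, m3] [n1, n0]) (.move [n0] [n1])
  | 0, _ => .move [m1] [phi]
  | 1, 0 => .move [n1] [n2]
  | 1, 1 => .split (.move [n3] [n0]) (.move [n0] [m3])
  | 1, _ => .move [m2] [m1]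
  | 2, 0 => .move [n2] [n3]
  | 2, _ => .move [m3] [m2]

def needs (d : Off) (y n : Proc) (l : List Letter) : Proc :=
  List.rec y (fun a _ ih => askPos d a 1 ih n) l

def Act.prog (d : Off) (k : Option Off → Proc) (t : Act) : Proc :=
  Act.rec (fun p m => needs d (k (some (d.shift p m))) (k none) m)
    (fun _ _ y n => askPos d n0 1 y n) t

/-- The action of `e i` on `B_1`. -/
def e1 : Fin 3 → Letter → Option Letter
  | 0, n1 => some phi | 0, n2 => some m3 | 0, n3 => some m2 | 0, phi => some m1
  | 0, _ => none
  | 1, n2 => some n1 | 1, n0 => some n3 | 1, m3 => some n0 | 1, m1 => some m2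
  | 1, _ => none
  | 2, n3 => some n2 | 2, m2 => some m3
  | 2, _ => none

def same1 (a b c d : ℕ) (r : Bool) : Bool := Bool.rec false r (Nat.beq (Nat.add a d) (Nat.add b c))
def sameOff (x y : Off) : Bool :=
  same1 x.p.a y.p.a x.n.a y.n.a (same1 x.p.b y.p.b x.n.b y.n.b (same1 x.p.c y.p.c x.n.c y.n.c
  (same1 x.p.d y.p.d x.n.d y.n.d (same1 x.p.e y.p.e x.n.e y.n.e (same1 x.p.f y.p.f x.n.f y.n.f
  (same1 x.p.g y.p.g x.n.g y.n.g (same1 x.p.h y.p.h x.n.h y.n.h true)))))))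

def v0 : V8 := ⟨0, 0, 0, 0, 0, 0, 0, 0⟩
def off0 : Off := ⟨v0, v0⟩

def getL (l : List Lin) (j : ℕ) : Lin := l.getD j ⟨v0, v0⟩

/-- The rule for the energy after `e i`, which acts on the left factor of the source if `sl` and of
the target if `tl`. -/
def eRule (i : Fin 3) (sl tl : Bool) (H : ℤ) : ℤ :=
  if i = 0 then (match sl, tl with | true, true => H + 1 | false, false => H - 1 | _, _ => H) else H

/-- Here `y` comes from `e i` on the source and `z` from `e i` on the image. The tree is applied a
second time, to `y`, and its leaf has to reproduce `z` and the energy demanded by `eRule`; zero has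
to correspond to zero. -/
def outcome (i : Fin 3) (H : ℤ) (sl : Bool) (y : Option (Off × Letter)) (tl : Bool)
    (z : Option (Off × Letter)) : Proc :=
  match y with
  | none => ret z.isNone
  | some (dy, βy) => (shape βy).prog dy fun αy dy' Hy =>
    match z with
    | none => ret false
    | some (dz, αz) => ret (decide (αy = αz) && sameOff dy' dz && decide (Hy = eRule i sl tl H))

/-- The form handed to `ask` is minus `ε i`, so the question is whether `ε i ≤ φ i α` at the image,
that is, whether `e i` acts there on the factor in `B_1`. -/
def target (i : Fin 3) (α : Letter) (d' : Off) (H : ℤ) (j : ℕ) (s : Lin) (sl : Bool)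
    (y : Option (Off × Letter)) : Proc :=
  argmaxQ d' j s (fun j' _ =>
    let f := getL (epsForms i) j'
    ask ⟨f.n, f.p⟩ (Nat.add (ph i α) (f.nv d')) (f.pv d')
      (outcome i H sl y true ((e1 i α).map fun a => (d', a)))
      ((act i j').prog d' fun w => outcome i H sl y false (w.map fun d => (d, α)))) (rows i)

def verify (i : Fin 3) (β : Letter) : Proc :=
  (shape β).prog off0 fun α d' H =>
  argmaxP off0 (fun j s =>
    ask (getL (phiForms i) j) 0 (ep i β)
      ((act i j).prog off0 fun w => target i α d' H j s true (w.map fun d => (d, β)))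
      (target i α d' H j s false ((e1 i β).map fun b => (off0, b)))) (rows i)

/-- The weight `φ i - ε i`. -/
def wtForm (i : Fin 3) : Lin :=
  let f := getL (phiForms i) 0
  let g := getL (epsForms i) 0
  ⟨addV f.p g.n, addV f.n g.p⟩

/-- The weights of the pair before and after, with negative terms moved to the other side. Weights
are linear, so the conditions along the branches are irrelevant. -/
def sameWt (i : Fin 3) (β : Letter) : DTree → Bool
  | .out α p m _ => Nat.beq (ph i β + ep i α + (wtForm i).nv (off0.shift p m))
      (ph i α + ep i β + (wtForm i).pv (off0.shift p m))
  | .br _ _ y n => sameWt i β y && sameWt i β n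

/-- What is known at the beginning: there is at most one letter `0` and at least one letter. -/
def st0 : St := ⟨v0, ⟨1000000, 1000000, 1000000, 1, 1000000, 1000000, 1000000, 1000000⟩, 170143779648513184865543685815043915776,
  [con ⟨1,1,1,1,1,1,1,1⟩ v0 0 1]⟩
end

/-! ### String lengths on `B_l` in closed form -/

/-- `ε i` itself vanishes at the end of a string and drops by one along it, and induction along the
string shows that these two properties determine it. -/
theorem Crystal.ε_eq_of_step {I B : Type} (C : Crystal I B) (i : I) (F : B → ℤ)
    (h0 : ∀ b, C.e i b = none → F b = 0) (h1 : ∀ b c, C.e i b = some c → F b = F c + 1) (b : B) :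
    (C.ε i b : ℤ) = F b := by
  generalize hn : C.ε i b = n
  induction n generalizing b with
  | zero =>
    cases h : C.e i b with
    | none => simp [h0 b h]
    | some c => have := C.ε_e h; omega
  | succ n ih =>
    cases h : C.e i b with
    | none =>
      have : C.ε i b = 0 := stringLength_none h
      omega
    | some c =>
      have := C.ε_e h
      rw [h1 b c h, ← ih c (by omega)]
      push_cast
      rfl

theorem Crystal.φ_eq_of_step {I B : Type} (C : Crystal I B) (i : I) (F : B → ℤ)
    (h0 : ∀ b, C.f i b = none → F b = 0) (h1 : ∀ b c, C.f i b = some c → F b = F c + 1) (b : B) :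
    (C.φ i b : ℤ) = F b := by
  generalize hn : C.φ i b = n
  induction n generalizing b with
  | zero =>
    cases h : C.f i b with
    | none => simp [h0 b h]
    | some c => have := C.φ_f h; omega
  | succ n ih =>
    cases h : C.f i b with
    | none =>
      have : C.φ i b = 0 := stringLength_none h
      omega
    | some c =>
      have := C.φ_f h
      rw [h1 b c h, ← ih c (by omega)]
      push_cast
      rfl

/-- The multiplicities of the letters in the row of `b ∈ B_l`, padded with `ϕ` to length `l`. -/
def conf {l : ℕ} (b : Elt l) : Letter → ℕ
  | n1 => b.1.x1.toNat
  | n2 => b.1.x2.toNat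
  | n3 => (b.1.x3 / 2).toNat
  | n0 => (b.1.x3 % 2).toNat
  | m3 => (b.1.y3 / 2).toNat
  | m2 => b.1.y2.toNat
  | m1 => b.1.y1.toNat
  | phi => (l - b.1.s).toNat

/-- The largest of the partial sums that govern the action of `e i` and `f i`. -/
def top : Fin 3 → Coord → ℤ
  | 0, b => max 0 (max b.z1 (max (b.z1 + b.z2) (max (b.z1 + b.z2 + 3 * b.z4)
      (max (b.z1 + b.z2 + 3 * b.z4 + b.z3) (2 * b.z1 + b.z2 + 3 * b.z4 + b.z3)))))
  | 1, b => max 0 (max (b.x3 - b.x2) (b.x3 - b.x2 + b.y2 - b.y3))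
  | 2, b => max 0 b.z4

def phiFun (l : ℕ) : Fin 3 → Coord → ℤ
  | 0, b => l - b.s + top 0 b
  | 1, b => b.x1 + top 1 b
  | 2, b => b.x2 + top 2 b

def epsFun (l : ℕ) : Fin 3 → Coord → ℤ
  | 0, b => l - b.s + top 0 b - (2 * b.z1 + b.z2 + 3 * b.z4 + b.z3)
  | 1, b => b.y1 + top 1 b - (b.x3 - b.x2 + b.y2 - b.y3)
  | 2, b => b.y2 + top 2 b - b.z4

theorem ofCoord_eq_none {l : ℕ} {b : Coord} : ofCoord l b = none ↔ ¬ b.Mem l := by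
  unfold ofCoord
  split_ifs with h <;> simp [h]

theorem opE_eq_none {l : ℕ} {i : Fin 3} {b : Elt l} :
    opE l i b = none ↔ ∀ c, rawE i b.1 = some c → ¬ c.Mem l := by
  simp [opE, Option.bind_eq_none_iff, ofCoord_eq_none]

theorem opF_eq_none {l : ℕ} {i : Fin 3} {b : Elt l} :
    opF l i b = none ↔ ∀ c, rawF i b.1 = some c → ¬ c.Mem l := by
  simp [opF, Option.bind_eq_none_iff, ofCoord_eq_none]

/-- The ways in which `e 0` can act: the partial sum at which the maximum is attained last, and the
new tuple. -/
theorem rawE0_cases (b : Coord) {k : ℤ} (hk : b.z4 = k) :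
    (b.z1 < 0 ∧ b.z1 + b.z2 < 0 ∧ b.z1 + b.z2 + 3 * k < 0 ∧ b.z1 + b.z2 + 3 * k + b.z3 < 0 ∧
      2 * b.z1 + b.z2 + 3 * k + b.z3 < 0 ∧ rawE0 b = some { b with x1 := b.x1 - 1 }) ∨
    (0 ≤ b.z1 ∧ b.z2 < 0 ∧ b.z2 + 3 * k < 0 ∧ b.z2 + 3 * k + b.z3 < 0 ∧
      b.z1 + b.z2 + 3 * k + b.z3 < 0 ∧
      rawE0 b = some { b with x3 := b.x3 - 1, y3 := b.y3 - 1, y1 := b.y1 + 1 }) ∨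
    (0 ≤ b.z1 + b.z2 ∧ 0 ≤ b.z2 ∧ k < 0 ∧ 3 * k + b.z3 < 0 ∧ b.z1 + 3 * k + b.z3 < 0 ∧
      rawE0 b = some { b with x3 := b.x3 - 2, y2 := b.y2 + 1 }) ∨
    (0 ≤ b.z1 + b.z2 + 3 * k ∧ 0 ≤ b.z2 + 3 * k ∧ 0 ≤ k ∧ b.z3 < 0 ∧ b.z1 + b.z3 < 0 ∧
      rawE0 b = some { b with x2 := b.x2 - 1, y3 := b.y3 + 2 }) ∨
    (0 ≤ b.z1 + b.z2 + 3 * k + b.z3 ∧ 0 ≤ b.z2 + 3 * k + b.z3 ∧ 0 ≤ 3 * k + b.z3 ∧ 0 ≤ b.z3 ∧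
      b.z1 < 0 ∧ rawE0 b = some { b with x1 := b.x1 - 1, x3 := b.x3 + 1, y3 := b.y3 + 1 }) ∨
    (0 ≤ 2 * b.z1 + b.z2 + 3 * k + b.z3 ∧ 0 ≤ b.z1 + b.z2 + 3 * k + b.z3 ∧
      0 ≤ b.z1 + 3 * k + b.z3 ∧ 0 ≤ b.z1 + b.z3 ∧ 0 ≤ b.z1 ∧
      rawE0 b = some { b with y1 := b.y1 + 1 }) := by
  unfold rawE0
  simp only [gt_iff_lt, ge_iff_le, hk, ← add_assoc, add_pos_lt, le_add_neg]
  generalize b.z1 = z1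
  generalize b.z2 = z2
  generalize b.z3 = z3
  split_ifs with h1 h2 h3 h4 h5 h6
  · left; refine ⟨?_, ?_, ?_, ?_, ?_, rfl⟩ <;> omega
  · right; left; refine ⟨?_, ?_, ?_, ?_, ?_, rfl⟩ <;> omega
  · right; right; left; refine ⟨?_, ?_, ?_, ?_, ?_, rfl⟩ <;> omega
  · right; right; right; left; refine ⟨?_, ?_, ?_, ?_, ?_, rfl⟩ <;> omega
  · right; right; right; right; left; refine ⟨?_, ?_, ?_, ?_, ?_, rfl⟩ <;> omega
  · right; right; right; right; right; refine ⟨?_, ?_, ?_, ?_, ?_, rfl⟩ <;> omega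
  · exfalso; omega

/-- Naming an entry at which the maximum is attained replaces a nested case split by linear
inequalities. -/
theorem max6_eq {a b c d e f m : ℤ} (ha : a ≤ m) (hb : b ≤ m) (hc : c ≤ m) (hd : d ≤ m) (he : e ≤ m)
    (hf : f ≤ m) (h : m = a ∨ m = b ∨ m = c ∨ m = d ∨ m = e ∨ m = f) :
    max a (max b (max c (max d (max e f)))) = m := by
  omega

/-- `e 0` acts at the last maximum of the six partial sums, and the partial sum with the same number
is still a maximum afterwards. Both maxima are thus explicit linear expressions. -/
theorem epsFun_zero_of_some {l : ℕ} {b c : Coord} (hb : b.Mem l) (hc : c.Mem l)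
    (h : rawE 0 b = some c) : epsFun l 0 b = epsFun l 0 c + 1 := by
  have hk : 2 * b.z4 = b.y3 - b.x3 := by simp only [Coord.z4, Coord.Mem] at *; omega
  have hm : 2 * c.z4 = c.y3 - c.x3 := by simp only [Coord.z4, Coord.Mem] at *; omega
  have hs : 2 * b.s = 2 * (b.x1 + b.x2 + b.y2 + b.y1) + b.x3 + b.y3 := by
    simp only [Coord.s, Coord.Mem] at *; omega
  have hs' : 2 * c.s = 2 * (c.x1 + c.x2 + c.y2 + c.y1) + c.x3 + c.y3 := by
    simp only [Coord.s, Coord.Mem] at *; omega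
  clear hb hc
  change rawE0 b = some c at h
  have hz (d : Coord) : d.z1 = d.y1 - d.x1 ∧ d.z2 = d.y2 - d.y3 ∧ d.z3 = d.x3 - d.x2 :=
    ⟨rfl, rfl, rfl⟩
  obtain ⟨p1, p2, p3⟩ := hz b
  obtain ⟨q1, q2, q3⟩ := hz c
  simp only [epsFun, top]
  generalize c.z4 = cz4 at *
  generalize c.z1 = cz1 at *
  generalize c.z2 = cz2 at *
  generalize c.z3 = cz3 at *
  generalize c.s = cs at *
  rcases rawE0_cases b rfl with h' | h' | h' | h' | h' | h' <;>
  obtain ⟨h1, h2, h3, h4, h5, h6⟩ := h' <;> rw [h6] at h <;>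
  generalize b.z4 = bz4 at * <;>
  generalize b.z1 = bz1 at * <;>
  generalize b.z2 = bz2 at * <;>
  generalize b.z3 = bz3 at * <;>
  generalize b.s = bs at * <;> clear h6 hz <;>
  obtain rfl := Option.some.inj h <;> dsimp only at q1 q2 q3 hm hs' <;> clear h
  · rw [max6_eq (m := 0) (a := 0) (b := bz1), max6_eq (m := 0) (a := 0) (b := cz1)] <;> omega
  · rw [max6_eq (m := bz1) (a := 0) (b := bz1), max6_eq (m := cz1) (a := 0) (b := cz1)] <;> omega
  · rw [max6_eq (m := bz1 + bz2) (a := 0) (b := bz1), max6_eq (m := cz1 + cz2) (a := 0) (b := cz1)] <;> omega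
  · rw [max6_eq (m := bz1 + bz2 + 3 * bz4) (a := 0) (b := bz1), max6_eq (m := cz1 + cz2 + 3 * cz4) (a := 0) (b := cz1)] <;> omega
  · rw [max6_eq (m := bz1 + bz2 + 3 * bz4 + bz3) (a := 0) (b := bz1), max6_eq (m := cz1 + cz2 + 3 * cz4 + cz3) (a := 0) (b := cz1)] <;> omega
  · rw [max6_eq (m := 2 * bz1 + bz2 + 3 * bz4 + bz3) (a := 0) (b := bz1), max6_eq (m := 2 * cz1 + cz2 + 3 * cz4 + cz3) (a := 0) (b := cz1)] <;> omega

theorem two_mul_z4 {l : ℕ} {b : Coord} (hb : b.Mem l) : 2 * b.z4 = b.y3 - b.x3 := by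
  simp only [Coord.z4, Coord.Mem] at *; omega

theorem two_mul_s {l : ℕ} {b : Coord} (hb : b.Mem l) :
    2 * b.s = 2 * (b.x1 + b.x2 + b.y2 + b.y1) + b.x3 + b.y3 := by
  simp only [Coord.s, Coord.Mem] at *; omega

theorem mem_iff {l : ℕ} {b : Coord} : b.Mem l ↔ 0 ≤ b.x1 ∧ 0 ≤ b.x2 ∧ 0 ≤ b.x3 ∧ 0 ≤ b.y3 ∧
    0 ≤ b.y2 ∧ 0 ≤ b.y1 ∧ b.x3 % 2 = b.y3 % 2 ∧
    2 * (b.x1 + b.x2 + b.y2 + b.y1) + b.x3 + b.y3 ≤ 2 * l := by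
  simp only [Coord.Mem, Coord.s]; omega

theorem epsFun_zero_of_none {l : ℕ} {b : Elt l} (h : opE l 0 b = none) : epsFun l 0 b.1 = 0 := by
  rw [opE_eq_none] at h
  obtain ⟨b, hb⟩ := b
  have hk := two_mul_z4 hb
  have hs := two_mul_s hb
  have hb' := mem_iff.mp hb
  dsimp only at h ⊢
  simp only [epsFun, top]
  have hz : b.z1 = b.y1 - b.x1 ∧ b.z2 = b.y2 - b.y3 ∧ b.z3 = b.x3 - b.x2 := ⟨rfl, rfl, rfl⟩
  obtain ⟨p1, p2, p3⟩ := hz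
  change ∀ c, rawE0 b = some c → ¬ c.Mem l at h
  rcases rawE0_cases b rfl with h' | h' | h' | h' | h' | h' <;>
  obtain ⟨h1, h2, h3, h4, h5, h6⟩ := h' <;> have h := h _ h6 <;> clear h6 <;>
  rw [mem_iff] at h <;> dsimp only at h <;>
  generalize b.z4 = bz4 at * <;>
  generalize b.z1 = bz1 at * <;>
  generalize b.z2 = bz2 at * <;>
  generalize b.z3 = bz3 at * <;>
  generalize b.s = bs at *
  -- In the first five cases the inequalities force the lowered coordinates to be large enough and
  -- the sum does not grow, so the new tuple stays in `B_l`. Only the last case, which raises `x̄₁`,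
  -- can leave `B_l`; then `s b = l` and the maximum is the total sum.
  · exfalso; omega
  · exfalso; omega
  · exfalso; omega
  · exfalso; omega
  · exfalso; omega
  · rw [max6_eq (m := 2 * bz1 + bz2 + 3 * bz4 + bz3) (a := 0) (b := bz1)] <;> omega

/-- The maximum cancels in `φ i - ε i` and a linear form remains. With the formula for `ε i` this
gives the behaviour of `φ i` along arrows, so `f i` has to be examined only where it vanishes. -/
theorem weight_of_some {l : ℕ} {b c : Elt l} (i : Fin 3) (h : opE l i b = some c) :
    phiFun l i c.1 - epsFun l i c.1 = phiFun l i b.1 - epsFun l i b.1 + 2 := by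
  rw [opE_eq_some] at h
  have hk := two_mul_z4 b.2
  have hm := two_mul_z4 c.2
  fin_cases i
  · simp only [phiFun, epsFun]
    ring_nf
    have hz (d : Coord) : d.z1 = d.y1 - d.x1 ∧ d.z2 = d.y2 - d.y3 ∧ d.z3 = d.x3 - d.x2 :=
      ⟨rfl, rfl, rfl⟩
    obtain ⟨p1, p2, p3⟩ := hz b.1
    obtain ⟨q1, q2, q3⟩ := hz c.1
    change rawE0 b.1 = some c.1 at h
    rcases rawE0_cases b.1 rfl with h' | h' | h' | h' | h' | h' <;>
    obtain ⟨-, -, -, -, -, h6⟩ := h' <;> rw [h6] at h <;> clear h6 <;>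
    have h := Option.some.inj h <;> rw [Coord.ext_iff] at h <;> dsimp only at h <;> omega
  · simp only [phiFun, epsFun]
    simp only [rawE, rawE1] at h
    split_ifs at h <;> have h := Option.some.inj h <;> rw [Coord.ext_iff] at h <;>
      dsimp only at h <;> omega
  · change phiFun l 2 c.1 - epsFun l 2 c.1 = phiFun l 2 b.1 - epsFun l 2 b.1 + 2
    simp only [phiFun, epsFun]
    change rawE2 b.1 = some c.1 at h
    unfold rawE2 at h
    split_ifs at h <;> have h := Option.some.inj h <;> rw [Coord.ext_iff] at h <;>
      dsimp only at h <;> omega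

theorem epsFun_of_some {l : ℕ} {b c : Elt l} (i : Fin 3) (h : opE l i b = some c) :
    epsFun l i b.1 = epsFun l i c.1 + 1 := by
  rw [opE_eq_some] at h
  fin_cases i
  · exact epsFun_zero_of_some b.2 c.2 h
  · change epsFun l 1 b.1 = epsFun l 1 c.1 + 1
    simp only [epsFun, top]
    change rawE1 b.1 = some c.1 at h
    unfold rawE1 pos at h
    split_ifs at h <;> have h := Option.some.inj h <;> rw [Coord.ext_iff] at h <;>
      dsimp only at h <;> omega
  · have hk := two_mul_z4 b.2
    have hm := two_mul_z4 c.2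
    change epsFun l 2 b.1 = epsFun l 2 c.1 + 1
    simp only [epsFun, top]
    change rawE2 b.1 = some c.1 at h
    unfold rawE2 at h
    split_ifs at h <;> have h := Option.some.inj h <;> rw [Coord.ext_iff] at h <;>
      dsimp only at h <;> omega

theorem epsFun_of_none {l : ℕ} {b : Elt l} (i : Fin 3) (h : opE l i b = none) :
    epsFun l i b.1 = 0 := by
  fin_cases i
  · exact epsFun_zero_of_none h
  · rw [opE_eq_none] at h
    change ∀ c, rawE1 b.1 = some c → _ at h
    change epsFun l 1 b.1 = 0
    have hb := mem_iff.mp b.2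
    simp only [epsFun, top]
    unfold rawE1 pos at h
    split_ifs at h <;> (try have h := h _ rfl) <;> (try rw [mem_iff] at h) <;>
      (try dsimp only at h) <;> omega
  · rw [opE_eq_none] at h
    change ∀ c, rawE2 b.1 = some c → _ at h
    change epsFun l 2 b.1 = 0
    have hb := mem_iff.mp b.2
    have hk := two_mul_z4 b.2
    simp only [epsFun, top]
    unfold rawE2 at h
    split_ifs at h <;> have h := h _ rfl <;> rw [mem_iff] at h <;>
      dsimp only at h <;> omega

theorem phiFun_zero_of_none {l : ℕ} {b : Elt l} (h : opF l 0 b = none) : phiFun l 0 b.1 = 0 := by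
  rw [opF_eq_none] at h
  obtain ⟨b, hb⟩ := b
  have hk := two_mul_z4 hb
  have hs := two_mul_s hb
  have hb' := mem_iff.mp hb
  dsimp only at h ⊢
  simp only [phiFun, top]
  have hz : b.z1 = b.y1 - b.x1 ∧ b.z2 = b.y2 - b.y3 ∧ b.z3 = b.x3 - b.x2 := ⟨rfl, rfl, rfl⟩
  obtain ⟨p1, p2, p3⟩ := hz
  change ∀ c, rawF0 b = some c → ¬ c.Mem l at h
  unfold rawF0 at h
  simp only [gt_iff_lt, ge_iff_le, ← add_assoc, add_pos_le, lt_add_neg] at h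
  generalize b.z4 = bz4 at *
  generalize b.z1 = bz1 at *
  generalize b.z2 = bz2 at *
  generalize b.z3 = bz3 at *
  split_ifs at h with h1 h2 h3 h4 h5 h6
  -- Only raising `x₁` can leave `B_l`; then `s b = l` and the maximum is the empty partial sum.
  · have h := h _ rfl
    rw [mem_iff] at h
    dsimp only at h
    rw [max6_eq (m := 0) (a := 0) (b := bz1)] <;> omega
  · have h := h _ rfl
    rw [mem_iff] at h
    dsimp only at h
    exfalso
    omega
  · have h := h _ rfl
    rw [mem_iff] at h
    dsimp only at h
    exfalso
    omega
  · have h := h _ rfl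
    rw [mem_iff] at h
    dsimp only at h
    exfalso
    omega
  · have h := h _ rfl
    rw [mem_iff] at h
    dsimp only at h
    exfalso
    omega
  · have h := h _ rfl
    rw [mem_iff] at h
    dsimp only at h
    exfalso
    omega
  · exfalso
    clear h
    omega

theorem phiFun_of_none {l : ℕ} {b : Elt l} (i : Fin 3) (h : opF l i b = none) :
    phiFun l i b.1 = 0 := by
  fin_cases i
  · exact phiFun_zero_of_none h
  · rw [opF_eq_none] at h
    change ∀ c, rawF1 b.1 = some c → _ at h
    change phiFun l 1 b.1 = 0
    have hb := mem_iff.mp b.2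
    simp only [phiFun, top]
    unfold rawF1 pos at h
    split_ifs at h <;> (try have h := h _ rfl) <;> (try rw [mem_iff] at h) <;>
      (try dsimp only at h) <;> omega
  · rw [opF_eq_none] at h
    change ∀ c, rawF2 b.1 = some c → _ at h
    change phiFun l 2 b.1 = 0
    have hb := mem_iff.mp b.2
    have hk := two_mul_z4 b.2
    simp only [phiFun, top]
    unfold rawF2 at h
    split_ifs at h <;> have h := h _ rfl <;> rw [mem_iff] at h <;>
      dsimp only at h <;> omega

theorem ε_eq_epsFun {l : ℕ} (i : Fin 3) (b : Elt l) : ((crystal l).ε i b : ℤ) = epsFun l i b.1 :=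
  (crystal l).ε_eq_of_step i (fun b => epsFun l i b.1) (fun _ => epsFun_of_none i)
    (fun _ _ => epsFun_of_some i) b

theorem φ_eq_phiFun {l : ℕ} (i : Fin 3) (b : Elt l) : ((crystal l).φ i b : ℤ) = phiFun l i b.1 :=
  (crystal l).φ_eq_of_step i (fun b => phiFun l i b.1) (fun _ => phiFun_of_none i)
    (fun b c h => by
      have h' : opE l i c = some b := (op_inverse l i b c).mp h
      have := weight_of_some i h'
      have := epsFun_of_some i h'
      change phiFun l i b.1 = phiFun l i c.1 + 1
      omega) b

/-! ### The action of `e i` on multiplicities -/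

/-- The value of a linear form. -/
def Lin.val (f : Lin) (v : Letter → ℕ) : ℤ :=
  ((f.p.a : ℤ) - f.n.a) * v n1 + ((f.p.b : ℤ) - f.n.b) * v n2 + ((f.p.c : ℤ) - f.n.c) * v n3 +
  ((f.p.d : ℤ) - f.n.d) * v n0 + ((f.p.e : ℤ) - f.n.e) * v m3 + ((f.p.f : ℤ) - f.n.f) * v m2 +
  ((f.p.g : ℤ) - f.n.g) * v m1 + ((f.p.h : ℤ) - f.n.h) * v phi

/-- The partial sum of `r` is the last largest one. -/
def IsTop (i : Fin 3) (v : Letter → ℕ) (r : Row) : Prop :=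
  r ∈ rows i ∧ (∀ g ∈ r.pre, g.val v ≤ r.s.val v) ∧ ∀ g ∈ r.post, g.val v < r.s.val v

/-- `w` is the outcome of an action on `v`. -/
def Act.Res : Act → (Letter → ℕ) → Option (Letter → ℕ) → Prop
  | .move _ m, v, none => ∃ a ∈ m, v a < 1
  | .move p m, v, some w => (∀ a ∈ m, 1 ≤ v a) ∧ ∀ x, w x + m.count x = v x + p.count x
  | .split y n, v, w => if 1 ≤ v n0 then y.Res v w else n.Res v w

theorem conf_eq {l : ℕ} (b : Elt l) : (conf b n1 : ℤ) = b.1.x1 ∧ (conf b n2 : ℤ) = b.1.x2 ∧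
    2 * (conf b n3 : ℤ) + conf b n0 = b.1.x3 ∧ (conf b n0 : ℤ) ≤ 1 ∧
    2 * (conf b m3 : ℤ) + conf b n0 = b.1.y3 ∧ (conf b m2 : ℤ) = b.1.y2 ∧
    (conf b m1 : ℤ) = b.1.y1 ∧ (conf b phi : ℤ) = l - b.1.s := by
  have := b.2
  simp only [Coord.Mem] at this
  refine ⟨?_, ?_, ?_, ?_, ?_, ?_, ?_, ?_⟩ <;> simp only [conf] <;> omega

/-- The number of letters `x` after the letters `m` are replaced by the letters `p`. -/
def moved (v : Letter → ℕ) (p m : List Letter) (x : Letter) : ℤ := v x + p.count x - m.count x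

/-- The new tuple lies in `B_l` as soon as no new multiplicity is negative; the bound on `s` is the
case of the letter `ϕ`. By `hm`, a multiplicity becomes negative only if a removed letter was
absent, so vanishing of `e i` is absence of a letter in `m`. -/
theorem res_move {l : ℕ} {i : Fin 3} {b : Elt l} {c : Coord} {p m : List Letter}
    (h : rawE i b.1 = some c) (hm : m.Nodup) (hp : ∀ a ∈ m, p.count a = 0)
    (h0 : 0 ≤ moved (conf b) p m n0 ∧ moved (conf b) p m n0 ≤ 1)
    (h1 : moved (conf b) p m n1 = c.x1) (h2 : moved (conf b) p m n2 = c.x2)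
    (h3 : 2 * moved (conf b) p m n3 + moved (conf b) p m n0 = c.x3)
    (k3 : 2 * moved (conf b) p m m3 + moved (conf b) p m n0 = c.y3)
    (k2 : moved (conf b) p m m2 = c.y2) (k1 : moved (conf b) p m m1 = c.y1)
    (hs : moved (conf b) p m phi = l - c.s) :
    (Act.move p m).Res (conf b) ((opE l i b).map conf) := by
  cases hd : opE l i b with
  | some d =>
    obtain rfl : d.1 = c := by
      rw [opE_eq_some, h] at hd
      exact (Option.some.inj hd).symm
    have hw (x : Letter) : (conf d x : ℤ) = moved (conf b) p m x := by
      obtain ⟨g1, g2, g3, g0, e3, e2, e1, gs⟩ := conf_eq d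
      cases x <;> omega
    refine ⟨fun a ha => ?_, fun x => ?_⟩
    · have := hw a
      have := hp a ha
      have := List.count_pos_iff.mpr ha
      unfold moved at *
      omega
    · have := hw x
      unfold moved at this
      omega
  | none =>
    by_contra hn
    have hn' (x : Letter) : 0 ≤ moved (conf b) p m x := by
      by_contra hx
      refine hn ⟨x, ?_, ?_⟩
      · refine List.count_pos_iff.mp ?_
        unfold moved at hx
        omega
      · have := List.nodup_iff_count_le_one.mp hm x
        unfold moved at hx
        omega
    have e1 := hn' n1
    have e2 := hn' n2
    have e3 := hn' n3
    have e4 := hn' m3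
    have e5 := hn' m2
    have e6 := hn' m1
    have e7 := hn' phi
    refine opE_eq_none.mp hd c h ?_
    unfold Coord.Mem
    omega

/-- `r` describes the action of `e i` on `b ∈ B_l`. -/
def Describes {l : ℕ} (i : Fin 3) (b : Elt l) (r : Row) : Prop :=
  IsTop i (conf b) r ∧ (act i r.j).Res (conf b) ((opE l i b).map conf) ∧
    ((crystal l).φ i b : ℤ) = (getL (phiForms i) r.j).val (conf b) ∧
    ((crystal l).ε i b : ℤ) = (getL (epsForms i) r.j).val (conf b)

section
variable {l : ℕ} (b : Elt l)

set_option maxHeartbeats 2000000 in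
theorem exists_describes_zero : ∃ r, Describes 0 b r := by
  obtain ⟨v1, v2, v3, v0, w3, w2, w1, vp⟩ := conf_eq b
  have hs := two_mul_s b.2
  have p1 : b.1.z1 = b.1.y1 - b.1.x1 := rfl
  have p2 : b.1.z2 = b.1.y2 - b.1.y3 := rfl
  have p3 : b.1.z3 = b.1.x3 - b.1.x2 := rfl
  have p4 := two_mul_z4 b.2
  have hφ := φ_eq_phiFun 0 b
  have hε := ε_eq_epsFun 0 b
  simp only [phiFun, epsFun] at hφ hε
  rcases rawE0_cases b.1 rfl with h | h | h | h | h | h <;> obtain ⟨h1, h2, h3, h4, h5, h6⟩ := h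
  · have ht : top 0 b.1 = 0 := by
      apply max6_eq <;> omega
    rw [ht] at hφ hε
    have hr : (act 0 0).Res (conf b) ((opE l 0 b).map conf) := by
      apply res_move (i := 0) h6 <;> simp [moved, Coord.s] <;> omega
    refine ⟨(rows 0)[0]'(by decide), ⟨List.getElem_mem _, ?_, ?_⟩, hr, ?_, ?_⟩ <;>
      simp [rows, rowsAux, prefixes, getL, phiForms, epsForms, Lin.val] <;> omega
  · have ht : top 0 b.1 = b.1.z1 := by
      apply max6_eq <;> omega
    rw [ht] at hφ hε
    have hr : (act 0 1).Res (conf b) ((opE l 0 b).map conf) := by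
      -- `x₃` and `x̄₃` both change parity here, so a letter `0` disappears if there is one and
      -- appears otherwise.
      change if 1 ≤ conf b n0 then _ else _
      split_ifs <;> apply res_move (i := 0) h6 <;> simp [moved, Coord.s] <;> omega
    refine ⟨(rows 0)[1]'(by decide), ⟨List.getElem_mem _, ?_, ?_⟩, hr, ?_, ?_⟩ <;>
      simp [rows, rowsAux, prefixes, getL, phiForms, epsForms, Lin.val] <;> omega
  · have ht : top 0 b.1 = b.1.z1 + b.1.z2 := by
      apply max6_eq <;> omega
    rw [ht] at hφ hε
    have hr : (act 0 2).Res (conf b) ((opE l 0 b).map conf) := by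
      apply res_move (i := 0) h6 <;> simp [moved, Coord.s] <;> omega
    refine ⟨(rows 0)[2]'(by decide), ⟨List.getElem_mem _, ?_, ?_⟩, hr, ?_, ?_⟩ <;>
      simp [rows, rowsAux, prefixes, getL, phiForms, epsForms, Lin.val] <;> omega
  · have ht : top 0 b.1 = b.1.z1 + b.1.z2 + 3 * b.1.z4 := by
      apply max6_eq <;> omega
    rw [ht] at hφ hε
    have hr : (act 0 3).Res (conf b) ((opE l 0 b).map conf) := by
      apply res_move (i := 0) h6 <;> simp [moved, Coord.s] <;> omega
    refine ⟨(rows 0)[3]'(by decide), ⟨List.getElem_mem _, ?_, ?_⟩, hr, ?_, ?_⟩ <;>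
      simp [rows, rowsAux, prefixes, getL, phiForms, epsForms, Lin.val] <;> omega
  · have ht : top 0 b.1 = b.1.z1 + b.1.z2 + 3 * b.1.z4 + b.1.z3 := by
      apply max6_eq <;> omega
    rw [ht] at hφ hε
    have hr : (act 0 4).Res (conf b) ((opE l 0 b).map conf) := by
      change if 1 ≤ conf b n0 then _ else _
      split_ifs <;> apply res_move (i := 0) h6 <;> simp [moved, Coord.s] <;> omega
    refine ⟨(rows 0)[4]'(by decide), ⟨List.getElem_mem _, ?_, ?_⟩, hr, ?_, ?_⟩ <;>
      simp [rows, rowsAux, prefixes, getL, phiForms, epsForms, Lin.val] <;> omega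
  · have ht : top 0 b.1 = 2 * b.1.z1 + b.1.z2 + 3 * b.1.z4 + b.1.z3 := by
      apply max6_eq <;> omega
    rw [ht] at hφ hε
    have hr : (act 0 5).Res (conf b) ((opE l 0 b).map conf) := by
      apply res_move (i := 0) h6 <;> simp [moved, Coord.s] <;> omega
    refine ⟨(rows 0)[5]'(by decide), ⟨List.getElem_mem _, ?_, ?_⟩, hr, ?_, ?_⟩ <;>
      simp [rows, rowsAux, prefixes, getL, phiForms, epsForms, Lin.val] <;> omega

theorem exists_describes_one : ∃ r, Describes 1 b r := by
  obtain ⟨v1, v2, v3, v0, w3, w2, w1, vp⟩ := conf_eq b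
  have hs := two_mul_s b.2
  have hφ := φ_eq_phiFun 1 b
  have hε := ε_eq_epsFun 1 b
  simp only [phiFun, epsFun, top] at hφ hε
  have he : rawE 1 b.1 = rawE1 b.1 := rfl
  unfold rawE1 pos at he
  split_ifs at he with h1 h2 h3
  · have hr : (act 1 2).Res (conf b) ((opE l 1 b).map conf) := by
      apply res_move he <;> simp [moved, Coord.s] <;> omega
    refine ⟨(rows 1)[2]'(by decide), ⟨List.getElem_mem _, ?_, ?_⟩, hr, ?_, ?_⟩ <;>
      simp [rows, rowsAux, prefixes, getL, phiForms, epsForms, Lin.val] <;> omega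
  · have hr : (act 1 1).Res (conf b) ((opE l 1 b).map conf) := by
      change if 1 ≤ conf b n0 then _ else _
      split_ifs <;> apply res_move he <;> simp [moved, Coord.s] <;> omega
    refine ⟨(rows 1)[1]'(by decide), ⟨List.getElem_mem _, ?_, ?_⟩, hr, ?_, ?_⟩ <;>
      simp [rows, rowsAux, prefixes, getL, phiForms, epsForms, Lin.val] <;> omega
  · have hr : (act 1 0).Res (conf b) ((opE l 1 b).map conf) := by
      apply res_move he <;> simp [moved, Coord.s] <;> omega
    refine ⟨(rows 1)[0]'(by decide), ⟨List.getElem_mem _, ?_, ?_⟩, hr, ?_, ?_⟩ <;>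
      simp [rows, rowsAux, prefixes, getL, phiForms, epsForms, Lin.val] <;> omega
  · omega

theorem exists_describes_two : ∃ r, Describes 2 b r := by
  obtain ⟨v1, v2, v3, v0, w3, w2, w1, vp⟩ := conf_eq b
  have hs := two_mul_s b.2
  have p4 := two_mul_z4 b.2
  have hφ := φ_eq_phiFun 2 b
  have hε := ε_eq_epsFun 2 b
  simp only [phiFun, epsFun, top] at hφ hε
  have he : rawE 2 b.1 = rawE2 b.1 := rfl
  unfold rawE2 at he
  split_ifs at he with h
  · have hr : (act 2 1).Res (conf b) ((opE l 2 b).map conf) := by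
      apply res_move he <;> simp [moved, Coord.s] <;> omega
    refine ⟨(rows 2)[1]'(by decide), ⟨List.getElem_mem _, ?_, ?_⟩, hr, ?_, ?_⟩ <;>
      simp [rows, rowsAux, prefixes, getL, phiForms, epsForms, Lin.val] <;> omega
  · have hr : (act 2 0).Res (conf b) ((opE l 2 b).map conf) := by
      apply res_move he <;> simp [moved, Coord.s] <;> omega
    refine ⟨(rows 2)[0]'(by decide), ⟨List.getElem_mem _, ?_, ?_⟩, hr, ?_, ?_⟩ <;>
      simp [rows, rowsAux, prefixes, getL, phiForms, epsForms, Lin.val] <;> omega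
end

theorem exists_describes {l : ℕ} (i : Fin 3) (b : Elt l) : ∃ r, Describes i b r := by
  fin_cases i
  · exact exists_describes_zero b
  · exact exists_describes_one b
  · exact exists_describes_two b

/-! ### Soundness of the decision procedure -/

theorem bool_rec_and {b c : Bool} (h : (Bool.rec false c b : Bool) = true) : b = true ∧ c = true := by
  cases b
  · cases h
  · exact ⟨rfl, h⟩

theorem bool_rec_or {b c : Bool} (h : (Bool.rec c true b : Bool) = true) : b = true ∨ c = true := by
  cases b
  · exact Or.inr h
  · exact Or.inl rfl

theorem andB_right {b c : Bool} (h : andB b c = true) : c = true := (bool_rec_and h).2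

theorem orB_cases {b c : Bool} (h : orB b c = true) : b = true ∨ c = true := bool_rec_or h

theorem bool_rec_cases {b c d : Bool} (h : (Bool.rec c d b : Bool) = true) :
    (b = true ∧ d = true) ∨ (b = false ∧ c = true) := by
  cases b
  · exact Or.inr ⟨rfl, h⟩
  · exact Or.inl ⟨rfl, h⟩

/-- `∑ (K - t x) v x` -/
def wsum (K : ℤ) (t : V8) (v : Letter → ℕ) : ℤ :=
  (K - t.a) * v n1 + (K - t.b) * v n2 + (K - t.c) * v n3 + (K - t.d) * v n0 + (K - t.e) * v m3 +
    (K - t.f) * v m2 + (K - t.g) * v m1 + (K - t.h) * v phi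

def Con.Holds (c : Con) (v : Letter → ℕ) : Prop := 0 ≤ wsum 16 c.t v + c.p - c.q

def InBox (lo w : V8) (v : Letter → ℕ) : Prop :=
  (∀ x, lo.get x ≤ v x) ∧ ∀ x, v x ≤ w.get x ∨ 1000000 ≤ w.get x

def St.Holds (st : St) (v : Letter → ℕ) : Prop := InBox st.lo st.w v ∧ ∀ c ∈ st.cs, c.Holds v

/-- A nonnegative coefficient is estimated by the upper bound, a negative one by the lower bound. If
the upper bound is missing, a positive coefficient would contribute at least 1000000 and violate
`hb`, so the coefficient is zero or negative. -/
theorem coord_le {K a lo w v : ℕ} (hl : lo ≤ v) (hw : v ≤ w ∨ 1000000 ≤ w)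
    (hb : (K - a) * w ≤ 100000) :
    ((K : ℤ) - a) * v ≤ ((K - a) * w : ℕ) - ((a - K) * lo : ℕ) := by
  rcases le_total a K with h | h
  · obtain ⟨d, rfl⟩ := Nat.exists_eq_add_of_le h
    have h1 : a + d - a = d := by omega
    have h2 : a - (a + d) = 0 := by omega
    rw [h1] at hb ⊢
    rw [h2]
    push_cast
    rcases hw with hw | hw
    · have : d * v ≤ d * w := Nat.mul_le_mul_left d hw
      zify at this
      linarith
    · have : d = 0 := by
        by_contra hd
        have : 1 * 1000000 ≤ d * w := Nat.mul_le_mul (by omega) hw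
        omega
      subst this
      simp
  · obtain ⟨d, rfl⟩ := Nat.exists_eq_add_of_le h
    have h1 : K + d - K = d := by omega
    have h2 : K - (K + d) = 0 := by omega
    rw [h1, h2]
    have : d * lo ≤ d * v := Nat.mul_le_mul_left d hl
    zify at this
    push_cast
    linarith

theorem negCore_sound {K : ℕ} {s lo w : V8} {p n : ℕ} (h : negCore K s lo w p n = true)
    {v : Letter → ℕ} (hv : InBox lo w v) : wsum K s v + p - n < 0 := by
  unfold negCore at h
  obtain ⟨h1, h2⟩ := bool_rec_and h
  have h1 := Nat.le_of_ble_eq_true h1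
  have h2 : _ < _ := Nat.blt_eq.mp h2
  simp only [boundPos, boundNeg, Nat.add_eq, Nat.mul_eq, Nat.sub_eq] at h1 h2
  obtain ⟨hl, hw⟩ := hv
  -- The limit 100000 on `boundNeg` also limits `boundPos`, and hence each of its summands.
  have ka := @coord_le K s.a lo.a w.a _ (hl n1) (hw n1) (by omega)
  have kb := @coord_le K s.b lo.b w.b _ (hl n2) (hw n2) (by omega)
  have kc := @coord_le K s.c lo.c w.c _ (hl n3) (hw n3) (by omega)
  have kd := @coord_le K s.d lo.d w.d _ (hl n0) (hw n0) (by omega)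
  have ke := @coord_le K s.e lo.e w.e _ (hl m3) (hw m3) (by omega)
  have kf := @coord_le K s.f lo.f w.f _ (hl m2) (hw m2) (by omega)
  have kg := @coord_le K s.g lo.g w.g _ (hl m1) (hw m1) (by omega)
  have kh := @coord_le K s.h lo.h w.h _ (hl phi) (hw phi) (by omega)
  unfold wsum
  generalize ((K : ℤ) - s.a) * v n1 = A at *
  generalize ((K : ℤ) - s.b) * v n2 = B at *
  generalize ((K : ℤ) - s.c) * v n3 = C at *
  generalize ((K : ℤ) - s.d) * v n0 = D at *
  generalize ((K : ℤ) - s.e) * v m3 = E at *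
  generalize ((K : ℤ) - s.f) * v m2 = F at *
  generalize ((K : ℤ) - s.g) * v m1 = G at *
  generalize ((K : ℤ) - s.h) * v phi = H at *
  omega

/-- The shift 16 of the coefficients adds up, which is why sums of two and three conditions are
evaluated relative to 32 and 48. -/
theorem wsum_addV (K L : ℤ) (s t : V8) (v : Letter → ℕ) :
    wsum (K + L) (addV s t) v = wsum K s v + wsum L t v := by
  simp only [wsum, addV, Nat.add_eq]
  push_cast
  ring

/-- The comparison with the mask is a filter that saves time; `negCore` alone carries the
contradiction. -/
theorem test1_sound {g : Con} {lo w : V8} {mask : ℕ} (h : test1 g lo w mask = true)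
    {v : Letter → ℕ} (hv : InBox lo w v) (hg : g.Holds v) : False := by
  unfold test1 at h
  have h := andB_right h
  have := negCore_sound (K := 16) h hv
  unfold Con.Holds at hg
  push_cast at this
  omega

theorem test2_sound {f g : Con} {lo w : V8} {mask : ℕ} (h : test2 f g lo w mask = true)
    {v : Letter → ℕ} (hv : InBox lo w v) (hf : f.Holds v) (hg : g.Holds v) : False := by
  unfold test2 at h
  have h := andB_right h
  have := negCore_sound (K := 32) (s := addV f.t g.t) h hv
  unfold Con.Holds at hf hg
  have e := wsum_addV 16 16 f.t g.t v
  simp only [Nat.add_eq] at this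
  push_cast at this
  norm_num at e
  omega

theorem test3_sound {f g k : Con} {lo w : V8} {mask : ℕ} (h : test3 f g k lo w mask = true)
    {v : Letter → ℕ} (hv : InBox lo w v) (hf : f.Holds v) (hg : g.Holds v) (hk : k.Holds v) :
    False := by
  unfold test3 at h
  have h := andB_right h
  have := negCore_sound (K := 48) (s := addV (addV f.t g.t) k.t) h hv
  unfold Con.Holds at hf hg hk
  have e := wsum_addV 32 16 (addV f.t g.t) k.t v
  have e' := wsum_addV 16 16 f.t g.t v
  simp only [Nat.add_eq] at this
  push_cast at this
  norm_num at e e'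
  omega

theorem exists_of_anyOf {p : Con → Bool} {cs : List Con} (h : anyOf p cs = true) :
    ∃ g ∈ cs, p g = true := by
  induction cs with
  | nil => cases h
  | cons g gs ih =>
    rcases bool_rec_or h with h | h
    · exact ⟨g, by simp, h⟩
    · obtain ⟨g, hg, h⟩ := ih h
      exact ⟨g, by simp [hg], h⟩

theorem exists_of_anyTail {p : Con → List Con → Bool} {cs : List Con} (h : anyTail p cs = true) :
    ∃ g gs, g ∈ cs ∧ gs ⊆ cs ∧ p g gs = true := by
  induction cs with
  | nil => cases h
  | cons g gs ih =>
    rcases bool_rec_or h with h | h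
    · exact ⟨g, _, by simp, List.Subset.refl _, h⟩
    · obtain ⟨g, hs, hg, hs', h⟩ := ih h
      exact ⟨g, hs, by simp [hg], fun x hx => List.mem_cons_of_mem _ (hs' hx), h⟩

section
variable {lo w : V8} {mask : ℕ} {v : Letter → ℕ}

theorem any1_sound (hv : InBox lo w v) {cs : List Con} (h : any1 lo w mask cs = true)
    (hc : ∀ c ∈ cs, c.Holds v) : False := by
  obtain ⟨g, hg, h⟩ := exists_of_anyOf h
  exact test1_sound h hv (hc g hg)

theorem any2_sound (hv : InBox lo w v) {f : Con} (hf : f.Holds v) {cs : List Con}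
    (h : any2 f lo w mask cs = true) (hc : ∀ c ∈ cs, c.Holds v) : False := by
  obtain ⟨g, hg, h⟩ := exists_of_anyOf h
  exact test2_sound h hv hf (hc g hg)

theorem deep_sound (hv : InBox lo w v) {cs : List Con} (h : deep lo w mask cs = true)
    (hc : ∀ c ∈ cs, c.Holds v) : False := by
  obtain ⟨f, fs, hf, hfs, h⟩ := exists_of_anyTail h
  obtain ⟨g, gs, hg, hgs, h⟩ := exists_of_anyTail h
  obtain ⟨k, hk, h⟩ := exists_of_anyOf h
  exact test3_sound h hv (hc f hf) (hc g (hfs hg)) (hc k (hfs (hgs hk)))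
end

/-- Success of `r` on a state that contains `v` implies `P`. -/
def Proves (r : Proc) (v : Letter → ℕ) (P : Prop) : Prop := ∀ st : St, st.Holds v → r st = true → P

section
variable {r s : Proc} {v : Letter → ℕ} {P : Prop}

theorem proves_ret {b : Bool} (h : b = true → P) : Proves (ret b) v P := by
  intro st hst hr
  unfold ret at hr
  rcases bool_rec_or hr with hr | hr
  · exact h hr
  · exact (deep_sound hst.1 hr hst.2).elim

theorem proves_both_left (h : Proves r v P) : Proves (both r s) v P :=
  fun st hst hr => h st hst (bool_rec_and hr).1

theorem proves_both_right (h : Proves s v P) : Proves (both r s) v P :=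
  fun st hst hr => h st hst (bool_rec_and hr).2

theorem V8.get_set (u : V8) (x y : Letter) (m : ℕ) :
    (u.set x m).get y = if y = x then m else u.get y := by
  cases x <;> cases y <;> rfl

theorem go_sound {lo w : V8} {mask : ℕ} {cs : List Con} (h : Proves r v P)
    (hr : go r lo w mask cs = true) (hv : InBox lo w v) (hc : ∀ c ∈ cs, c.Holds v) : P := by
  unfold go at hr
  rcases bool_rec_or hr with hr | hr
  · exact (any1_sound hv hr hc).elim
  · exact h ⟨lo, w, mask, cs⟩ ⟨hv, hc⟩ hr

theorem proves_ge {x : Letter} {m : ℕ} (hx : m ≤ v x) (h : Proves r v P) :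
    Proves (ge x m r) v P := by
  intro st hst hr
  unfold ge at hr
  rcases bool_rec_cases hr with ⟨-, hr⟩ | ⟨-, hr⟩
  · exact h st hst hr
  · have hin : InBox (st.lo.set x m) st.w v := by
      refine ⟨fun y => ?_, hst.1.2⟩
      rw [V8.get_set]
      split_ifs with hy
      · exact hy ▸ hx
      · exact hst.1.1 y
    rcases bool_rec_cases hr with ⟨h1, hr⟩ | ⟨-, hr⟩
    · have h1 : _ < _ := Nat.blt_eq.mp h1
      have hr := Nat.le_of_ble_eq_true hr
      have := hst.1.2 x
      omega
    · exact go_sound h hr hin hst.2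

theorem proves_lt {x : Letter} {m : ℕ} (hx : v x < m) (h : Proves r v P) :
    Proves (lt x m r) v P := by
  intro st hst hr
  unfold lt at hr
  rcases bool_rec_cases hr with ⟨-, hr⟩ | ⟨-, hr⟩
  · exact h st hst hr
  · rcases bool_rec_or hr with hr | hr
    · have := Nat.le_of_ble_eq_true hr
      have := hst.1.1 x
      omega
    · refine go_sound h hr ⟨hst.1.1, fun y => ?_⟩ hst.2
      rw [V8.get_set]
      split_ifs with hy
      · subst hy
        left
        rw [Nat.pred_eq_sub_one]
        omega
      · exact hst.1.2 y

theorem proves_assume {c : Con} (hc : c.Holds v) (h : Proves r v P) : Proves (assume c r) v P := by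
  intro st hst hr
  unfold assume at hr
  rcases orB_cases hr with hr | hr
  · exact (test1_sound hr hst.1 hc).elim
  · rcases orB_cases hr with hr | hr
    · exact (any2_sound hst.1 hc hr hst.2).elim
    · refine h ⟨st.lo, st.w, st.mask, c :: st.cs⟩ ⟨hst.1, ?_⟩ hr
      intro d hd
      rcases List.mem_cons.mp hd with rfl | hd
      · exact hc
      · exact hst.2 d hd
end

/-- `v'` arises from `v` by the offset `d`. -/
def Off.Rel (d : Off) (v v' : Letter → ℕ) : Prop := ∀ x, v' x + d.n.get x = v x + d.p.get x

theorem off0_rel (v : Letter → ℕ) : off0.Rel v v := fun x => by cases x <;> rfl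

section
variable {r s : Proc} {v v' v'' : Letter → ℕ} {P : Prop} {d : Off}

/-- Success means success on both branches, so it suffices to follow the one that `v` takes. All
programs are in continuation style, and their soundness proofs follow the path of `v` in this way.
-/
theorem proves_askPos {x : Letter} {m : ℕ} (hd : d.Rel v v') (h1 : m ≤ v' x → Proves r v P)
    (h2 : v' x < m → Proves s v P) : Proves (askPos d x m r s) v P := by
  have hx := hd x
  rcases Nat.lt_or_ge (v' x) m with h | h
  · refine proves_both_right (proves_lt ?_ (h2 h))
    simp only [Nat.sub_eq, Nat.add_eq]
    omega
  · refine proves_both_left (proves_ge ?_ (h1 h))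
    simp only [Nat.sub_eq, Nat.add_eq]
    omega

theorem incs_get (w : List Letter) (u : V8) (x : Letter) :
    (incs w u).get x = u.get x + w.count x := by
  induction w with
  | nil => rfl
  | cons a w ih =>
    change ((incs w u).set a (Nat.succ ((incs w u).get a))).get x = _
    rw [V8.get_set, List.count_cons]
    by_cases h : a = x
    · subst h
      simp [ih]
      omega
    · simp [h, Ne.symm h, ih]

theorem Off.Rel.shift {p m : List Letter} (hd : d.Rel v v')
    (h : ∀ x, v'' x + m.count x = v' x + p.count x) : (d.shift p m).Rel v v'' := by
  intro x
  have := hd x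
  have := h x
  simp only [Off.shift, incs_get]
  omega

/-- The leaf that `v` reaches is labelled by `α` and `H` and changes `v` into `v'`. -/
def DTree.Result : DTree → (Letter → ℕ) → Letter → (Letter → ℕ) → ℤ → Prop
  | .out α p m H, v, α', v', H' => α' = α ∧ H' = H ∧ ∀ x, v' x + m.count x = v x + p.count x
  | .br a m y n, v, α', v', H' => if m ≤ v a then y.Result v α' v' H' else n.Result v α' v' H'

theorem proves_prog {k : Letter → Off → ℤ → Proc} {α : Letter} {H : ℤ} (t : DTree)
    (hd : d.Rel v v') (ht : t.Result v' α v'' H)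
    (hk : ∀ d' : Off, d'.Rel v v'' → Proves (k α d' H) v P) : Proves (t.prog d k) v P := by
  induction t with
  | out α p m H =>
    obtain ⟨rfl, rfl, h⟩ := ht
    exact hk _ (hd.shift h)
  | br a m y n hy hn =>
    refine proves_askPos hd (fun h => hy ?_) (fun h => hn ?_)
    · simpa [DTree.Result, h] using ht
    · simpa [DTree.Result, Nat.not_le.mpr h] using ht

theorem V8.get_n1 (u : V8) : u.get n1 = u.a := rfl
theorem V8.get_n2 (u : V8) : u.get n2 = u.b := rfl
theorem V8.get_n3 (u : V8) : u.get n3 = u.c := rfl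
theorem V8.get_n0 (u : V8) : u.get n0 = u.d := rfl
theorem V8.get_m3 (u : V8) : u.get m3 = u.e := rfl
theorem V8.get_m2 (u : V8) : u.get m2 = u.f := rfl
theorem V8.get_m1 (u : V8) : u.get m1 = u.g := rfl
theorem V8.get_phi (u : V8) : u.get phi = u.h := rfl

theorem dot_eq (s t : V8) (z : ℕ) : dot s t z = s.a * t.a + s.b * t.b + s.c * t.c + s.d * t.d +
    s.e * t.e + s.f * t.f + s.g * t.g + s.h * t.h + z := by
  simp only [dot, Nat.add_eq, Nat.mul_eq]
  ring

theorem Lin.val_rel (f : Lin) (hd : d.Rel v v') : f.val v' = f.val v + f.pv d - f.nv d := by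
  have h (x : Letter) : (v' x : ℤ) = v x + d.p.get x - d.n.get x := by
    have := hd x
    omega
  simp only [Lin.val, Lin.pv, Lin.nv, dot_eq, h]
  simp only [V8.get_n1, V8.get_n2, V8.get_n3, V8.get_n0, V8.get_m3, V8.get_m2, V8.get_m1, V8.get_phi]
  push_cast
  ring

def V8.Le (u : V8) (k : ℕ) : Prop := ∀ x, u.get x ≤ k

/-- The bound on the positive coefficients keeps `16 + n - p` from being truncated in `bias1`. -/
theorem con_holds {p n : V8} {c e : ℕ} (hp : p.Le 16) :
    (con p n c e).Holds v ↔ 0 ≤ (Lin.mk p n).val v + c - e := by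
  have h {a b : ℕ} (ha : a ≤ 16) : (16 : ℤ) - bias1 a b = a - b := by
    simp only [bias1, Nat.add_eq, Nat.sub_eq]
    omega
  have h1 := h (b := n.a) (hp n1)
  have h2 := h (b := n.b) (hp n2)
  have h3 := h (b := n.c) (hp n3)
  have h4 := h (b := n.d) (hp n0)
  have h5 := h (b := n.e) (hp m3)
  have h6 := h (b := n.f) (hp m2)
  have h7 := h (b := n.g) (hp m1)
  have h8 := h (b := n.h) (hp phi)
  simp only [V8.get_n1, V8.get_n2, V8.get_n3, V8.get_n0, V8.get_m3, V8.get_m2, V8.get_m1,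
    V8.get_phi] at h1 h2 h3 h4 h5 h6 h7 h8
  simp only [Con.Holds, con, bias, wsum, Lin.val, h1, h2, h3, h4, h5, h6, h7, h8]

/-- With 8 for single forms, differences of two forms stay within the bound 16 of `con_holds`. -/
def Lin.Small (f : Lin) : Prop := f.p.Le 8 ∧ f.n.Le 8

theorem Lin.val_swap (f : Lin) : (Lin.mk f.n f.p).val v = -f.val v := by
  simp only [Lin.val]
  ring

theorem Lin.val_sub (f g : Lin) : (Lin.mk (addV f.p g.n) (addV f.n g.p)).val v = f.val v - g.val v := by
  simp only [Lin.val, addV, Nat.add_eq]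
  push_cast
  ring

theorem addV_le {s t : V8} (hs : s.Le 8) (ht : t.Le 8) : (addV s t).Le 16 := by
  intro x
  have h1 := hs x
  have h2 := ht x
  have : (addV s t).get x = s.get x + t.get x := by cases x <;> rfl
  omega

theorem proves_ask {f : Lin} {p q : ℕ} (hf : f.Small) (h1 : (q : ℤ) ≤ f.val v + p → Proves r v P)
    (h2 : f.val v + p < q → Proves s v P) : Proves (ask f p q r s) v P := by
  rcases lt_or_ge (f.val v + p) q with h | h
  · refine proves_both_right (proves_assume ?_ (h2 h))
    rw [con_holds fun x => (hf.2 x).trans (by norm_num), Lin.val_swap]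
    push_cast [Nat.succ_eq_add_one]
    omega
  · refine proves_both_left (proves_assume ?_ (h1 h))
    rw [con_holds fun x => (hf.1 x).trans (by norm_num)]
    change 0 ≤ f.val v + p - q
    omega

theorem proves_geP {f g : Lin} {t : ℕ} (hf : f.Small) (hg : g.Small) (hd : d.Rel v v')
    (h : g.val v' + t ≤ f.val v') (hr : Proves r v P) : Proves (geP f g d t r) v P := by
  refine proves_assume ?_ hr
  rw [con_holds (addV_le hf.1 hg.2), Lin.val_sub]
  rw [g.val_rel hd, f.val_rel hd] at h
  simp only [Nat.add_eq]
  push_cast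
  omega

theorem proves_geAll {f : Lin} {t : ℕ} {l : List Lin} (hf : f.Small) (hl : ∀ g ∈ l, g.Small)
    (hd : d.Rel v v') (h : ∀ g ∈ l, g.val v' + t ≤ f.val v') (hr : Proves r v P) :
    Proves (geAll f d t l r) v P := by
  induction l with
  | nil => exact hr
  | cons g l ih =>
    exact proves_geP hf (hl g (by simp)) hd (h g (by simp))
      (ih (fun k hk => hl k (by simp [hk])) fun k hk => h k (by simp [hk]))

/-- Leaving out an assumption is always sound, so it need not be shown that the omitted conditions
follow from the others. -/
theorem proves_geAll' {f : Lin} {t : ℕ} {l : List Lin} (hf : f.Small) (hl : ∀ g ∈ l, g.Small)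
    (hd : d.Rel v v') (h : ∀ g ∈ l, g.val v' + t ≤ f.val v') (hr : Proves r v P) :
    Proves (geAll' f d t l r) v P := by
  induction l with
  | nil => exact hr
  | cons g l ih =>
    have ih := ih (fun k hk => hl k (by simp [hk])) fun k hk => h k (by simp [hk])
    change Proves (branch (constGe f g d 0) (geAll' f d t l r) (geP f g d t (geAll' f d t l r))) v P
    generalize constGe f g d 0 = c
    cases c
    · exact proves_geP hf (hl g (by simp)) hd (h g (by simp)) ih
    · exact ih
end

theorem mem_rowsAux {r : Row} {j : ℕ} {pre l : List Lin} (h : r ∈ rowsAux j pre l) :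
    j ≤ r.j ∧ (∀ x ∈ pre, x ∈ r.pre) ∧ r.s ∈ l ∧ (∀ x ∈ r.pre, x ∈ pre ∨ x ∈ l) ∧
      ∀ x ∈ r.post, x ∈ l := by
  induction l generalizing j pre with
  | nil => cases h
  | cons s l ih =>
    rcases List.mem_cons.mp h with rfl | h
    · exact ⟨le_rfl, fun _ h => h, by simp, fun _ h => .inl h, fun x hx => by simp [hx]⟩
    · obtain ⟨h1, h2, h3, h4, h5⟩ := ih h
      refine ⟨by omega, fun x hx => h2 x (by simp [hx]), by simp [h3], fun x hx => ?_,
        fun x hx => by simp [h5 x hx]⟩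
      have := h4 x hx
      simp only [List.mem_cons] at this ⊢
      tauto

def Row.Before (r r' : Row) : Prop := r.j < r'.j ∧ r.s ∈ r'.pre ∧ r'.s ∈ r.post

theorem rowsAux_pairwise (j : ℕ) (pre l : List Lin) : (rowsAux j pre l).Pairwise Row.Before := by
  induction l generalizing j pre with
  | nil => exact List.Pairwise.nil
  | cons s l ih =>
    refine List.Pairwise.cons (fun r hr => ?_) (ih _ _)
    obtain ⟨h1, h2, h3, -⟩ := mem_rowsAux hr
    exact ⟨h1, h2 s (by simp), h3⟩

theorem rows_before {i : Fin 3} {r r' : Row} (h : r ∈ rows i) (h' : r' ∈ rows i) :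
    r.j = r'.j ∨ r.Before r' ∨ r'.Before r := by
  refine List.Pairwise.forall_of_forall_of_flip (R := fun r r' : Row => r.j = r'.j ∨ r.Before r' ∨ r'.Before r)
    (fun a _ => .inl rfl) ((rowsAux_pairwise 0 [] (prefixes i)).imp fun h => .inr (.inl h))
    ((rowsAux_pairwise 0 [] (prefixes i)).imp fun h => .inr (.inr h)) h h'

theorem V8.le_of_all {u : V8} {k : ℕ} (h : u.a ≤ k ∧ u.b ≤ k ∧ u.c ≤ k ∧ u.d ≤ k ∧ u.e ≤ k ∧
    u.f ≤ k ∧ u.g ≤ k ∧ u.h ≤ k) : u.Le k := by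
  obtain ⟨_, _, _, _, _, _, _, _⟩ := h
  intro x
  cases x <;> assumption

instance (u : V8) (k : ℕ) : Decidable (u.Le k) :=
  decidable_of_iff (u.a ≤ k ∧ u.b ≤ k ∧ u.c ≤ k ∧ u.d ≤ k ∧ u.e ≤ k ∧ u.f ≤ k ∧ u.g ≤ k ∧ u.h ≤ k)
    ⟨V8.le_of_all, fun h => ⟨h n1, h n2, h n3, h n0, h m3, h m2, h m1, h phi⟩⟩

instance (f : Lin) : Decidable f.Small := inferInstanceAs (Decidable (_ ∧ _))

theorem prefixes_small : ∀ i, ∀ f ∈ prefixes i, f.Small := by decide +kernel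

theorem forms_small : ∀ i, ∀ r ∈ rows i,
    (getL (phiForms i) r.j).Small ∧ (getL (epsForms i) r.j).Small := by decide +kernel

theorem rows_small {i : Fin 3} {r : Row} (h : r ∈ rows i) :
    r.s.Small ∧ (∀ g ∈ r.pre, g.Small) ∧ ∀ g ∈ r.post, g.Small := by
  obtain ⟨-, -, h3, h4, h5⟩ := mem_rowsAux h
  refine ⟨prefixes_small i _ h3, fun g hg => prefixes_small i g ?_, fun g hg => prefixes_small i g (h5 g hg)⟩
  simpa using h4 g hg

section
variable {r s : Proc} {v v' v'' : Letter → ℕ} {P : Prop} {d : Off}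

theorem proves_top {i : Fin 3} {r0 : Row} {s : Proc} (h : IsTop i v' r0) (hd : d.Rel v v')
    (hs : Proves s v P) : Proves (geAll r0.s d 0 r0.pre (geAll r0.s d 1 r0.post s)) v P := by
  obtain ⟨h1, h2, h3⟩ := rows_small h.1
  refine proves_geAll h1 h2 hd (fun g hg => ?_) (proves_geAll h1 h3 hd (fun g hg => ?_) hs)
  · simpa using h.2.1 g hg
  · have := h.2.2 g hg
    push_cast
    omega

theorem proves_argmaxP {i : Fin 3} {r0 : Row} {k : ℕ → Lin → Proc} (h : IsTop i v' r0)
    (hd : d.Rel v v') (hk : Proves (k r0.j r0.s) v P) : Proves (argmaxP d k (rows i)) v P := by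
  have hm := h.1
  generalize rows i = rs at hm
  induction rs with
  | nil => cases hm
  | cons r1 rs ih =>
    rcases List.mem_cons.mp hm with rfl | hm
    · exact proves_both_left (proves_top h hd hk)
    · exact proves_both_right (ih hm)

/-- If the last maximum moves from `r0` at `v` to another form `r1` at `v'`, then `r0` is at least
`r1` at `v` and `r1` is at least `r0` at `v'`. Ties are broken by the order of the forms, so one of
the two inequalities is strict. The offset therefore favours `r1` by at least one, which is a
comparison of constants, and forms failing it may be skipped. -/
theorem proves_argmaxQ {i : Fin 3} {r0 r1 : Row} {k : ℕ → Lin → Proc} (h0 : IsTop i v r0)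
    (h1 : IsTop i v' r1) (hd : d.Rel v v') (hk : Proves (k r1.j r1.s) v P) :
    Proves (argmaxQ d r0.j r0.s k (rows i)) v P := by
  have hm := h1.1
  generalize rows i = rs at hm
  induction rs with
  | nil => cases hm
  | cons r2 rs ih =>
    rcases List.mem_cons.mp hm with rfl | hm
    · refine proves_both_left ?_
      obtain ⟨s1, s2, s3⟩ := rows_small h1.1
      have hbif {c : Bool} {x y : Proc} (h : c = true → Proves x v P) (h' : c = false → Proves y v P) :
          Proves (branch c x y) v P := by
        cases c
        · exact h' rfl
        · exact h rfl
      refine hbif (fun _ => ?_) fun hb => ?_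
      · refine proves_geAll' s1 s2 hd (fun g hg => ?_) (proves_geAll' s1 s3 hd (fun g hg => ?_) hk)
        · simpa using h1.2.1 g hg
        · have := h1.2.2 g hg
          push_cast
          omega
      · have hb : ¬ r1.j = r0.j := fun h => by rw [h, show Nat.beq r0.j r0.j = true from Nat.beq_refl _] at hb; cases hb
        have hd1 := r1.s.val_rel hd
        have hd0 := r0.s.val_rel hd
        -- First part: the inequality at `v'`, strict if `r1` precedes `r0`. Second part: the sum of
        -- the inequalities at `v` and `v'`, which is strict in either order.
        have key : r0.s.val v' + ((Bool.rec 0 1 (Nat.blt r1.j r0.j) : ℕ) : ℤ) ≤ r1.s.val v' ∧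
            r0.s.val v' + r1.s.val v + 1 ≤ r1.s.val v' + r0.s.val v := by
          rcases rows_before h1.1 h0.1 with h | ⟨h, h', h''⟩ | ⟨h, h', h''⟩
          · exact absurd h hb
          · have e1 := h0.2.1 _ h'
            have e2 := h1.2.2 _ h''
            rw [show Nat.blt r1.j r0.j = true from Nat.blt_eq.mpr h]
            constructor <;> push_cast <;> omega
          · have e1 := h1.2.1 _ h'
            have e2 := h0.2.2 _ h''
            rw [show Nat.blt r1.j r0.j = false from
              Bool.eq_false_iff.mpr fun h' => absurd (Nat.blt_eq.mp h') (by omega)]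
            constructor <;> push_cast <;> omega
        have hc : constGe r1.s r0.s d 1 = true := by
          refine Nat.ble_eq_true_of_le ?_
          simp only [Nat.add_eq]
          omega
        refine hbif (fun _ => ?_) fun h => absurd (hc.symm.trans h) (by simp)
        exact proves_geP s1 (rows_small h0.1).1 hd key.1 (proves_top h1 hd hk)
    · exact proves_both_right (ih hm)

/-- The offset describes the outcome of an action. -/
def OptRel (v : Letter → ℕ) : Option Off → Option (Letter → ℕ) → Prop
  | none, none => True
  | some d, some u => d.Rel v u
  | _, _ => False

theorem proves_needs {m : List Letter} (hd : d.Rel v v') (hr : (∀ a ∈ m, 1 ≤ v' a) → Proves r v P)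
    (hs : (∃ a ∈ m, v' a < 1) → Proves s v P) : Proves (needs d r s m) v P := by
  induction m with
  | nil => exact hr (by simp)
  | cons a m ih =>
    refine proves_askPos hd (fun h => ih (fun h' => hr ?_) fun h' => hs ?_) fun h => hs ⟨a, by simp, h⟩
    · simpa [h] using h'
    · obtain ⟨b, hb, h'⟩ := h'
      exact ⟨b, by simp [hb], h'⟩

theorem proves_act {k : Option Off → Proc} {o : Option (Letter → ℕ)} (t : Act) (hd : d.Rel v v')
    (ht : t.Res v' o) (hk : ∀ w, OptRel v w o → Proves (k w) v P) : Proves (t.prog d k) v P := by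
  induction t with
  | move p m =>
    cases o with
    | none =>
      refine proves_needs hd (fun h => ?_) fun _ => hk none trivial
      obtain ⟨a, ha, h'⟩ := ht
      have := h a ha
      omega
    | some u =>
      refine proves_needs hd (fun _ => hk (some _) (hd.shift ht.2)) fun h => ?_
      obtain ⟨a, ha, h'⟩ := h
      have := ht.1 a ha
      omega
  | split y n hy hn =>
    refine proves_askPos hd (fun h => hy ?_) (fun h => hn ?_)
    · simpa [Act.Res, h] using ht
    · simpa [Act.Res, Nat.not_le.mpr h] using ht

theorem sameOff_eq {d d' : Off} (h : sameOff d d' = true) (x : Letter) :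
    d.p.get x + d'.n.get x = d'.p.get x + d.n.get x := by
  have same {a b c e : ℕ} {r : Bool} (h : same1 a b c e r = true) : a + e = b + c ∧ r = true := by
    obtain ⟨h1, h2⟩ := bool_rec_and h
    exact ⟨Nat.eq_of_beq_eq_true h1, h2⟩
  obtain ⟨h1, h⟩ := same h
  obtain ⟨h2, h⟩ := same h
  obtain ⟨h3, h⟩ := same h
  obtain ⟨h4, h⟩ := same h
  obtain ⟨h5, h⟩ := same h
  obtain ⟨h6, h⟩ := same h
  obtain ⟨h7, h⟩ := same h
  obtain ⟨h8, h⟩ := same h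
  cases x <;> assumption

theorem sameOff_rel {d d' : Off} (h : sameOff d d' = true) (hd : d.Rel v v') (hd' : d'.Rel v v'') :
    v' = v'' := by
  funext x
  have a1 := hd x
  have a2 := hd' x
  have := sameOff_eq h x
  omega
end

/-! ### Rows as words, and their passage through a column of height two -/

/-- `a` may stand immediately to the left of `b` in a row. -/
def Up (a b : Letter) : Prop := [b, a] ∈ B11

instance : DecidableRel Up := fun a b => inferInstanceAs (Decidable ([b, a] ∈ B11))

instance : Fintype Letter := ⟨{n1, n2, n3, n0, m3, m2, m1, phi}, fun x => by cases x <;> decide⟩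

theorem Up.trans : ∀ {a b c : Letter}, Up a b → Up b c → Up a c := by decide +kernel

instance : IsTrans Letter Up := ⟨fun _ _ _ => Up.trans⟩

theorem Up.left_ne : ∀ {a b : Letter}, Up a b → a ≠ phi := by decide +kernel

theorem Up.right_ne : ∀ {a b : Letter}, Up a b → b ≠ phi := by decide +kernel

theorem Up.not_B12 : ∀ {a b : Letter}, Up a b → [b, a] ∉ B12 := by decide +kernel

/-- The columns of height one with the letters of `w`. -/
def singles (w : List Letter) : Tableau := w.map fun a => [a]

/-- The words that are rows without the letter `ϕ`. -/
def IsWord (w : List Letter) : Prop := w.IsChain Up ∧ phi ∉ w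

/-- The letter `x` passes through the column `α` over `β`. -/
def step (x α β : Letter) : Option (Letter × Letter × Letter) :=
  match ηInv [x, α, β] with
  | some [a, b, c] => some (a, b, c)
  | _ => none

/-- The letters of `w` pass, from the first to the last, through the column `α` over `β`. -/
def pass : Letter → Letter → List Letter → Option (List Letter × Letter × Letter)
  | α, β, [] => some ([], α, β)
  | α, β, x :: w => (step x α β).bind fun r => (pass r.1 r.2.1 w).map fun q => (r.2.2 :: q.1, q.2)

/-- `Up` is the relation `B(11)` under which a column takes the new letter and hands its own to the
next column, so the whole row is shifted to the right. -/
theorem columnInsert_up {β : Letter} {w : List Letter} (h : (β :: w).IsChain Up) :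
    columnInsert β (singles w) = some (singles (β :: w)) := by
  induction w generalizing β with
  | nil => rfl
  | cons α w ih =>
    rw [List.isChain_cons_cons] at h
    change columnInsert β ([α] :: singles w) = _
    rw [columnInsert, if_neg h.1.not_B12, if_pos (show [α, β] ∈ B11 from h.1), ih h.2]
    rfl

/-- The shift of `columnInsert_up` is undone: every letter moves one column to the left, and the one
that leaves is the first letter of the row, not the one that was lifted. -/
theorem reverseInsert_singles {w : List Letter} {x h : Letter} {t : List Letter}
    (hw : (h :: t).IsChain Up) (e : w ++ [x] = h :: t) :
    reverseInsert x (singles w) = some (h, singles t) := by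
  induction w generalizing h t with
  | nil =>
    obtain ⟨rfl, rfl⟩ := List.cons.inj e
    rfl
  | cons c w ih =>
    obtain ⟨rfl, e'⟩ := List.cons.inj e
    clear e
    have e : w ++ [x] = t := e'
    cases t with
    | nil => simp at e
    | cons h' t =>
      rw [List.isChain_cons_cons] at hw
      change (reverseInsert x (singles w)).bind _ = _
      rw [ih hw.2 e]
      change (reverseColumn [c] h').map _ = _
      rw [reverseColumn, if_pos (show [h', c] ∈ B11 from hw.1)]
      rfl

theorem getLast?_singles (w : List Letter) (x : Letter) :
    (singles (w ++ [x])).getLast? = some [x] := by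
  simp [singles]

theorem dropLast_singles (w : List Letter) (x : Letter) :
    (singles (w ++ [x])).dropLast = singles w := by
  simp [singles]

theorem bumpStep_singles {h : Letter} {t : List Letter} (hw : (h :: t).IsChain Up) :
    bumpStep (singles (h :: t)) = some (h, singles t) := by
  obtain ⟨w, x, e⟩ : ∃ w x, h :: t = w ++ [x] :=
    ⟨_, _, (List.dropLast_append_getLast (List.cons_ne_nil h t)).symm⟩
  have : bumpStep (singles (h :: t)) = match (singles (h :: t)).getLast? with
    | some [x] => reverseInsert x (singles (h :: t)).dropLast
    | _ => none := by
    unfold bumpStep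
    split
    · rename_i heq
      simp [singles] at heq
    · rfl
  rw [this]
  simp only [e, getLast?_singles, dropLast_singles]
  exact reverseInsert_singles hw e.symm

theorem bumpOut_singles {w : List Letter} (hw : w.IsChain Up) :
    bumpOut w.length (singles w) = some w := by
  induction w with
  | nil => rfl
  | cons h t ih =>
    change (bumpStep (singles (h :: t))).bind _ = _
    rw [bumpStep_singles hw]
    change (bumpOut t.length (singles t)).map _ = _
    rw [ih hw.tail]
    rfl

theorem reverseColumn_pair (α β x : Letter) :
    reverseColumn [α, β] x = (step x α β).map fun r => ([r.1, r.2.1], r.2.2) := by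
  simp only [reverseColumn, step]
  rcases ηInv [x, α, β] with _ | w
  · rfl
  · rcases w with _ | ⟨a, _ | ⟨b, _ | ⟨c, _ | ⟨d, w⟩⟩⟩⟩ <;> rfl

theorem step_any : ∀ x α β, [α, β] ∈ B12 → Up α x → (step x α β).any (fun r =>
    decide ([r.1, r.2.1] ∈ B12 ∧ Up r.2.2 r.2.1 ∧ ∀ y, Up x y → Up r.1 y ∧
      (step y r.1 r.2.1).all (fun q => decide (Up r.2.2 q.2.2)) = true)) = true := by
  decide +kernel

/-- The kernel inspects all triples of letters. The final clause looks one letter ahead: two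
successive letters leaving the column may stand next to each other in a row. This makes the outgoing
letters a row without following the whole process. -/
theorem step_spec (x α β : Letter) (h : [α, β] ∈ B12) (hx : Up α x) : ∃ r, step x α β = some r ∧
    [r.1, r.2.1] ∈ B12 ∧ Up r.2.2 r.2.1 ∧ ∀ y, Up x y → Up r.1 y ∧
      ∀ q, step y r.1 r.2.1 = some q → Up r.2.2 q.2.2 := by
  have := step_any x α β h hx
  simp only [Option.any_eq_true, Option.all_eq_true, decide_eq_true_eq] at this
  exact this

theorem ne_of_B12 : ∀ {α β : Letter}, [α, β] ∈ B12 → β ≠ phi := by decide +kernel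

/-- Rows can pass through a column, and the outgoing letters form a row. -/
theorem exists_pass {α β : Letter} {w : List Letter} (h : [α, β] ∈ B12) (hw : (α :: w).IsChain Up) :
    ∃ o α' β', pass α β w = some (o, α', β') ∧ [α', β'] ∈ B12 ∧ (o ++ [β']).IsChain Up ∧
      o.length = w.length := by
  induction w generalizing α β with
  | nil => exact ⟨[], α, β, rfl, h, by simp, rfl⟩
  | cons x w ih =>
    rw [List.isChain_cons_cons] at hw
    obtain ⟨r, hr, h1, h2, h3⟩ := step_spec x α β h hw.1
    have hw' : (r.1 :: w).IsChain Up := by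
      cases w with
      | nil => simp
      | cons y w =>
        rw [List.isChain_cons_cons] at hw ⊢
        exact ⟨(h3 y hw.2.1).1, hw.2.2⟩
    obtain ⟨o, α', β', e, h4, h5, h6⟩ := ih h1 hw'
    refine ⟨r.2.2 :: o, α', β', by simp [pass, hr, e], h4, ?_, by simp [h6]⟩
    cases w with
    | nil =>
      obtain ⟨rfl, rfl, rfl⟩ : o = [] ∧ α' = r.1 ∧ β' = r.2.1 := by simpa [pass, eq_comm] using e
      simpa using h2
    | cons y w =>
      rw [List.isChain_cons_cons] at hw
      -- The letter `q.2.2` leaves next, when `y` enters the new column; the clause with look-ahead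
      -- compares it with `r.2.2`.
      obtain ⟨q, hq, -⟩ := step_spec y r.1 r.2.1 h1 (h3 y hw.2.1).1
      obtain ⟨o', rfl⟩ : ∃ o', o = q.2.2 :: o' := by
        simp only [pass, hq, Option.bind_some, Option.map_eq_some_iff] at e
        obtain ⟨p, -, e⟩ := e
        exact ⟨p.1, (congrArg Prod.fst e).symm⟩
      rw [List.cons_append, List.cons_append, List.isChain_cons_cons]
      exact ⟨(h3 y hw.2.1).2 q hq, h5⟩

theorem isWord_append_of_B12 {α β : Letter} {o : List Letter} (h : [α, β] ∈ B12)
    (ho : (o ++ [β]).IsChain Up) : IsWord (o ++ [β]) := by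
  refine ⟨ho, fun hp => ?_⟩
  rw [List.isChain_iff_pairwise] at ho
  rcases List.mem_append.mp hp with hp | hp
  · exact (List.pairwise_append.mp ho |>.2.2 _ hp β (by simp)).left_ne rfl
  · exact ne_of_B12 h (List.mem_singleton.mp hp).symm

/-- The rightmost letter pushes the single columns to the left, so what enters the column of height
two is the first letter `h` of the row. For this reason `pass` reads its word from the first letter
to the last. -/
theorem bumpStep_column {α β h : Letter} {t : List Letter} (hw : (h :: t).IsChain Up)
    {r : Letter × Letter × Letter} (hr : step h α β = some r) :
    bumpStep ([α, β] :: singles (h :: t)) = some (r.2.2, [r.1, r.2.1] :: singles t) := by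
  obtain ⟨w, x, e⟩ : ∃ w x, h :: t = w ++ [x] :=
    ⟨_, _, (List.dropLast_append_getLast (List.cons_ne_nil h t)).symm⟩
  change (match ([α, β] :: singles (h :: t)).getLast? with
    | some [x] => reverseInsert x ([α, β] :: singles (h :: t)).dropLast
    | _ => none) = _
  have e1 : [α, β] :: singles (h :: t) = ([α, β] :: singles w) ++ [[x]] := by simp [e, singles]
  rw [e1, List.getLast?_concat, List.dropLast_concat]
  change (reverseInsert x (singles w)).bind _ = _
  rw [reverseInsert_singles hw e.symm]
  change (reverseColumn [α, β] h).map _ = _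
  rw [reverseColumn_pair, hr]
  rfl

theorem bumpOut_column {α β α' β' : Letter} {w o : List Letter} (h : [α, β] ∈ B12)
    (hw : (α :: w).IsChain Up) (hp : pass α β w = some (o, α', β')) :
    bumpOut (w.length + 2) ([α, β] :: singles w) = some (o ++ [β', α']) := by
  induction w generalizing α β o with
  | nil =>
    obtain ⟨rfl, rfl, rfl⟩ : [] = o ∧ α = α' ∧ β = β' := by simpa [pass] using hp
    simp only [bumpOut, bumpStep, singles, List.map_nil, if_pos h]
    rfl
  | cons x w ih =>
    rw [List.isChain_cons_cons] at hw
    obtain ⟨r, hr, h1, h2, h3⟩ := step_spec x α β h hw.1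
    simp only [pass, hr, Option.bind_some, Option.map_eq_some_iff] at hp
    obtain ⟨⟨o', q⟩, hp, e⟩ := hp
    obtain ⟨rfl, rfl⟩ := Prod.mk.inj e
    have hw' : (r.1 :: w).IsChain Up := by
      cases w with
      | nil => simp
      | cons y w =>
        rw [List.isChain_cons_cons] at hw ⊢
        exact ⟨(h3 y hw.2.1).1, hw.2.2⟩
    change (bumpStep ([α, β] :: singles (x :: w))).bind _ = _
    rw [bumpStep_column hw.2 hr]
    change (bumpOut (w.length + 2) _).map _ = _
    rw [ih h1 hw' hp]
    rfl

/-! ### The algorithm as a list of rules -/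

/-- The row of an element of `B_l` whose letters other than `ϕ` form the word `w`. -/
def tab (w : List Letter) : List Letter := if w = [] then [phi] else w

/-- The output of the algorithm for `b₁ = w` with `k = l - |w|` and `b₂ = β`:
`b₂' = α`, `b₁' = w'` and the value of `H`. -/
inductive Rule : ℕ → List Letter → Letter → Letter → List Letter → ℤ → Prop
  | bump_two {k w β} : β ≠ phi → (β :: w).IsChain Up → Rule (k + 2) w β n1 (β :: w ++ [m1]) (-2)
  | bump_one {w β} : β ≠ phi → (β :: w).IsChain Up → Rule 1 w β phi (β :: w) (-1)
  | bump_zero {w β w' x} : w ≠ [] → (β :: w).IsChain Up → β :: w = w' ++ [x] → Rule 0 w β x w' 0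
  | phi_zero {w' x} : Rule 0 (w' ++ [x]) phi x w' (-1)
  | phi_succ {k w} : Rule (k + 1) w phi phi w (-2)
  | column_zero {a w β o α β'} : [a, β] ∈ B12 → pass a β w = some (o, α, β') →
      Rule 0 (a :: w) β α (o ++ [β']) (-1)
  | column_succ {k a w β o α β' t t'} : [a, β] ∈ B12 → pass a β w = some (o, α, β') →
      ξInv α = some [t, t'] → Rule (k + 1) (a :: w) β t (o ++ [β', t']) (-2)
  | cancel_one {k} : Rule k [n1] m1 n1 [m1] (-2)
  | cancel {k w' x} : Rule k (n1 :: (w' ++ [x])) m1 x w' (-2)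
  | special {k a β g w w' x t t'} : ξ [a, β] = some g → (g :: w).IsChain Up → g :: w = w' ++ [x] →
      ξInv x = some [t, t'] → Rule k (a :: w) β t (w' ++ [t']) (-2)
  | second {k a β g a' w o α β'} : ξ [a, β] = some g → [a', g] ∈ B12 →
      pass a' g w = some (o, α, β') → Rule k (a :: a' :: w) β α (o ++ [β']) (-2)

theorem B11_ξ : ∀ α β, [α, β] ∈ B11 → α ≠ phi ∧ β ≠ phi ∧ ξ [α, β] = none := by decide +kernel

theorem B12_ξ : ∀ α β, [α, β] ∈ B12 → α ≠ phi ∧ β ≠ phi ∧ [α, β] ∉ B11 ∧ ξ [α, β] = none := by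
  decide +kernel

/-- By the last clause, the contracted letter either pushes the next column on or comes to stand
below its letter. A second contraction never occurs. -/
theorem ξ_B10 : ∀ α β g, ξ [α, β] = some g → [α, β] ∈ B10 ∧ α ≠ phi ∧ β ≠ phi ∧ g ≠ phi ∧
    [α, β] ∉ B11 ∧ [α, β] ∉ B12 ∧ ∀ a', Up α a' → Up g a' ∨ [a', g] ∈ B12 := by decide +kernel

theorem pair_cases : ∀ α β, α ≠ phi → β ≠ phi → [α, β] ∈ B11 ∨ [α, β] ∈ B12 ∨
    (∃ g, ξ [α, β] = some g) ∨ α = n1 ∧ β = m1 := by decide +kernel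

/-- Needed for output II: the second letter split off from the upper letter of the final column may
follow the lower letter in a row. -/
theorem ξInv_B12 : ∀ α β, [α, β] ∈ B12 → ∃ t t', ξInv α = some [t, t'] ∧ Up β t' ∧ t ≠ phi := by
  decide +kernel

theorem ξInv_up : ∀ x, x ≠ phi → ∃ t t', ξInv x = some [t, t'] ∧ t ≠ phi ∧ t' ≠ phi ∧
    ∀ y, Up y x → Up y t' := by decide +kernel

theorem up_m1 : ∀ x, x ≠ phi → Up x m1 := by decide +kernel

theorem phi_ξ : ∀ β, ξ [phi, β] = none := by decide +kernel

theorem insert_phi : ∀ α, [α, phi] ∉ B12 ∧ [α, phi] ∉ B11 ∧ ξ [α, phi] = none := by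
  decide +kernel

theorem B10_ξ : ∀ α β, ξ [α, β] = none → [α, β] ∉ B10 := by decide +kernel

theorem not_special_of_ξ {A : List Letter} {α β : Letter} 
    (h' : ξ [α, β] = none) :
    ¬ Special (α :: A) β := by
  cases A with
  | nil => exact B10_ξ α β h'
  | cons a A =>
    rintro ⟨g, hg, -⟩
    rw [h'] at hg
    cases hg

theorem columnInsert_column {α β : Letter} (h : [α, β] ∈ B12) (T : Tableau) :
    columnInsert β ([α] :: T) = some ([α, β] :: T) := by
  rw [columnInsert, if_pos h]

theorem columnInsert_ξ {α β g : Letter} (h : ξ [α, β] = some g) (T : Tableau) :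
    columnInsert β ([α] :: T) = columnInsert g T := by
  obtain ⟨-, -, -, -, h1, h2, -⟩ := ξ_B10 α β g h
  rw [columnInsert, if_neg h2, if_neg h1, h]

theorem size_singles (w : List Letter) : size (singles w) = w.length := by
  induction w with
  | nil => rfl
  | cons a w ih =>
    simp only [size, singles, List.map_cons, List.sum_cons] at ih ⊢
    rw [ih]
    simp [add_comm]

theorem size_column (α β : Letter) (w : List Letter) :
    size ([α, β] :: singles w) = w.length + 2 := by
  have := size_singles w
  simp only [size, List.map_cons, List.sum_cons] at this ⊢
  rw [this]
  simp [add_comm]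

theorem length_singles (w : List Letter) : (singles w).length = w.length := by simp [singles]

theorem isWord_of_append {w w' : List Letter} (h : IsWord (w ++ w')) : IsWord w :=
  ⟨h.1.left_of_append, fun hp => h.2 (List.mem_append_left _ hp)⟩

theorem algorithm_of_steps {l : ℕ} {A : List Letter} {β α : Letter} {T : Tableau} {t w' : List Letter}
    {H : ℤ} (h1 : columnInsert β (singles A) = some T) (h2 : bumpOut (size T) T = some t)
    (h3 : output (outputCase l A β) t = some ([α], tab w')) (h4 : energy l A β T = H) :
    algorithm l A [β] = (ofRow 1 [α]).bind fun a => (ofRow l (tab w')).map fun c => (H, a, c) := by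
  change (columnInsert β (singles A)).bind _ = _
  rw [h1, Option.bind_some, h2, Option.bind_some, h3, Option.bind_some, h4]

/-- The algorithm follows the rules and its output is a row for `B_l`. -/
def Follows (l k : ℕ) (w : List Letter) (β : Letter) : Prop :=
  ∃ α w' H, Rule k w β α w' H ∧ IsWord w' ∧ w'.length ≤ l ∧ algorithm l (tab w) [β] =
    (ofRow 1 [α]).bind fun a => (ofRow l (tab w')).map fun c => (H, a, c)

/-- The letter `β` fits in front of the row (or replaces `ϕ`), and reverse bumping returns the
letters of `β :: w` in order. The number `k` of free places decides between the outputs I, V and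
III. -/
theorem follows_bump {l k : ℕ} {w : List Letter} {β : Letter} (hw : IsWord w)
    (hl : l = w.length + k) (h1 : 1 ≤ l) (hβ : β ≠ phi) (hc : (β :: w).IsChain Up) :
    Follows l k w β := by
  have hbw : IsWord (β :: w) := ⟨hc, by simpa [Ne.symm hβ] using hw.2⟩
  -- the tableau and the letters bumped out
  have hT : columnInsert β (singles (tab w)) = some (singles (β :: w)) := by
    cases w with
    | nil => cases β <;> first | rfl | exact absurd rfl hβ
    | cons a w => exact columnInsert_up hc
  have ht : bumpOut (size (singles (β :: w))) (singles (β :: w)) = some (β :: w) := by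
    rw [size_singles, bumpOut_singles hc]
  have hS : ¬ Special (tab w) β := by
    cases w with
    | nil => exact not_special_of_ξ (phi_ξ β)
    | cons a w =>
      rw [List.isChain_cons_cons] at hc
      obtain ⟨-, -, h⟩ := B11_ξ a β hc.1
      exact not_special_of_ξ h
  have hE : energy l (tab w) β (singles (β :: w)) = max (-2) (-(k : ℤ)) := by
    rw [energy, if_neg hS, length_singles, hl]
    congr 1
    push_cast [List.length_cons]
    ring
  have hO : outputCase l (tab w) β = if w.length + 1 < l then .III else
      if w.length + 1 = l then .V else .I := by
    cases w with
    | nil =>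
      simp only [outputCase, tab, if_pos, ne_eq, not_true, false_and, if_false, hβ, not_false_eq_true, and_self, List.length_nil]
      split_ifs <;> first | rfl | omega
    | cons a w =>
      rw [List.isChain_cons_cons] at hc
      obtain ⟨h, h', -⟩ := B11_ξ a β hc.1
      have : [a, β] ∈ B11 := hc.1
      simp [outputCase, tab, h, h', this]
  rcases k with _ | _ | k
  · obtain ⟨w', x, e⟩ : ∃ w' x, β :: w = w' ++ [x] :=
      ⟨_, _, (List.dropLast_append_getLast (List.cons_ne_nil β w)).symm⟩
    have hne : w ≠ [] := by rintro rfl; simp at hl; omega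
    have hlen : w.length = w'.length := by simpa using congrArg List.length e
    refine ⟨x, w', 0, .bump_zero hne hc e, isWord_of_append (e ▸ hbw), by omega,
      algorithm_of_steps hT ht ?_ (by simpa using hE)⟩
    rw [hO, if_neg (by omega), if_neg (by omega), e]
    have : w' ≠ [] := by
      rintro rfl
      exact hne (List.length_eq_zero_iff.mp hlen)
    simp [output, tab, this]
  · refine ⟨phi, β :: w, -1, .bump_one hβ hc, hbw, by simp; omega,
      algorithm_of_steps hT ht ?_ (by simpa using hE)⟩
    rw [hO, if_neg (by omega), if_pos (by omega)]
    simp [output, tab]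
  · refine ⟨n1, β :: w ++ [m1], -2, .bump_two hβ hc, ⟨?_, by simpa using hbw.2⟩, by simp; omega,
      algorithm_of_steps hT ht ?_ (by rw [hE]; push_cast; omega)⟩
    · refine List.IsChain.append hc (by simp) fun x hx y hy => ?_
      obtain rfl : y = m1 := by simpa using hy.symm
      exact up_m1 x fun h => hbw.2 (h ▸ List.mem_of_getLast? hx)
    · rw [hO, if_pos (by omega)]
      simp [output, tab]

/-- Inserting `ϕ` changes nothing, except that the row `ϕ` is removed; the output depends only on
whether a place is free. -/
theorem follows_phi {l k : ℕ} {w : List Letter} (hw : IsWord w) (hl : l = w.length + k)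
    (h1 : 1 ≤ l) : Follows l k w phi := by
  cases w with
  | nil =>
    obtain ⟨k, rfl⟩ : ∃ k', k = k' + 1 := ⟨k - 1, by simp at hl; omega⟩
    refine ⟨phi, [], -2, .phi_succ, hw, by simp, algorithm_of_steps (T := []) (t := []) rfl rfl rfl ?_⟩
    rw [energy, if_neg (show ¬ Special (tab []) phi from not_special_of_ξ (insert_phi phi).2.2)]
    simp only [List.length_nil, Nat.cast_zero]
    omega
  | cons a w =>
    have ha : a ≠ phi := fun h => hw.2 (by simp [h])
    obtain ⟨e1, e2, e3⟩ := insert_phi a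
    have hT : columnInsert phi (singles (a :: w)) = some (singles (a :: w)) := by
      change columnInsert phi ([a] :: singles w) = _
      rw [columnInsert, if_neg e1, if_neg e2, e3]
      simp only [ha, false_and, if_false, reduceCtorEq, and_false, or_self, if_true]
      rfl
    have ht : bumpOut (size (singles (a :: w))) (singles (a :: w)) = some (a :: w) := by
      rw [size_singles, bumpOut_singles hw.1]
    have hE : energy l (tab (a :: w)) phi (singles (a :: w)) = max (-2) (-(k : ℤ) - 1) := by
      change energy l (a :: w) _ _ = _
      rw [energy, if_neg (not_special_of_ξ e3), length_singles, hl]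
      congr 1
      push_cast
      ring
    have hO : outputCase l (tab (a :: w)) phi = if l = 1 then .IV else
        if w.length + 1 < l then .V else .I := by
      simp [outputCase, tab, ha]
    simp only [List.length_cons] at hl
    rcases k with _ | k
    · obtain ⟨w', x, e⟩ : ∃ w' x, a :: w = w' ++ [x] :=
        ⟨_, _, (List.dropLast_append_getLast (List.cons_ne_nil a w)).symm⟩
      have hlen : w.length = w'.length := by simpa using congrArg List.length e
      have hr : Rule 0 (a :: w) phi x w' (-1) := e ▸ .phi_zero
      refine ⟨x, w', -1, hr, isWord_of_append (e ▸ hw), by omega,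
        algorithm_of_steps hT ht ?_ (by rw [hE]; norm_num)⟩
      rw [hO, if_neg (show ¬ w.length + 1 < l by omega), e]
      -- Outputs IV and I describe the same result: for `l = 1` the remaining word is empty, and the
      -- row of the empty word is `ϕ`.
      split_ifs with h
      · obtain rfl : w' = [] := List.length_eq_zero_iff.mp (by omega)
        rfl
      · have : w' ≠ [] := by
          rintro rfl
          simp at hlen
          simp [hlen] at hl
          omega
        simp [output, tab, this]
    · refine ⟨phi, a :: w, -2, .phi_succ, hw, by simp; omega,
        algorithm_of_steps hT ht ?_ (by rw [hE]; push_cast; omega)⟩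
      rw [hO, if_neg (by omega), if_pos (by omega)]
      simp [output, tab]

/-- The tableau keeps its `n` columns, the first with two boxes. Bumping out ends with the lower and
then the upper letter of the final column; the latter is kept as `b₂'` in case I and split by `ξ⁻¹`
in case II. -/
theorem follows_column {l k : ℕ} {a β : Letter} {w : List Letter} (hw : IsWord (a :: w))
    (hl : l = w.length + 1 + k) (h : [a, β] ∈ B12) : Follows l k (a :: w) β := by
  obtain ⟨ha, hβ, h11, hξ⟩ := B12_ξ a β h
  obtain ⟨o, α, β', hp, h', hc, hlen⟩ := exists_pass h hw.1
  have hT : columnInsert β (singles (a :: w)) = some ([a, β] :: singles w) := columnInsert_column h _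
  have ht : bumpOut (size ([a, β] :: singles w)) ([a, β] :: singles w) = some ((o ++ [β']) ++ [α]) := by
    rw [size_column, bumpOut_column h hw.1 hp]
    simp
  have hE : energy l (tab (a :: w)) β ([a, β] :: singles w) = max (-2) (-(k : ℤ) - 1) := by
    change energy l (a :: w) _ _ = _
    rw [energy, if_neg (not_special_of_ξ hξ), List.length_cons, length_singles, hl]
    congr 1
    push_cast
    ring
  have hO : outputCase l (tab (a :: w)) β = if w.length + 1 < l then .II else .I := by
    simp [outputCase, tab, ha, hβ, h11, h]
  have how := isWord_append_of_B12 h' hc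
  rcases k with _ | k
  · refine ⟨α, o ++ [β'], -1, .column_zero h hp, how, by simp; omega,
      algorithm_of_steps hT ht ?_ (by rw [hE]; norm_num)⟩
    rw [hO, if_neg (by omega)]
    simp [output, tab]
  · obtain ⟨t, t', e, h1, h2⟩ := ξInv_B12 α β' h'
    refine ⟨t, o ++ [β', t'], -2, .column_succ h hp e, ?_, by simp; omega,
      algorithm_of_steps hT ht ?_ (by rw [hE]; push_cast; omega)⟩
    · rw [show o ++ [β', t'] = (o ++ [β']) ++ [t'] by simp]
      refine ⟨List.IsChain.append hc (by simp) fun x hx y hy => ?_, ?_⟩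
      · obtain rfl : y = t' := by simpa using hy.symm
        obtain rfl : x = β' := by simpa using hx.symm
        exact h1
      · simpa [h1.right_ne.symm] using how.2
    · rw [hO, if_pos (by omega)]
      simp [output, tab, e]

/-- At most `l - 1` columns remain, so the maximum defining `H` is `-2`. For a single remaining
letter, output IV is what I would give with the empty row written as `ϕ`. -/
theorem follows_cancel {l k : ℕ} {w : List Letter} (hw : IsWord (n1 :: w))
    (hl : l = w.length + 1 + k) : Follows l k (n1 :: w) m1 := by
  have hT : columnInsert m1 (singles (n1 :: w)) = some (singles w) := rfl
  have ht : bumpOut (size (singles w)) (singles w) = some w := by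
    rw [size_singles, bumpOut_singles (show w.IsChain Up from hw.1.tail)]
  have hE : energy l (tab (n1 :: w)) m1 (singles w) = -2 := by
    change energy l (n1 :: w) _ _ = _
    rw [energy, if_neg (not_special_of_ξ (by decide)), length_singles, hl]
    push_cast
    omega
  have hO : outputCase l (tab (n1 :: w)) m1 = if w.length = 0 then .III else
      if w.length = 1 then .IV else .I := by
    have : [n1, m1] ∉ B11 ∧ [n1, m1] ∉ B12 ∧ [n1, m1] ∉ B10 := by decide
    simp [outputCase, tab, this]
  have hw' : IsWord w := ⟨hw.1.tail, fun h => hw.2 (List.mem_cons_of_mem _ h)⟩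
  rcases List.eq_nil_or_concat' w with rfl | ⟨w', x, rfl⟩
  · refine ⟨n1, [m1], -2, .cancel_one, by constructor <;> simp, by simp at hl ⊢; omega,
      algorithm_of_steps hT ht ?_ hE⟩
    rw [hO]
    rfl
  · refine ⟨x, w', -2, .cancel, isWord_of_append hw', by simp at hl; omega,
      algorithm_of_steps hT ht ?_ hE⟩
    rw [hO, if_neg (by simp)]
    cases w' with
    | nil => rfl
    | cons b w' =>
      rw [if_neg (by simp)]
      simp only [output, List.getLast?_concat, List.dropLast_concat]
      rfl

theorem follows_special {l k : ℕ} {a β g : Letter} {w : List Letter} (hw : IsWord (a :: w))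
    (hl : l = w.length + 1 + k) (h : ξ [a, β] = some g) (hc : (g :: w).IsChain Up) :
    Follows l k (a :: w) β := by
  obtain ⟨h10, ha, hβ, hg, h11, h12, -⟩ := ξ_B10 a β g h
  have hT : columnInsert β (singles (a :: w)) = some (singles (g :: w)) :=
    (columnInsert_ξ h _).trans (columnInsert_up hc)
  have ht : bumpOut (size (singles (g :: w))) (singles (g :: w)) = some (g :: w) := by
    rw [size_singles, bumpOut_singles hc]
  have hS : Special (a :: w) β := by
    cases w with
    | nil => exact h10
    | cons b w => exact ⟨g, h, (List.isChain_cons_cons.mp hc).1⟩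
  have hO : outputCase l (tab (a :: w)) β = .II := by
    simp [outputCase, tab, ha, hβ, h11, h12, h10, hS]
  have hgw : IsWord (g :: w) :=
    ⟨hc, by simpa [hg.symm] using fun h => hw.2 (List.mem_cons_of_mem _ h)⟩
  obtain ⟨w', x, e⟩ : ∃ w' x, g :: w = w' ++ [x] :=
    ⟨_, _, (List.dropLast_append_getLast (List.cons_ne_nil g w)).symm⟩
  have hlen : w.length = w'.length := by simpa using congrArg List.length e
  rw [e] at hgw
  obtain ⟨t, t', e', h1, h2, h3⟩ := ξInv_up x fun hx => hgw.2 (by simp [hx])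
  refine ⟨t, w' ++ [t'], -2, .special h hc e e', ⟨List.IsChain.append (isWord_of_append hgw).1
    (by simp) fun y hy z hz => ?_, by simpa [h2.symm] using (isWord_of_append hgw).2⟩,
    by simp; omega, algorithm_of_steps hT ht ?_ ?_⟩
  · obtain rfl : z = t' := by simpa using hz.symm
    exact h3 y ((List.isChain_append.mp hgw.1).2.2 y hy x (by simp))
  · rw [hO, e]
    simp [output, tab, e']
  -- The tableau has `n` columns here, so without the special clause the value would be `-1` for `k
  -- = 0`.
  · exact if_pos hS

/-- The contraction removes one column and the contracted letter goes below the next letter, so `n -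
1` columns remain and the maximum defining `H` is `-2`. -/
theorem follows_second {l k : ℕ} {a a' β g : Letter} {w : List Letter} (hw : IsWord (a :: a' :: w))
    (hl : l = w.length + 2 + k) (h : ξ [a, β] = some g) (h' : [a', g] ∈ B12) :
    Follows l k (a :: a' :: w) β := by
  obtain ⟨h10, ha, hβ, hg, h11, h12, -⟩ := ξ_B10 a β g h
  obtain ⟨o, α, β', hp, h2, hc, hlen⟩ := exists_pass h' hw.1.tail
  have hT : columnInsert β (singles (a :: a' :: w)) = some ([a', g] :: singles w) :=
    (columnInsert_ξ h _).trans (columnInsert_column h' _)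
  have ht : bumpOut (size ([a', g] :: singles w)) ([a', g] :: singles w) =
      some ((o ++ [β']) ++ [α]) := by
    rw [size_column, bumpOut_column h' hw.1.tail hp]
    simp
  have hS : ¬ Special (a :: a' :: w) β := by
    rintro ⟨g', e, hg'⟩
    obtain rfl : g = g' := Option.some.inj (h.symm.trans e)
    exact (B12_ξ a' g h').2.2.1 hg'
  have hO : outputCase l (tab (a :: a' :: w)) β = .I := by
    simp [outputCase, tab, ha, hβ, h11, h12, h10, hS]
  refine ⟨α, o ++ [β'], -2, .second h h' hp, isWord_append_of_B12 h2 hc, by simp; omega,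
    algorithm_of_steps hT ht ?_ ?_⟩
  · rw [hO]
    simp [output, tab]
  · change energy l (a :: a' :: w) _ _ = _
    rw [energy, if_neg hS, List.length_cons, length_singles, hl]
    push_cast
    omega

/-- For letters other than `ϕ`, the four possibilities of `pair_cases` for the first column
determine the rule, except after a contraction, where `ξ_B10` decides at the second column. -/
theorem follows {l k : ℕ} {w : List Letter} (hw : IsWord w) (hl : l = w.length + k) (h1 : 1 ≤ l)
    (β : Letter) : Follows l k w β := by
  by_cases hβ : β = phi
  · subst hβ
    exact follows_phi hw hl h1
  cases w with
  | nil => exact follows_bump hw hl h1 hβ (by simp)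
  | cons a w =>
    simp only [List.length_cons] at hl
    rcases pair_cases a β (fun h => hw.2 (by simp [h])) hβ with h | h | ⟨g, h⟩ | ⟨rfl, rfl⟩
    · exact follows_bump hw hl h1 hβ (List.isChain_cons_cons.mpr ⟨h, hw.1⟩)
    · exact follows_column hw hl h
    · cases w with
      | nil => exact follows_special hw hl h (by simp)
      | cons a' w =>
        have := List.isChain_cons_cons.mp hw.1
        rcases (ξ_B10 a β g h).2.2.2.2.2.2 a' this.1 with h' | h'
        · exact follows_special hw hl h (List.isChain_cons_cons.mpr ⟨h', this.2⟩)
        · exact follows_second hw hl h h'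
    · exact follows_cancel hw hl

/-! ### Soundness of the comparison of `e i` before and after the algorithm -/

theorem sameWt_shape : ∀ i β, sameWt i β (shape β) = true := by decide +kernel

/-- The two actions lead to outcomes which the decision trees match. -/
def Agrees (i : Fin 3) (H : ℤ) (sl tl : Bool) : Option ((Letter → ℕ) × Letter) →
    Option ((Letter → ℕ) × Letter) → Prop
  | none, z => z = none
  | some (u, β), z => ∀ α u' H', (shape β).Result u α u' H' → z = some (u', α) ∧ H' = eRule i sl tl H

def PairRel (v : Letter → ℕ) : Option (Off × Letter) → Option ((Letter → ℕ) × Letter) → Prop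
  | none, none => True
  | some (d, a), some (u, b) => d.Rel v u ∧ a = b
  | _, _ => False

theorem PairRel.map {v : Letter → ℕ} {w : Option Off} {o : Option (Letter → ℕ)} (h : OptRel v w o)
    (a : Letter) : PairRel v (w.map fun d => (d, a)) (o.map fun u => (u, a)) := by
  cases w <;> cases o
  · trivial
  · exact h.elim
  · exact h.elim
  · exact ⟨h, rfl⟩

theorem pairRel_map {v u : Letter → ℕ} {d : Off} (h : d.Rel v u) (a : Option Letter) :
    PairRel v (a.map fun b => (d, b)) (a.map fun b => (u, b)) := by
  cases a
  · trivial
  · exact ⟨h, rfl⟩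

theorem proves_outcome {v : Letter → ℕ} {i : Fin 3} {H : ℤ} {sl tl : Bool}
    {y z : Option (Off × Letter)} {Y Z : Option ((Letter → ℕ) × Letter)} (hy : PairRel v y Y)
    (hz : PairRel v z Z) : Proves (outcome i H sl y tl z) v (Agrees i H sl tl Y Z) := by
  match y, Y, hy with
  | none, none, _ =>
    refine proves_ret fun h => ?_
    match z, Z, hz with
    | none, none, _ => rfl
  | some (d, β), some (u, _), ⟨hd, rfl⟩ =>
    intro st hst hr α u' H' hres
    dsimp only [outcome] at hr
    refine proves_prog (P := Z = some (u', α) ∧ H' = eRule i sl tl H) _ hd hres (fun d' hd' => ?_)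
      st hst hr
    match z, Z, hz with
    | none, none, _ => exact proves_ret fun h => by cases h
    | some (dz, α'), some (uz, _), ⟨hdz, rfl⟩ =>
      refine proves_ret fun h => ?_
      simp only [Bool.and_eq_true, decide_eq_true_eq] at h
      obtain ⟨⟨rfl, h⟩, h'⟩ := h
      exact ⟨by rw [sameOff_rel h hd' hdz], h'⟩

/-- The program asks for the leaf of the tree, the last maximum at `v`, the factor on which `e i`
acts, the outcome there, and then for the same data at the image `v'`. The hypotheses answer each
question for the given `v`, and the proof goes down the corresponding path. -/
theorem verify_sound {i : Fin 3} {β α : Letter} {v v' : Letter → ℕ} {H : ℤ} {r r' : Row}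
    {o o' : Option (Letter → ℕ)} (h : verify i β st0 = true) (hv : st0.Holds v)
    (ht : (shape β).Result v α v' H) (h0 : IsTop i v r) (h1 : IsTop i v' r')
    (ho : (act i r.j).Res v o) (ho' : (act i r'.j).Res v' o') {sl tl : Bool}
    (hs : sl = true ↔ (ep i β : ℤ) ≤ (getL (phiForms i) r.j).val v)
    (htl : tl = true ↔ (getL (epsForms i) r'.j).val v' ≤ ph i α) :
    Agrees i H sl tl
      (if sl then o.map fun u => (u, β) else (e1 i β).map fun b => (v, b))
      (if tl then (e1 i α).map fun b => (v', b) else o'.map fun u => (u, α)) := by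
  have target {d' : Off} {sl : Bool} {y : Option (Off × Letter)}
      {Y : Option ((Letter → ℕ) × Letter)} (hd : d'.Rel v v') (hy : PairRel v y Y) :
      Proves (target i α d' H r.j r.s sl y) v (Agrees i H sl tl Y
        (if tl then (e1 i α).map fun b => (v', b) else o'.map fun u => (u, α))) := by
    refine proves_argmaxQ h0 h1 hd ?_
    have hf := (forms_small i r' h1.1).2
    have e := (getL (epsForms i) r'.j).val_rel hd
    have e' := (getL (epsForms i) r'.j).val_swap (v := v)
    refine proves_ask ⟨hf.2, hf.1⟩ (fun h => ?_) (fun h => ?_)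
    · simp only [Nat.add_eq] at h
      push_cast at h
      obtain rfl : tl = true := htl.mpr (by omega)
      exact proves_outcome hy (pairRel_map hd _)
    · simp only [Nat.add_eq] at h
      push_cast at h
      obtain rfl : tl = false := Bool.eq_false_iff.mpr fun h' => by have := htl.mp h'; omega
      exact proves_act _ hd ho' fun w hw => proves_outcome hy (PairRel.map hw α)
  refine proves_prog (shape β) (off0_rel v) ht (fun d' hd => ?_) st0 hv h
  refine proves_argmaxP h0 (off0_rel v) ?_
  refine proves_ask (forms_small i r h0.1).1 (fun h => ?_) (fun h => ?_)
  · obtain rfl : sl = true := hs.mpr (by push_cast at h; omega)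
    exact proves_act _ (off0_rel v) ho fun w hw => target hd (PairRel.map hw β)
  · obtain rfl : sl = false := Bool.eq_false_iff.mpr fun h' => by have := hs.mp h'; push_cast at h; omega
    exact target hd (pairRel_map (off0_rel v) _)

/-- Every leaf, reachable or not, preserves the weight. -/
theorem weight_result {i : Fin 3} {β α : Letter} {v v' : Letter → ℕ} {H : ℤ}
    (ht : (shape β).Result v α v' H) :
    (wtForm i).val v + ph i β + ep i α = (wtForm i).val v' + ph i α + ep i β := by
  have h := sameWt_shape i β
  generalize shape β = t at h ht
  induction t with
  | out α p m H =>
    obtain ⟨rfl, rfl, ht⟩ := ht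
    have := (wtForm i).val_rel ((off0_rel v).shift ht)
    have := Nat.eq_of_beq_eq_true h
    omega
  | br a m y n hy hn =>
    simp only [sameWt, Bool.and_eq_true] at h
    simp only [DTree.Result] at ht
    split_ifs at ht
    · exact hy h.1 ht
    · exact hn h.2 ht

theorem weight_conf {l : ℕ} (i : Fin 3) (b : Elt l) :
    (wtForm i).val (conf b) = phiFun l i b.1 - epsFun l i b.1 := by
  obtain ⟨h1, h2, h3, h4, h5, h6, h7, h8⟩ := conf_eq b
  have hk := two_mul_z4 b.2
  have hz (d : Coord) : d.z1 = d.y1 - d.x1 ∧ d.z2 = d.y2 - d.y3 ∧ d.z3 = d.x3 - d.x2 :=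
    ⟨rfl, rfl, rfl⟩
  obtain ⟨p1, p2, p3⟩ := hz b.1
  rw [show (wtForm i).val (conf b) = (getL (phiForms i) 0).val (conf b) -
    (getL (epsForms i) 0).val (conf b) from Lin.val_sub _ _]
  fin_cases i <;>
  · simp only [phiFun, epsFun, getL, phiForms, epsForms, Lin.val, List.getD_cons_zero, Fin.isValue]
    push_cast
    omega

/-! ### The decision trees agree with the rules -/

noncomputable section
def no : Proc := fun _ => false

/-- A word is read off from its multiplicities: its first letter is the first one in the alphabet
`L` that occurs. The continuation also receives the rest of the alphabet, beginning with this
letter, which may occur again. -/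
def firstP (d : Off) (k : Letter → List Letter → Proc) (n : Proc) (L : List Letter) : Proc :=
  List.rec n (fun x L ih => askPos d x 1 (k x (x :: L)) ih) L

def lastP (d : Off) (k : Letter → Proc) (n : Proc) : Proc := firstP d (fun x _ => k x) n B1.reverse

/-- The run of letters `x` has unknown length. Once a step leaves the column unchanged and emits `x`
again, all remaining copies pass without effect, so finitely many questions suffice. Exhausting the
fuel makes the check fail, so its size is irrelevant to soundness. -/
def passRun (d0 : Off) (x : Letter) (k : Letter → Letter → Off → Proc) (fuel : ℕ) :
    ℕ → Letter → Letter → Off → Proc :=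
  Nat.rec (fun _ _ _ _ => no) (fun _ ih m α β d =>
    askPos d0 x (Nat.succ m)
      (Option.rec no (fun r => if r = (α, β, x) then k α β d else
        ih (Nat.succ m) r.1 r.2.1 (d.shift [r.2.2] [x])) (step x α β))
      (k α β d)) fuel

def passRuns (d0 : Off) (k : Letter → Letter → Off → Proc) (L : List Letter) :
    Letter → Letter → Off → Proc :=
  List.rec k (fun x _ ih => passRun d0 x ih 12 0) L

def splitP (x : Letter) (k : Letter → Letter → Proc) : Proc :=
  match ξInv x with
  | some [t, t'] => k t t'
  | _ => no

/-- A symbolic run of `Rule`, which builds up the offset from the given multiplicities to those of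
the output. -/
def algoP (β : Letter) (k : Letter → Off → ℤ → Proc) : Proc :=
  firstP off0 (fun a L =>
    let d := off0.shift [] [a]
    if β = phi then
      askPos off0 phi 1 (k phi off0 (-2)) (lastP off0 (fun x => k x (off0.shift [phi] [x]) (-1)) no)
    else if [a, β] ∈ B11 then
      askPos off0 phi 1
        (askPos off0 phi 2 (k n1 (off0.shift [β, m1] [phi, phi]) (-2))
          (k phi (off0.shift [β] [phi]) (-1)))
        (lastP off0 (fun x => k x (off0.shift [β] [x]) 0) no)
    else if [a, β] ∈ B12 then
      passRuns d (fun α β' d' => askPos off0 phi 1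
        (splitP α fun t t' => k t (d'.shift [β', t'] [phi]) (-2))
        (k α (d'.shift [β'] []) (-1))) L a β d
    else if a = n1 ∧ β = m1 then
      lastP d (fun x => k x (off0.shift [phi, phi] [n1, x]) (-2)) (k n1 (off0.shift [m1] [n1]) (-2))
    else
      match ξ [a, β] with
      | none => no
      | some g =>
        firstP d (fun a' L' =>
          let d' := off0.shift [] [a, a']
          if [a', g] ∈ B11 then
            lastP d (fun x => splitP x fun t t' => k t (off0.shift [g, t'] [a, x]) (-2)) no
          else
            passRuns d' (fun α β' d => k α (d.shift [β', phi] []) (-2)) L' a' g d')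
          (splitP g fun t t' => k t (off0.shift [t'] [a]) (-2)) L)
    (if β = phi then k phi off0 (-2) else
      askPos off0 phi 2 (k n1 (off0.shift [β, m1] [phi, phi]) (-2))
        (k phi (off0.shift [β] [phi]) (-1))) B1

def verifyShape (β : Letter) : Proc := algoP β fun α d H =>
  (shape β).prog off0 fun α' d' H' => ret (decide (α = α') && sameOff d d' && decide (H = H'))
end

/-- The increasing word with the letters of `L`, each `x` taken `v x` times. -/
def runs (v : Letter → ℕ) (L : List Letter) : List Letter := L.flatMap fun x => List.replicate (v x) x

theorem runs_cons (v : Letter → ℕ) (x : Letter) (L : List Letter) :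
    runs v (x :: L) = List.replicate (v x) x ++ runs v L := rfl

theorem runs_congr {v v' : Letter → ℕ} {L : List Letter} (h : ∀ x ∈ L, v x = v' x) :
    runs v L = runs v' L := by
  induction L with
  | nil => rfl
  | cons x L ih =>
    rw [runs_cons, runs_cons, h x (by simp), ih fun y hy => h y (by simp [hy])]

section
variable {v v' : Letter → ℕ} {P : Prop} {d : Off}

/-- After one copy of `a` is removed, the multiplicities describe the rest of the word over the
shortened alphabet as well as over all of `L`, since the letters before `a` do not occur. Passing
through a column uses the first form, reading the last letter the second. -/
theorem proves_first {k : Letter → List Letter → Proc} {n : Proc} {L : List Letter} {a : Letter}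
    {w : List Letter} (hd : d.Rel v v') (hL : L.Nodup) (hw : runs v' L = a :: w)
    (hk : ∀ L', (a :: L').Nodup → (∀ v1 : Letter → ℕ, (∀ x, v1 x + [a].count x = v' x) →
      runs v1 (a :: L') = w ∧ runs v1 L = w) → Proves (k a (a :: L')) v P) : Proves (firstP d k n L) v P := by
  induction L with
  | nil => cases hw
  | cons x L ih =>
    rw [runs_cons] at hw
    refine proves_askPos hd (fun h => ?_) (fun h => ?_)
    · obtain ⟨m, hm⟩ : ∃ m, v' x = m + 1 := ⟨v' x - 1, by omega⟩
      rw [hm, List.replicate_succ, List.cons_append] at hw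
      obtain ⟨rfl, rfl⟩ := List.cons.inj hw
      refine hk L hL fun v1 hv1 => ?_
      refine (and_self _).symm ▸ ?_
      have h1 := hv1 x
      simp only [List.count_singleton_self] at h1
      rw [runs_cons, show v1 x = m by omega]
      congr 1
      refine runs_congr fun y hy => ?_
      have h2 := hv1 y
      have : x ≠ y := fun h => (List.nodup_cons.mp hL).1 (h ▸ hy)
      simpa [List.count_singleton, this] using h2
    · rw [show v' x = 0 by omega] at hw
      refine ih (List.nodup_cons.mp hL).2 hw fun L' hL' h' => hk L' hL' fun v1 hv1 => ?_
      obtain ⟨h1, h2⟩ := h' v1 hv1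
      have := hv1 x
      rw [runs_cons v1 x L, show v1 x = 0 by omega]
      exact ⟨h1, h2⟩

theorem proves_first_nil {k : Letter → List Letter → Proc} {n : Proc} {L : List Letter}
    (hd : d.Rel v v') (hw : runs v' L = []) (hn : Proves n v P) : Proves (firstP d k n L) v P := by
  induction L with
  | nil => exact hn
  | cons x L ih =>
    rw [runs_cons, List.append_eq_nil_iff] at hw
    refine proves_askPos hd (fun h => ?_) (fun _ => ih hw.2)
    have := congrArg List.length hw.1
    simp at this
    omega

theorem proves_last_aux {k : Letter → Proc} {n : Proc} {L : List Letter} {x : Letter}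
    {w : List Letter} (hd : d.Rel v v') (hw : runs v' L.reverse = w ++ [x]) (hk : Proves (k x) v P) :
    Proves (firstP d (fun x _ => k x) n L) v P := by
  induction L with
  | nil => simp [runs] at hw
  | cons y L ih =>
    have e : runs v' (y :: L).reverse = runs v' L.reverse ++ List.replicate (v' y) y := by
      simp [runs]
    rw [e] at hw
    refine proves_askPos hd (fun h => ?_) (fun h => ?_)
    · obtain ⟨m, hm⟩ : ∃ m, v' y = m + 1 := ⟨v' y - 1, by omega⟩
      rw [hm, List.replicate_succ', ← List.append_assoc] at hw
      obtain ⟨-, h⟩ := List.append_inj' hw rfl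
      obtain rfl : y = x := by simpa using h
      exact hk
    · rw [show v' y = 0 by omega, List.replicate_zero, List.append_nil] at hw
      exact ih hw

theorem proves_last {k : Letter → Proc} {n : Proc} {x : Letter} {w : List Letter} (hd : d.Rel v v')
    (hw : runs v' B1 = w ++ [x]) (hk : Proves (k x) v P) : Proves (lastP d k n) v P :=
  proves_last_aux (L := B1.reverse) hd (by rwa [List.reverse_reverse]) hk

theorem pass_fixed {α β x : Letter} (h : step x α β = some (α, β, x)) (m : ℕ) {w : List Letter}
    {o : List Letter} {q : Letter × Letter} (hp : pass α β (List.replicate m x ++ w) = some (o, q)) :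
    ∃ o', pass α β w = some (o', q) ∧ o = List.replicate m x ++ o' := by
  induction m generalizing o with
  | zero => exact ⟨o, hp, rfl⟩
  | succ m ih =>
    simp only [List.replicate_succ, List.cons_append, pass, h, Option.bind_some,
      Option.map_eq_some_iff] at hp
    obtain ⟨⟨o1, q1⟩, hp, e⟩ := hp
    obtain ⟨rfl, rfl⟩ := Prod.mk.inj e
    obtain ⟨o', h1, rfl⟩ := ih hp
    exact ⟨o', h1, rfl⟩

/-- `F` arises from `v` by the offset `d` when the word `w` is then replaced by the word `o`. -/
def Off.Becomes (d : Off) (v F : Letter → ℕ) (w o : List Letter) : Prop :=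
  ∀ y, F y + d.n.get y + w.count y = v y + d.p.get y + o.count y

theorem Off.Becomes.shift {F : Letter → ℕ} {w o : List Letter} {p m : List Letter}
    (h : d.Becomes v F (m ++ w) (p ++ o)) : (d.shift p m).Becomes v F w o := by
  intro y
  have := h y
  simp only [List.count_append, Off.shift, incs_get] at this ⊢
  omega

theorem proves_passRun {d0 : Off} {x : Letter} {k : Letter → Letter → Off → Proc}
    {v0 F : Letter → ℕ} (hd0 : d0.Rel v v0) {w : List Letter} {q : Letter × Letter} (fuel : ℕ)
    {m n : ℕ} {α β : Letter} {o : List Letter} (hm : v0 x = m + n)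
    (hd : d.Becomes v F (List.replicate n x ++ w) o)
    (hp : pass α β (List.replicate n x ++ w) = some (o, q))
    (hk : ∀ a b d' o', d'.Becomes v F w o' → pass a b w = some (o', q) → Proves (k a b d') v P) :
    Proves (passRun d0 x k fuel m α β d) v P := by
  induction fuel generalizing m n α β o d with
  | zero => exact fun st _ h => by cases h
  | succ f ih =>
    refine proves_askPos hd0 (fun h => ?_) (fun h => ?_)
    · obtain ⟨n, rfl⟩ : ∃ n', n = n' + 1 := ⟨n - 1, by omega⟩
      cases hs : step x α β with
      | none => simp [List.replicate_succ, pass, hs] at hp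
      | some r =>
        change Proves (if r = (α, β, x) then k α β d else _) v P
        split_ifs with hr
        · subst hr
          obtain ⟨o', h1, rfl⟩ := pass_fixed hs _ hp
          refine hk α β d o' (fun y => ?_) h1
          have := hd y
          simp only [List.count_append] at this
          omega
        · simp only [List.replicate_succ, List.cons_append, pass, hs, Option.bind_some,
            Option.map_eq_some_iff] at hp hd
          obtain ⟨⟨o1, q1⟩, hp, e⟩ := hp
          obtain ⟨rfl, rfl⟩ := Prod.mk.inj e
          exact ih (by omega) (Off.Becomes.shift (p := [r.2.2]) (m := [x]) hd) hp
    · obtain rfl : n = 0 := by omega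
      exact hk α β d o hd hp

theorem proves_passRuns {d0 : Off} {k : Letter → Letter → Off → Proc} {v0 F : Letter → ℕ}
    (hd0 : d0.Rel v v0) {L : List Letter} {α β α' β' : Letter} {o : List Letter}
    (hd : d.Becomes v F (runs v0 L) o) (hp : pass α β (runs v0 L) = some (o, α', β'))
    (hk : ∀ d' : Off, d'.Rel v F → Proves (k α' β' d') v P) :
    Proves (passRuns d0 k L α β d) v P := by
  induction L generalizing α β d o with
  | nil =>
    obtain ⟨rfl, rfl, rfl⟩ : [] = o ∧ α = α' ∧ β = β' := by simpa [runs, pass] using hp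
    exact hk d fun y => by simpa [runs] using hd y
  | cons x L ih =>
    exact proves_passRun hd0 12 (m := 0) (by simp) hd hp fun a b d' o' h1 h2 => ih h1 h2

theorem proves_split {x t t' : Letter} {k : Letter → Letter → Proc} (h : ξInv x = some [t, t'])
    (hk : Proves (k t t') v P) : Proves (splitP x k) v P := by
  rw [splitP, h]
  exact hk

/-- The multiplicities of the letters in `w`, supplemented by letters `ϕ` up to the length `l`. -/
def mult (l : ℕ) (w : List Letter) (x : Letter) : ℕ :=
  w.count x + (List.replicate (l - w.length) phi).count x

theorem pass_length {α β : Letter} {w o : List Letter} {q : Letter × Letter}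
    (h : pass α β w = some (o, q)) : o.length = w.length := by
  induction w generalizing α β o with
  | nil =>
    obtain ⟨rfl, -⟩ : [] = o ∧ _ := by simpa [pass] using h
    rfl
  | cons x w ih =>
    simp only [pass, Option.bind_eq_some_iff, Option.map_eq_some_iff] at h
    obtain ⟨r, -, ⟨o', q'⟩, hp, e⟩ := h
    obtain ⟨rfl, rfl⟩ := Prod.mk.inj e
    simp [ih hp]

theorem off0_rel_shift {p m : List Letter} (h : ∀ x, v' x + m.count x = v x + p.count x) :
    (off0.shift p m).Rel v v' := (off0_rel v).shift h

theorem off0_becomes {F : Letter → ℕ} {w o p m : List Letter}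
    (h : ∀ y, F y + m.count y + w.count y = v y + p.count y + o.count y) :
    (off0.shift p m).Becomes v F w o := by
  intro y
  have := h y
  have e : ∀ z, off0.p.get z = 0 ∧ off0.n.get z = 0 := by decide +kernel
  simp only [Off.shift, incs_get, (e y).1, (e y).2]
  omega

theorem mult_eq (l : ℕ) (w : List Letter) (x : Letter) :
    mult l w x = w.count x + if x = phi then l - w.length else 0 := by
  simp only [mult, List.count_replicate, beq_iff_eq, eq_comm (a := phi)]

theorem runs_B1_ne_phi (v : Letter → ℕ) : phi ∉ runs v B1 := by
  intro h
  simp only [runs, List.mem_flatMap, List.mem_replicate] at h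
  obtain ⟨x, hx, -, rfl⟩ := h
  revert hx
  decide

theorem proves_head {k' : Letter → List Letter → Proc} {n : Proc} {a : Letter} {w : List Letter}
    {v1 : Letter → ℕ} (e : runs v B1 = a :: w) (hv : ∀ x, v1 x + [a].count x = v x)
    (h : ∀ L, (a :: L).Nodup → runs v1 (a :: L) = w → runs v1 B1 = w → Proves (k' a (a :: L)) v P) :
    Proves (firstP off0 k' n B1) v P :=
  proves_first (off0_rel v) (by decide) e fun L hL hr => h L hL (hr v1 hv).1 (hr v1 hv).2

theorem exists_sub {a : Letter} (h : 1 ≤ v a) : ∃ v1 : Letter → ℕ, ∀ x, v1 x + [a].count x = v x := by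
  refine ⟨fun x => v x - [a].count x, fun x => ?_⟩
  by_cases hx : a = x
  · subst hx
    simp only [List.count_singleton_self]
    omega
  · simp [hx]

/-- Each rule belongs to one path through `algoP`. Along this path the hypotheses answer the
questions, and the final offset is verified by counting letters, with `ϕ` as padding to length `l`.
-/
theorem proves_algo {k : Letter → Off → ℤ → Proc} {l j : ℕ} {w w' : List Letter} {α β : Letter}
    {H : ℤ} (hr : Rule j w β α w' H) (hv : runs v B1 = w) (hm : ∀ x, v x = mult l w x)
    (hl : l = w.length + j) (h1 : 1 ≤ l)
    (hk : ∀ d : Off, d.Rel v (mult l w') → Proves (k α d H) v P) : Proves (algoP β k) v P := by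
  have hp0 : w.count phi = 0 := List.count_eq_zero.mpr (hv ▸ runs_B1_ne_phi v)
  have hphi : v phi = j := by
    rw [hm, mult_eq, hp0, if_pos rfl]
    omega
  have hsub {a : Letter} {w1 : List Letter} (e : w = a :: w1) :
      ∃ v1 : Letter → ℕ, ∀ x, v1 x + [a].count x = v x := by
    refine exists_sub ?_
    rw [hm, mult_eq, e]
    simp
    omega
  cases hr with
  | @bump_two j w β hβ hc =>
    have hk' := hk (off0.shift [β, m1] [phi, phi]) (off0_rel_shift fun x => by
      rw [hm, mult_eq, mult_eq]
      simp only [List.cons_append, List.count_cons, List.count_append, List.count_nil, List.length_cons,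
        List.length_append, List.length_nil, beq_iff_eq, eq_comm (a := phi)]
      split_ifs <;> omega)
    cases w with
    | nil =>
      refine proves_first_nil (off0_rel v) hv ?_
      rw [if_neg hβ]
      exact proves_askPos (off0_rel v) (fun _ => hk') fun h => absurd h (by omega)
    | cons a w =>
      obtain ⟨v1, hv1⟩ := hsub rfl
      refine proves_head hv hv1 fun L hL hw hw1 => ?_
      dsimp only
      rw [if_neg hβ, if_pos (show [a, β] ∈ B11 from (List.isChain_cons_cons.mp hc).1)]
      exact proves_askPos (off0_rel v) (fun _ => proves_askPos (off0_rel v) (fun _ => hk')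
        fun h => absurd h (by omega)) fun h => absurd h (by omega)
  | @bump_one w β hβ hc =>
    have hk' := hk (off0.shift [β] [phi]) (off0_rel_shift fun x => by
      rw [hm, mult_eq, mult_eq]
      simp only [List.count_cons, List.count_nil, List.length_cons, beq_iff_eq, eq_comm (a := phi)]
      split_ifs <;> omega)
    cases w with
    | nil =>
      refine proves_first_nil (off0_rel v) hv ?_
      rw [if_neg hβ]
      exact proves_askPos (off0_rel v) (fun h => absurd h (by omega)) fun _ => hk'
    | cons a w =>
      obtain ⟨v1, hv1⟩ := hsub rfl
      refine proves_head hv hv1 fun L hL hw hw1 => ?_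
      dsimp only
      rw [if_neg hβ, if_pos (show [a, β] ∈ B11 from (List.isChain_cons_cons.mp hc).1)]
      exact proves_askPos (off0_rel v) (fun _ => proves_askPos (off0_rel v)
        (fun h => absurd h (by omega)) fun _ => hk') fun h => absurd h (by omega)
  | @bump_zero w β w' x hw hc e =>
    have hlen := congrArg List.length e
    have hk' := hk (off0.shift [β] [α]) (off0_rel_shift fun y => by
      have := congrArg (List.count y) e
      rw [hm, mult_eq, mult_eq]
      simp only [List.count_cons, List.count_append, List.count_nil, List.length_cons,
        List.length_append, List.length_nil] at this hlen ⊢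
      split_ifs at this ⊢ <;> omega)
    cases w with
    | nil => exact absurd rfl hw
    | cons a w =>
      obtain ⟨w'', rfl⟩ : ∃ w'', w' = β :: w'' := by
        cases w' with
        | nil => simp at e
        | cons b w'' => exact ⟨w'', by rw [(List.cons.inj e).1]⟩
      have e : a :: w = w'' ++ [α] := (List.cons.inj e).2
      obtain ⟨v1, hv1⟩ := hsub rfl
      refine proves_head hv hv1 fun L hL hw hw1 => ?_
      dsimp only
      obtain ⟨h, -⟩ := List.isChain_cons_cons.mp hc
      rw [if_neg h.left_ne, if_pos (show [a, β] ∈ B11 from h)]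
      exact proves_askPos (off0_rel v) (fun h => absurd h (by omega)) fun _ =>
        proves_last (off0_rel v) (hv.trans e) hk'
  | @phi_zero w' x =>
    have hk' := hk (off0.shift [phi] [α]) (off0_rel_shift fun y => by
      rw [hm, mult_eq, mult_eq]
      simp only [List.count_cons, List.count_append, List.count_nil, List.length_append,
        List.length_cons, List.length_nil, beq_iff_eq, eq_comm (a := phi)] at hl ⊢
      split_ifs <;> omega)
    obtain ⟨a, w, e⟩ : ∃ a w, w' ++ [α] = a :: w := by
      cases w' with
      | nil => exact ⟨α, [], rfl⟩
      | cons a w => exact ⟨a, w ++ [α], rfl⟩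
    obtain ⟨v1, hv1⟩ := hsub e
    refine proves_head (hv.trans e) hv1 fun L hL hw hw1 => ?_
    dsimp only
    rw [if_pos rfl]
    exact proves_askPos (off0_rel v) (fun h => absurd h (by omega)) fun _ =>
      proves_last (off0_rel v) hv hk'
  | @phi_succ j w =>
    have hk' := hk off0 fun x => by rw [← hm]; exact off0_rel v x
    cases w with
    | nil =>
      refine proves_first_nil (off0_rel v) hv ?_
      rw [if_pos rfl]
      exact hk'
    | cons a w =>
      obtain ⟨v1, hv1⟩ := hsub rfl
      refine proves_head hv hv1 fun L hL hw hw1 => ?_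
      dsimp only
      rw [if_pos rfl]
      exact proves_askPos (off0_rel v) (fun _ => hk') fun h => absurd h (by omega)
  | @column_zero a w β o α β' h hp =>
    have hlen := pass_length hp
    obtain ⟨v1, hv1⟩ := hsub rfl
    refine proves_head hv hv1 fun L hL hw hw1 => ?_
    obtain ⟨-, hβ, h11, -⟩ := B12_ξ a β h
    dsimp only
    rw [if_neg hβ, if_neg h11, if_pos h]
    rw [← hw] at hp
    -- The first letter has become part of the column, so the passing word and its image are padded
    -- to length `l - 1` only; the last shift puts the missing letter back.
    refine proves_passRuns (F := mult (l - 1) o) (off0_rel_shift (by simpa using hv1))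
      (off0_becomes fun y => ?_) hp fun d' hd' => proves_askPos (off0_rel v)
        (fun h => absurd h (by omega)) fun _ => hk _ (hd'.shift fun y => ?_)
    · rw [hw, hm, mult_eq, mult_eq]
      simp only [List.count_cons, List.count_nil, List.length_cons] at hl ⊢
      split_ifs <;> omega
    · rw [mult_eq, mult_eq]
      simp only [List.count_cons, List.count_append, List.count_nil, List.length_append,
        List.length_cons, List.length_nil] at hl ⊢
      split_ifs <;> omega
  | @column_succ j a w β o α β' t t' h hp ht =>
    have hlen := pass_length hp
    obtain ⟨v1, hv1⟩ := hsub rfl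
    refine proves_head hv hv1 fun L hL hw hw1 => ?_
    obtain ⟨-, hβ, h11, -⟩ := B12_ξ a β h
    dsimp only
    rw [if_neg hβ, if_neg h11, if_pos h]
    rw [← hw] at hp
    refine proves_passRuns (F := mult (l - 1) o) (off0_rel_shift (by simpa using hv1))
      (off0_becomes fun y => ?_) hp fun d' hd' => proves_askPos (off0_rel v)
        (fun _ => proves_split ht (hk _ (hd'.shift fun y => ?_))) fun h => absurd h (by omega)
    · rw [hw, hm, mult_eq, mult_eq]
      simp only [List.count_cons, List.count_nil, List.length_cons] at hl ⊢
      split_ifs <;> omega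
    · rw [mult_eq, mult_eq]
      simp only [List.count_cons, List.count_append, List.count_nil, List.length_append,
        List.length_cons, List.length_nil, beq_iff_eq, eq_comm (a := phi)] at hl ⊢
      split_ifs <;> omega
  | cancel_one =>
    have hk' := hk (off0.shift [m1] [n1]) (off0_rel_shift fun x => by
      rw [hm, mult_eq, mult_eq]
      simp only [List.count_cons, List.count_nil, List.length_cons, List.length_nil]
      split_ifs <;> omega)
    obtain ⟨v1, hv1⟩ := hsub rfl
    refine proves_head hv hv1 fun L hL hw hw1 => ?_
    dsimp only
    rw [if_neg (by decide), if_neg (by decide), if_neg (by decide), if_pos (by decide)]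
    exact proves_first_nil (L := B1.reverse) (off0_rel_shift (by simpa using hv1)) (by
      have e : runs v1 B1.reverse = (runs v1 B1).reverse := by
        simp [runs, List.reverse_flatMap, Function.comp_def]
      rw [e, hw1, List.reverse_nil]) hk'
  | @cancel _ w' _ =>
    have hk' := hk (off0.shift [phi, phi] [n1, α]) (off0_rel_shift fun y => by
      rw [hm, mult_eq, mult_eq]
      simp only [List.count_cons, List.count_append, List.count_nil, List.length_append,
        List.length_cons, List.length_nil, beq_iff_eq, eq_comm (a := phi)] at hl ⊢
      split_ifs <;> omega)
    obtain ⟨v1, hv1⟩ := hsub rfl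
    refine proves_head hv hv1 fun L hL hw hw1 => ?_
    dsimp only
    rw [if_neg (by decide), if_neg (by decide), if_neg (by decide), if_pos (by decide)]
    exact proves_last (off0_rel_shift (by simpa using hv1)) hw1 hk'
  | @special _ a β g w w' x _ t' h hc e ht =>
    have hlen := congrArg List.length e
    have hk' := hk (off0.shift [g, t'] [a, x]) (off0_rel_shift fun y => by
      have := congrArg (List.count y) e
      rw [hm, mult_eq, mult_eq]
      simp only [List.count_cons, List.count_append, List.count_nil, List.length_append,
        List.length_cons, List.length_nil] at this hlen hl ⊢
      split_ifs at this ⊢ <;> omega)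
    obtain ⟨-, -, hβ, -, h11, h12, -⟩ := ξ_B10 a β g h
    have hn : ¬ (a = n1 ∧ β = m1) := by
      rintro ⟨rfl, rfl⟩
      cases h
    obtain ⟨v1, hv1⟩ := hsub rfl
    have hd1 : (off0.shift [] [a]).Rel v v1 := off0_rel_shift (by simpa using hv1)
    refine proves_head hv hv1 fun L hL hw hw1 => ?_
    dsimp only
    rw [if_neg hβ, if_neg h11, if_neg h12, if_neg hn, h]
    dsimp only
    cases w with
    | nil =>
      obtain ⟨rfl, e'⟩ : w' = [] ∧ g = x := by
        cases w' with
        | nil => simpa using e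
        | cons b w' => simp at e
      subst e'
      refine proves_first_nil hd1 hw (proves_split ht (hk _ (off0_rel_shift fun y => ?_)))
      rw [hm, mult_eq, mult_eq]
      simp only [List.count_cons, List.count_append, List.count_nil, List.length_append,
        List.length_cons, List.length_nil] at hl ⊢
      split_ifs <;> omega
    | cons a' w =>
      obtain ⟨w'', rfl⟩ : ∃ w'', w' = g :: w'' := by
        cases w' with
        | nil => simp at e
        | cons b w'' => exact ⟨w'', by rw [(List.cons.inj e).1]⟩
      have e : a' :: w = w'' ++ [x] := (List.cons.inj e).2
      refine proves_first hd1 hL hw fun L' hL' _ => ?_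
      rw [if_pos (show [a', g] ∈ B11 from (List.isChain_cons_cons.mp hc).1)]
      exact proves_last hd1 (hw1.trans e) (proves_split ht hk')
  | @second _ a β g a' w o _ β' h h' hp =>
    have hlen := pass_length hp
    obtain ⟨-, -, hβ, -, h11, h12, -⟩ := ξ_B10 a β g h
    have hn : ¬ (a = n1 ∧ β = m1) := by
      rintro ⟨rfl, rfl⟩
      cases h
    obtain ⟨v1, hv1⟩ := hsub rfl
    have hd1 : (off0.shift [] [a]).Rel v v1 := off0_rel_shift (by simpa using hv1)
    refine proves_head hv hv1 fun L hL hw hw1 => ?_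
    dsimp only
    rw [if_neg hβ, if_neg h11, if_neg h12, if_neg hn, h]
    dsimp only
    refine proves_first hd1 hL hw fun L' hL' hr => ?_
    have hpos : 1 ≤ v1 a' := by
      have h1 := hv1 a'
      rw [hm, mult_eq] at h1
      simp only [List.count_cons, List.count_nil, beq_self_eq_true, if_true] at h1
      split_ifs at h1 <;> omega
    obtain ⟨v2, hv2⟩ := exists_sub hpos
    rw [if_neg (B12_ξ a' g h').2.2.1]
    have hr := (hr v2 hv2).1
    have hv2' (y : Letter) : v2 y + [a, a'].count y = v y := by
      have h1 := hv1 y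
      have h2 := hv2 y
      simp only [List.count_cons, List.count_nil] at h1 h2 ⊢
      omega
    rw [← hr] at hp
    -- Two letters have left the row, one contracted with `β` and one now in the column; the last
    -- shift restores the length with `β'` and an additional `ϕ`.
    refine proves_passRuns (F := mult (l - 2) o) (off0_rel_shift (by simpa using hv2'))
      (off0_becomes fun y => ?_) hp fun d' hd' => hk _ (hd'.shift fun y => ?_)
    · rw [hr, hm, mult_eq, mult_eq]
      simp only [List.count_cons, List.count_nil, List.length_cons] at hl ⊢
      split_ifs <;> omega
    · rw [mult_eq, mult_eq]
      simp only [List.count_cons, List.count_append, List.count_nil, List.length_append,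
        List.length_cons, List.length_nil, beq_iff_eq, eq_comm (a := phi)] at hl ⊢
      split_ifs <;> omega
end

/-- The label of the leaf that `v` reaches. -/
def DTree.leaf : DTree → (Letter → ℕ) → Letter × List Letter × List Letter × ℤ
  | .out α p m H, _ => (α, p, m, H)
  | .br a m y n, v => if m ≤ v a then y.leaf v else n.leaf v

theorem DTree.result_leaf (t : DTree) {v v' : Letter → ℕ}
    (h : ∀ x, v' x + (t.leaf v).2.2.1.count x = v x + (t.leaf v).2.1.count x) :
    t.Result v (t.leaf v).1 v' (t.leaf v).2.2.2 := by
  induction t with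
  | out α p m H => exact ⟨rfl, rfl, h⟩
  | br a m y n hy hn =>
    simp only [DTree.leaf, DTree.Result] at h ⊢
    split_ifs at h ⊢ with hm
    · exact hy h
    · exact hn h

/-- In contrast to `proves_prog`, nothing about the leaf is known in advance; it is the program that
has to compare it. -/
theorem proves_prog_leaf {v v' : Letter → ℕ} {P : Prop} {d : Off} {k : Letter → Off → ℤ → Proc}
    (t : DTree) (hd : d.Rel v v') (hk : Proves (k (t.leaf v').1
      (d.shift (t.leaf v').2.1 (t.leaf v').2.2.1) (t.leaf v').2.2.2) v P) :
    Proves (t.prog d k) v P := by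
  induction t with
  | out α p m H => exact hk
  | br a m y n hy hn =>
    refine proves_askPos hd (fun h => hy ?_) (fun h => hn ?_)
    · simpa [DTree.leaf, h] using hk
    · simpa [DTree.leaf, Nat.not_le.mpr h] using hk

theorem verifyShape_all (β : Letter) : verifyShape β st0 = true := by
  cases β <;> decide +kernel

/-- The symbolic run yields an offset that leads to the output of the rule; the check shows that the
leaf reached by `v` has the same offset, letter and energy. -/
theorem result_of_rule {l j : ℕ} {w w' : List Letter} {α β : Letter} {H : ℤ} {v : Letter → ℕ}
    (hr : Rule j w β α w' H) (hv : runs v B1 = w) (hm : ∀ x, v x = mult l w x)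
    (hl : l = w.length + j) (h1 : 1 ≤ l) (h0 : st0.Holds v) :
    (shape β).Result v α (mult l w') H := by
  refine proves_algo hr hv hm hl h1 (fun d hd => ?_) st0 h0 (verifyShape_all β)
  refine proves_prog_leaf (shape β) (off0_rel v) (proves_ret fun h => ?_)
  simp only [Bool.and_eq_true, decide_eq_true_eq] at h
  obtain ⟨⟨rfl, h⟩, rfl⟩ := h
  refine DTree.result_leaf _ fun x => ?_
  have e := sameOff_eq h x
  have e' := hd x
  have e0 : ∀ z, off0.p.get z = 0 ∧ off0.n.get z = 0 := by decide +kernel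
  simp only [Off.shift, incs_get, (e0 x).1, (e0 x).2] at e
  omega

/-! ### Words, multiplicities and elements of `B_l` -/

theorem row_eq {l : ℕ} (b : Elt l) : row b.1 = tab (runs (conf b) B1) := by
  simp [row, tab, runs, B1, conf]

theorem length_runs {l : ℕ} (b : Elt l) : l = (runs (conf b) B1).length + conf b phi := by
  obtain ⟨h1, h2, h3, h4, h5, h6, h7, h8⟩ := conf_eq b
  have := two_mul_s b.2
  simp only [runs, B1, List.flatMap_cons, List.flatMap_nil, List.length_append, List.length_replicate,
    List.length_nil]
  omega

/-- The letter `0` is the only one of `B1` that may not stand next to itself, whence the hypothesis.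
-/
theorem isWord_runs {v : Letter → ℕ} (h : v n0 ≤ 1) : IsWord (runs v B1) := by
  refine ⟨?_, runs_B1_ne_phi v⟩
  rw [List.isChain_iff_pairwise, runs, List.pairwise_flatMap]
  refine ⟨fun a ha => ?_, ?_⟩
  · by_cases h0 : a = n0
    · subst h0
      rcases Nat.le_one_iff_eq_zero_or_eq_one.mp h with h | h <;> simp [h]
    · have : ∀ a ∈ B1, a ≠ n0 → Up a a := by decide +kernel
      exact List.pairwise_replicate.mpr (Or.inr (this a ha h0))
  · have : B1.Pairwise Up := by decide +kernel
    refine this.imp fun {a b} hab x hx y hy => ?_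
    obtain ⟨-, rfl⟩ := List.mem_replicate.mp hx
    obtain ⟨-, rfl⟩ := List.mem_replicate.mp hy
    exact hab

theorem conf_eq_mult {l : ℕ} (b : Elt l) (x : Letter) : conf b x = mult l (runs (conf b) B1) x := by
  have h := length_runs b
  rw [mult_eq]
  by_cases hx : x = phi
  · subst hx
    rw [List.count_eq_zero.mpr (runs_B1_ne_phi _), if_pos rfl]
    omega
  · rw [if_neg hx]
    simp only [runs, B1, List.flatMap_cons, List.flatMap_nil, List.count_append, List.count_replicate,
      List.count_nil]
    cases x <;> first | exact absurd rfl hx | simp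

theorem st0_holds {l : ℕ} (h : 1 ≤ l) (b : Elt l) : st0.Holds (conf b) := by
  obtain ⟨h1, h2, h3, h4, h5, h6, h7, h8⟩ := conf_eq b
  have hl := length_runs b
  simp only [runs, B1, List.flatMap_cons, List.flatMap_nil, List.length_append, List.length_replicate,
    List.length_nil] at hl
  refine ⟨⟨fun x => ?_, fun x => ?_⟩, fun c hc => ?_⟩
  · have : st0.lo.get x = 0 := by cases x <;> rfl
    omega
  · cases x
    case n0 => left; exact_mod_cast h4
    all_goals right; exact le_rfl
  · obtain rfl := List.mem_singleton.mp hc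
    rw [con_holds (V8.le_of_all (by decide))]
    simp only [Lin.val, v0]
    push_cast
    omega

theorem Up.antisymm : ∀ a b, Up a b → Up b a → a = b := by decide +kernel

theorem IsWord.count_n0 {w : List Letter} (h : IsWord w) : w.count n0 ≤ 1 := by
  by_contra hc
  have hs : List.Sublist (List.replicate 2 n0) w := List.replicate_sublist_iff.mpr (by omega)
  have := (List.isChain_iff_pairwise.mp h.1).sublist hs
  revert this
  decide

/-- Both words are sorted for the antisymmetric relation `Up` and have the same letters. -/
theorem runs_count {w : List Letter} (h : IsWord w) : runs (fun x => w.count x) B1 = w := by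
  have hp : (runs (fun x => w.count x) B1).Perm w := by
    rw [List.perm_iff_count]
    intro x
    by_cases hx : x = phi
    · subst hx
      rw [List.count_eq_zero.mpr (runs_B1_ne_phi _), List.count_eq_zero.mpr h.2]
    · simp only [runs, B1, List.flatMap_cons, List.flatMap_nil, List.count_append,
        List.count_replicate, List.count_nil]
      cases x <;> first | exact absurd rfl hx | simp
  exact hp.eq_of_pairwise (le := Up) (fun a b _ _ => Up.antisymm a b) (List.isChain_iff_pairwise.mp
    (isWord_runs h.count_n0).1) (List.isChain_iff_pairwise.mp h.1)

theorem count_tab {w : List Letter} {x : Letter} (hx : x ≠ phi) : (tab w).count x = w.count x := by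
  unfold tab
  split_ifs with h
  · simp [h, hx.symm]
  · rfl

/-- A word contains `0` at most once, so the number of letters `0` is the common parity of `x₃` and
`x̄₃`, and halving these recovers the multiplicities of `3` and `3̄`. -/
theorem exists_ofRow {l : ℕ} {w : List Letter} (hw : IsWord w) (hl : w.length ≤ l) :
    ∃ c, ofRow l (tab w) = some c ∧ conf c = mult l w := by
  have hr := runs_count hw
  have hlen := congrArg List.length hr
  have h0 := hw.count_n0
  have hp := List.count_eq_zero.mpr hw.2
  simp only [runs, B1, List.flatMap_cons, List.flatMap_nil, List.length_append,
    List.length_replicate, List.length_nil] at hlen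
  let c : Coord := ⟨w.count n1, w.count n2, 2 * w.count n3 + w.count n0,
    2 * w.count m3 + w.count n0, w.count m2, w.count m1⟩
  have h2 : (c.x3 / 2).toNat = w.count n3 := by dsimp only [c]; omega
  have h3 : (c.x3 % 2).toNat = w.count n0 := by dsimp only [c]; omega
  have h4 : (c.y3 / 2).toNat = w.count m3 := by dsimp only [c]; omega
  have hs : c.s = w.length := by
    unfold Coord.s
    dsimp only [c]
    omega
  have hc : c.Mem l := by
    rw [Coord.Mem, hs]
    dsimp only [c]
    omega
  have hrow : row c = tab w := by
    rw [← hr]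
    simp only [row, tab, h2, h3, h4, runs, B1, List.flatMap_cons, List.flatMap_nil, List.append_nil,
      List.append_assoc]
    rfl
  refine ⟨⟨c, hc⟩, ?_, ?_⟩
  · unfold ofRow
    simp only [count_tab (show n1 ≠ phi by decide), count_tab (show n2 ≠ phi by decide),
      count_tab (show n3 ≠ phi by decide), count_tab (show n0 ≠ phi by decide),
      count_tab (show m3 ≠ phi by decide), count_tab (show m2 ≠ phi by decide),
      count_tab (show m1 ≠ phi by decide)]
    rw [if_pos hrow]
    exact dif_pos hc
  · funext x
    rw [mult_eq]
    cases x
    case phi =>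
      change ((l : ℤ) - c.s).toNat = _
      rw [hs, hp, if_pos rfl]
      omega
    case n3 => exact h2
    case n0 => exact h3
    case m3 => exact h4
    all_goals exact Int.toNat_natCast _

theorem conf_injective (l : ℕ) : Function.Injective (conf (l := l)) := by
  intro b c h
  obtain ⟨h1, h2, h3, h4, h5, h6, h7, h8⟩ := conf_eq b
  obtain ⟨g1, g2, g3, g4, g5, g6, g7, g8⟩ := conf_eq c
  rw [h] at h1 h2 h3 h4 h5 h6 h7 h8
  exact Subtype.ext (Coord.ext (by omega) (by omega) (by omega) (by omega) (by omega) (by omega))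

/-- The elements of `B_1`. -/
def letterElt : Letter → Elt 1
  | n1 => ⟨⟨1, 0, 0, 0, 0, 0⟩, by decide⟩
  | n2 => ⟨⟨0, 1, 0, 0, 0, 0⟩, by decide⟩
  | n3 => ⟨⟨0, 0, 2, 0, 0, 0⟩, by decide⟩
  | n0 => ⟨⟨0, 0, 1, 1, 0, 0⟩, by decide⟩
  | m3 => ⟨⟨0, 0, 0, 2, 0, 0⟩, by decide⟩
  | m2 => ⟨⟨0, 0, 0, 0, 1, 0⟩, by decide⟩
  | m1 => ⟨⟨0, 0, 0, 0, 0, 1⟩, by decide⟩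
  | phi => ⟨⟨0, 0, 0, 0, 0, 0⟩, by decide⟩

theorem row_letterElt (β : Letter) : row (letterElt β).1 = [β] := by
  cases β <;> decide +kernel

theorem ofRow_letter (β : Letter) : ofRow 1 [β] = some (letterElt β) := by
  cases β <;> rfl

theorem letterElt_injective : Function.Injective letterElt := fun α β h => by
  have := congrArg (fun b : Elt 1 => row b.1) h
  simpa [row_letterElt] using this

theorem letterElt_surjective (b : Elt 1) : ∃ β, b = letterElt β := by
  have hr := row_eq b
  have hl := length_runs b
  obtain ⟨c, hc, hc'⟩ := exists_ofRow (isWord_runs (v := conf b) (by exact_mod_cast (conf_eq b).2.2.2.1))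
    (show _ ≤ 1 by omega)
  obtain rfl : c = b := conf_injective _ (funext fun x => by rw [hc', ← conf_eq_mult])
  generalize runs (conf c) B1 = w at *
  match w, hl, hc with
  | [], _, hc => exact ⟨phi, Option.some.inj (hc.symm.trans (ofRow_letter phi))⟩
  | [x], _, hc => exact ⟨x, Option.some.inj (hc.symm.trans (ofRow_letter x))⟩
  | _ :: _ :: _, hl, _ => simp only [List.length_cons] at hl; omega

/-- Here `follows`, which shows that every step can be carried out, meets `result_of_rule`; from now
on only the decision trees matter. -/
theorem algorithm_shape {l : ℕ} (hl : 1 ≤ l) (b : Elt l) (β : Letter) :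
    ∃ α c H, (shape β).Result (conf b) α (conf c) H ∧
      algorithm l (row b.1) (row (letterElt β).1) = some (H, letterElt α, c) := by
  obtain ⟨α, w', H, hr, hw, hl', ha⟩ :=
    follows (isWord_runs (by exact_mod_cast (conf_eq b).2.2.2.1)) (length_runs b) hl β
  obtain ⟨c, hc, hc'⟩ := exists_ofRow hw hl'
  refine ⟨α, c, H, ?_, ?_⟩
  · rw [hc']
    exact result_of_rule hr rfl (conf_eq_mult b) (length_runs b) hl (st0_holds hl b)
  · rw [row_eq, row_letterElt, ha, ofRow_letter, hc]
    rfl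

/-! ### The algorithm commutes with `e i` -/

/-- These 24 evaluations contain the whole comparison. They are independent of `l`, which is present
only as the sum of the multiplicities. -/
theorem verify_all (i : Fin 3) (β : Letter) : verify i β st0 = true := by
  fin_cases i <;> cases β <;> decide +kernel

theorem opE_letterElt (i : Fin 3) (β : Letter) :
    opE 1 i (letterElt β) = (e1 i β).map letterElt := by
  fin_cases i <;> cases β <;> rfl

theorem ε_letterElt (i : Fin 3) (β : Letter) : (crystal 1).ε i (letterElt β) = ep i β := by
  have h : ∀ i β, epsFun 1 i (letterElt β).1 = ep i β := by decide +kernel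
  exact_mod_cast (ε_eq_epsFun i (letterElt β)).trans (h i β)

theorem φ_letterElt (i : Fin 3) (β : Letter) : (crystal 1).φ i (letterElt β) = ph i β := by
  have h : ∀ i β, phiFun 1 i (letterElt β).1 = ph i β := by decide +kernel
  exact_mod_cast (φ_eq_phiFun i (letterElt β)).trans (h i β)

/-- `y` and `H` arise from `x` in the way that the decision trees prescribe. -/
def Matches {l : ℕ} (x : Elt l × Elt 1) (y : Elt 1 × Elt l) (H : ℤ) : Prop :=
  ∃ β α, x.2 = letterElt β ∧ y.1 = letterElt α ∧ (shape β).Result (conf x.1) α (conf y.2) H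

theorem tensorE_letter {l : ℕ} (i : Fin 3) (b : Elt l) (β : Letter) :
    ((crystal l).tensor (crystal 1)).e i (b, letterElt β) =
      (if decide (ep i β ≤ (crystal l).φ i b) then (opE l i b).map fun c => (c, β)
        else (e1 i β).map fun γ => (b, γ)).map fun p => (p.1, letterElt p.2) := by
  change (if (crystal 1).ε i (letterElt β) ≤ _ then (opE l i b).map _
    else (opE 1 i (letterElt β)).map _) = _
  rw [ε_letterElt, opE_letterElt]
  by_cases h : ep i β ≤ (crystal l).φ i b
  · simp only [h, if_true, decide_true, Option.map_map]
    rfl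
  · simp only [h, if_false, decide_false, Option.map_map, Bool.false_eq_true]
    rfl

theorem letter_tensorE {l : ℕ} (i : Fin 3) (b : Elt l) (β : Letter) :
    ((crystal 1).tensor (crystal l)).e i (letterElt β, b) =
      (if decide ((crystal l).ε i b ≤ ph i β) then (e1 i β).map fun γ => (b, γ)
        else (opE l i b).map fun c => (c, β)).map fun p => (letterElt p.2, p.1) := by
  change (if _ ≤ (crystal 1).φ i (letterElt β) then (opE 1 i (letterElt β)).map _
    else (opE l i b).map _) = _
  rw [φ_letterElt, opE_letterElt]
  by_cases h : (crystal l).ε i b ≤ ph i β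
  · simp only [h, if_true, decide_true, Option.map_map]
    rfl
  · simp only [h, if_false, decide_false, Option.map_map, Bool.false_eq_true]
    rfl

theorem agrees_of_matches {l : ℕ} (hl : 1 ≤ l) (i : Fin 3) {b c : Elt l} {β α : Letter} {H : ℤ}
    (h : (shape β).Result (conf b) α (conf c) H) :
    Agrees i H (decide (ep i β ≤ (crystal l).φ i b)) (decide ((crystal l).ε i c ≤ ph i α))
      ((if decide (ep i β ≤ (crystal l).φ i b) then (opE l i b).map fun c => (c, β)
        else (e1 i β).map fun γ => (b, γ)).map fun p => (conf p.1, p.2))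
      ((if decide ((crystal l).ε i c ≤ ph i α) then (e1 i α).map fun γ => (c, γ)
        else (opE l i c).map fun c => (c, α)).map fun p => (conf p.1, p.2)) := by
  obtain ⟨r, h0, ho, hφ, -⟩ := exists_describes i b
  obtain ⟨r', h1, ho', -, hε⟩ := exists_describes i c
  have := verify_sound (verify_all i β) (st0_holds hl b) h h0 h1 ho ho'
    (sl := decide (ep i β ≤ (crystal l).φ i b)) (tl := decide ((crystal l).ε i c ≤ ph i α))
    (by rw [← hφ, decide_eq_true_iff]; exact_mod_cast Iff.rfl)
    (by rw [← hε, decide_eq_true_iff]; exact_mod_cast Iff.rfl)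
  simpa only [apply_ite (Option.map _), Option.map_map, Function.comp_def] using this

theorem Matches.e_none {l : ℕ} (hl : 1 ≤ l) {i : Fin 3} {x : Elt l × Elt 1} {y : Elt 1 × Elt l}
    {H : ℤ} (h : Matches x y H) (hx : ((crystal l).tensor (crystal 1)).e i x = none) :
    ((crystal 1).tensor (crystal l)).e i y = none := by
  obtain ⟨b, x⟩ := x
  obtain ⟨y, c⟩ := y
  obtain ⟨β, α, rfl, rfl, h⟩ := h
  have ha := agrees_of_matches hl i (b := b) (c := c) h
  rw [tensorE_letter, Option.map_eq_none_iff] at hx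
  rw [hx] at ha
  rw [letter_tensorE, Option.map_eq_none_iff]
  exact Option.map_eq_none_iff.mp ha

theorem Matches.e_some {l : ℕ} (hl : 1 ≤ l) {i : Fin 3} {x x' : Elt l × Elt 1}
    {y y' : Elt 1 × Elt l} {H H' : ℤ} (h : Matches x y H) (h' : Matches x' y' H')
    (hx : ((crystal l).tensor (crystal 1)).e i x = some x') :
    ((crystal 1).tensor (crystal l)).e i y = some y' ∧
      H' = eRule i (decide ((crystal 1).ε i x.2 ≤ (crystal l).φ i x.1))
        (decide ((crystal l).ε i y.2 ≤ (crystal 1).φ i y.1)) H := by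
  obtain ⟨b, x⟩ := x
  obtain ⟨y, c⟩ := y
  obtain ⟨b', x'⟩ := x'
  obtain ⟨y', c'⟩ := y'
  obtain ⟨β, α, rfl, rfl, h⟩ := h
  obtain ⟨β', α', rfl, rfl, h'⟩ := h'
  have ha := agrees_of_matches hl i (b := b) (c := c) h
  dsimp only at h' ⊢
  rw [tensorE_letter, Option.map_eq_some_iff] at hx
  obtain ⟨⟨b1, β1⟩, hx, e⟩ := hx
  obtain ⟨rfl, e'⟩ := Prod.mk.inj e
  obtain rfl := letterElt_injective e'
  rw [hx] at ha
  obtain ⟨h1, h2⟩ := ha _ _ _ h'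
  rw [letter_tensorE, ε_letterElt, φ_letterElt]
  refine ⟨?_, h2⟩
  obtain ⟨⟨c1, α1⟩, hy, e⟩ := Option.map_eq_some_iff.mp h1
  obtain ⟨e1, rfl⟩ := Prod.mk.inj e
  obtain rfl := conf_injective l e1
  rw [hy]
  rfl

/-! ### Strings and weights in tensor products -/

namespace Crystal
variable {I B B' : Type} (C : Crystal I B) (C' : Crystal I B')

theorem ε_eq_zero {i : I} {b : B} (h : C.e i b = none) : C.ε i b = 0 := stringLength_none h

theorem φ_eq_zero {i : I} {b : B} (h : C.f i b = none) : C.φ i b = 0 := stringLength_none h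

theorem φ_e {i : I} {b c : B} (h : C.e i b = some c) : C.φ i c = C.φ i b + 1 :=
  C.φ_f ((C.inverse i c b).mpr h)

theorem ε_f {i : I} {b c : B} (h : C.f i b = some c) : C.ε i c = C.ε i b + 1 :=
  C.ε_e ((C.inverse i b c).mp h)

theorem exists_f_of_pos {i : I} {b : B} (h : 0 < C.φ i b) : ∃ c, C.f i b = some c := by
  cases hc : C.f i b with
  | none => have := C.φ_eq_zero hc; omega
  | some c => exact ⟨c, rfl⟩

/-- The right-hand side follows the tensor product rule step by step: while `e i` acts on the right
factor the difference `ε i b' - φ i b` decreases; once it is at most zero, `e i` acts on the left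
factor, `φ i b` grows and it stays so. -/
theorem ε_tensor (i : I) (b : B) (b' : B') : ((C.tensor C').ε i (b, b') : ℤ) =
    C.ε i b + max 0 ((C'.ε i b' : ℤ) - C.φ i b) := by
  refine (C.tensor C').ε_eq_of_step i
    (fun x => C.ε i x.1 + max 0 ((C'.ε i x.2 : ℤ) - C.φ i x.1)) ?_ ?_ (b, b')
  · rintro ⟨b, b'⟩ h
    change tensorE C C' i (b, b') = none at h
    unfold tensorE at h
    dsimp only at h ⊢
    split_ifs at h with h1
    · have := C.ε_eq_zero (Option.map_eq_none_iff.mp h)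
      omega
    · have := C'.ε_eq_zero (Option.map_eq_none_iff.mp h)
      omega
  · rintro ⟨b, b'⟩ y h
    change tensorE C C' i (b, b') = some y at h
    unfold tensorE at h
    dsimp only at h ⊢
    split_ifs at h with h1
    · obtain ⟨c, hc, rfl⟩ := Option.map_eq_some_iff.mp h
      have := C.ε_e hc
      have := C.φ_e hc
      dsimp only
      omega
    · obtain ⟨c, hc, rfl⟩ := Option.map_eq_some_iff.mp h
      have := C'.ε_e hc
      dsimp only
      omega

theorem φ_tensor (i : I) (b : B) (b' : B') : ((C.tensor C').φ i (b, b') : ℤ) =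
    C'.φ i b' + max 0 ((C.φ i b : ℤ) - C'.ε i b') := by
  refine (C.tensor C').φ_eq_of_step i
    (fun x => C'.φ i x.2 + max 0 ((C.φ i x.1 : ℤ) - C'.ε i x.2)) ?_ ?_ (b, b')
  · rintro ⟨b, b'⟩ h
    change tensorF C C' i (b, b') = none at h
    unfold tensorF at h
    dsimp only at h ⊢
    split_ifs at h with h1
    · have := C.φ_eq_zero (Option.map_eq_none_iff.mp h)
      omega
    · have := C'.φ_eq_zero (Option.map_eq_none_iff.mp h)
      omega
  · rintro ⟨b, b'⟩ y h
    change tensorF C C' i (b, b') = some y at h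
    unfold tensorF at h
    dsimp only at h ⊢
    split_ifs at h with h1
    · obtain ⟨c, hc, rfl⟩ := Option.map_eq_some_iff.mp h
      have := C.φ_f hc
      dsimp only
      omega
    · obtain ⟨c, hc, rfl⟩ := Option.map_eq_some_iff.mp h
      have := C'.φ_f hc
      have := C'.ε_f hc
      dsimp only
      omega

/-- A map that commutes with `e i` preserves `ε i`. -/
theorem ε_eq_of_comm {i : I} {ι : B → B'} (h : ∀ x, C'.e i (ι x) = (C.e i x).map ι) (x : B) :
    C'.ε i (ι x) = C.ε i x := by
  have := C.ε_eq_of_step i (fun x => (C'.ε i (ι x) : ℤ)) ?_ ?_ x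
  · exact_mod_cast this.symm
  · intro b hb
    exact_mod_cast C'.ε_eq_zero (by rw [h, hb]; rfl)
  · intro b c hc
    have := C'.ε_e (i := i) (b := ι b) (c := ι c) (by rw [h, hc]; rfl)
    exact_mod_cast this

end Crystal

/-- `φ i - ε i` is additive over tensor products, so this reduces to the trees. It supplies the
equality of `φ i` in the injectivity argument, where compatibility with `f i` is not yet available.
-/
theorem Matches.weight {l : ℕ} (i : Fin 3) {x : Elt l × Elt 1} {y : Elt 1 × Elt l} {H : ℤ}
    (h : Matches x y H) : (((crystal l).tensor (crystal 1)).φ i x : ℤ) -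
      ((crystal l).tensor (crystal 1)).ε i x = ((crystal 1).tensor (crystal l)).φ i y -
      ((crystal 1).tensor (crystal l)).ε i y := by
  obtain ⟨b, x⟩ := x
  obtain ⟨y, c⟩ := y
  obtain ⟨β, α, rfl, rfl, h⟩ := h
  have := weight_result (i := i) h
  dsimp only at this ⊢
  rw [weight_conf, weight_conf, ← ε_eq_epsFun, ← φ_eq_phiFun, ← ε_eq_epsFun, ← φ_eq_phiFun] at this
  rw [Crystal.ε_tensor, Crystal.φ_tensor, Crystal.ε_tensor, Crystal.φ_tensor, ε_letterElt,
    φ_letterElt, ε_letterElt, φ_letterElt]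
  omega

/-! ### Connectedness of `B_l ⊗ B_1` -/

/-- `(k, 0, 0, 0, 0, 0)` -/
def ones {l k : ℕ} (h : k ≤ l) : Elt l := ⟨⟨k, 0, 0, 0, 0, 0⟩, by simp [Coord.Mem, Coord.s, h]⟩

/-- `(0, 0, 0, 0, 0, k)` -/
def bars {l k : ℕ} (h : k ≤ l) : Elt l := ⟨⟨0, 0, 0, 0, 0, k⟩, by simp [Coord.Mem, Coord.s, h]⟩

theorem epsFun_ones {l k : ℕ} (h : k ≤ l) : epsFun l 0 (ones h).1 = l + k := by
  simp only [ones, epsFun, top, Coord.s, Coord.z1, Coord.z2, Coord.z3, Coord.z4]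
  omega

theorem φ_ones {l k : ℕ} (h : k ≤ l) : (crystal l).φ 0 (ones h) = l - k := by
  have : phiFun l 0 (ones h).1 = l - k := by
    simp only [ones, phiFun, top, Coord.s, Coord.z1, Coord.z2, Coord.z3, Coord.z4]
    omega
  have := (φ_eq_phiFun 0 (ones h)).trans this
  omega

theorem φ_ones_zero {l : ℕ} (i : Fin 3) (hi : i ≠ 0) : (crystal l).φ i (ones (Nat.zero_le l)) = 0 := by
  have : phiFun l i (ones (Nat.zero_le l)).1 = 0 := by
    fin_cases i
    · exact absurd rfl hi
    all_goals simp [ones, phiFun, top, Coord.z4]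
  exact_mod_cast (φ_eq_phiFun i _).trans this

theorem φ_bars {l k : ℕ} (h : k ≤ l) : (crystal l).φ 0 (bars h) = l + k := by
  have : phiFun l 0 (bars h).1 = l + k := by
    simp only [bars, phiFun, top, Coord.s, Coord.z1, Coord.z2, Coord.z3, Coord.z4]
    omega
  exact_mod_cast (φ_eq_phiFun 0 _).trans this

theorem e_ones {l k : ℕ} (h : k + 1 ≤ l) :
    opE l 0 (ones h) = some (ones (Nat.le_of_succ_le h)) := by
  rw [opE_eq_some]
  change rawE0 ⟨((k + 1 : ℕ) : ℤ), 0, 0, 0, 0, 0⟩ = some ⟨k, 0, 0, 0, 0, 0⟩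
  rw [rawE0, if_pos (by simp only [Coord.z1, Coord.z2, Coord.z3, Coord.z4, pos]; omega)]
  simp

theorem e_bars {l k : ℕ} (h : k + 1 ≤ l) :
    opE l 0 (bars (Nat.le_of_succ_le h)) = some (bars h) := by
  rw [opE_eq_some]
  change rawE0 ⟨0, 0, 0, 0, 0, k⟩ = some ⟨0, 0, 0, 0, 0, ((k + 1 : ℕ) : ℤ)⟩
  have h1 : ∀ b : Coord, b = ⟨0, 0, 0, 0, 0, k⟩ → b.z1 = k ∧ b.z2 = 0 ∧ b.z3 = 0 ∧ b.z4 = 0 := by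
    rintro b rfl
    simp [Coord.z1, Coord.z2, Coord.z3, Coord.z4]
  obtain ⟨h1, h2, h3, h4⟩ := h1 _ rfl
  rw [rawE0, if_neg, if_neg, if_neg, if_neg, if_neg, if_pos] <;>
    simp only [h1, h2, h3, h4, pos, neg] <;> try omega
  simp

/-- A linear function of the weight that `e 1` and `e 2` increase. -/
def height (b : Coord) : ℤ := 6 * b.x1 + 4 * b.x2 + b.x3 - b.y3 - 4 * b.y2 - 6 * b.y1

theorem height_of_e {l : ℕ} {i : Fin 3} (hi : i ≠ 0) {b c : Elt l} (h : opE l i b = some c) :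
    height c.1 = height b.1 + 2 ∧ c.1.s = b.1.s := by
  rw [opE_eq_some] at h
  have hb := two_mul_s b.2
  have hc := two_mul_s c.2
  unfold height
  fin_cases i
  · exact absurd rfl hi
  · change rawE1 b.1 = some c.1 at h
    unfold rawE1 at h
    split_ifs at h <;> have h := Option.some.inj h <;> rw [Coord.ext_iff] at h <;>
      dsimp only at h <;> omega
  · change rawE2 b.1 = some c.1 at h
    unfold rawE2 at h
    split_ifs at h <;> have h := Option.some.inj h <;> rw [Coord.ext_iff] at h <;>
      dsimp only at h <;> omega

theorem height_le {l : ℕ} (b : Elt l) : height b.1 ≤ 6 * l := by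
  have h := mem_iff.mp b.2
  have := two_mul_s b.2
  unfold height
  omega

/-- By the closed formulas, `ε 2 = 0` gives `x̄₂ = 0` and `x₃ ≤ x̄₃`, and `ε 1 = 0` gives `x̄₁ = 0`
and places the maximum at the last partial sum. The resulting inequalities leave only `x₁`. -/
theorem eq_ones_of_highest {l : ℕ} {b : Elt l} (h1 : (crystal l).ε 1 b = 0)
    (h2 : (crystal l).ε 2 b = 0) : ∃ (k : ℕ) (h : k ≤ l), b = ones h ∧ b.1.s = k := by
  have e1 := (ε_eq_epsFun 1 b).symm
  have e2 := (ε_eq_epsFun 2 b).symm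
  have hb := mem_iff.mp b.2
  have hs := two_mul_s b.2
  have hk := two_mul_z4 b.2
  simp only [h1, h2, epsFun, top] at e1 e2
  push_cast at e1 e2
  obtain ⟨g1, g2, g3, g4, g5⟩ : b.1.y1 = 0 ∧ b.1.y2 = 0 ∧ b.1.y3 = 0 ∧ b.1.x3 = 0 ∧ b.1.x2 = 0 := by
    omega
  refine ⟨b.1.x1.toNat, by omega, Subtype.ext (Coord.ext ?_ g5 g4 g3 g2 g1), by omega⟩
  change b.1.x1 = (b.1.x1.toNat : ℤ)
  omega

section
variable {l : ℕ} {P : Elt l × Elt 1 → Prop}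
  (he : ∀ i x y, ((crystal l).tensor (crystal 1)).e i x = some y → (P x ↔ P y))
include he

theorem move_left (i : Fin 3) {b c : Elt l} {β : Letter} (h : opE l i b = some c)
    (hβ : ep i β ≤ (crystal l).φ i b) : P (b, letterElt β) ↔ P (c, letterElt β) :=
  he i _ _ (by rw [tensorE_letter, if_pos (by simpa using hβ), h]; rfl)

theorem move_right (i : Fin 3) {b : Elt l} {β γ : Letter} (h : e1 i β = some γ)
    (hβ : (crystal l).φ i b < ep i β) : P (b, letterElt β) ↔ P (b, letterElt γ) :=
  he i _ _ (by rw [tensorE_letter, if_neg (by simpa using hβ), h]; rfl)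

/-- The condition on `m` keeps `ε 0 β ≤ φ 0` all the way down, so that `e 0` always acts on the left
factor. -/
theorem descend (m : ℕ) (hm : m ≤ l) {β : Letter} (hβ : ep 0 β + m ≤ l) {k : ℕ} (hk : k ≤ m) :
    P (ones (hk.trans hm), letterElt β) ↔ P (ones (Nat.zero_le l), letterElt β) := by
  induction k with
  | zero => exact Iff.rfl
  | succ k ih =>
    refine (move_left he 0 (e_ones _) ?_).trans (ih (by omega))
    rw [φ_ones]
    omega

theorem ascend {k : ℕ} (hk : k ≤ l) (hl : 1 ≤ l) :
    P (ones (Nat.zero_le l), letterElt phi) ↔ P (bars hk, letterElt phi) := by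
  induction k with
  | zero => exact Iff.rfl
  | succ k ih =>
    refine (ih (by omega)).trans (move_left he 0 (e_bars _) ?_)
    rw [φ_bars]
    change 1 ≤ _
    omega

/-- Every element can be raised by `e 1` and `e 2` to one of the form `1^k ⊗ β`. -/
theorem climb (h : ∀ (k : ℕ) (hk : k ≤ l) (β : Letter), P (ones hk, letterElt β)) (b : Elt l)
    (b' : Elt 1) : P (b, b') := by
  by_cases hn : ∃ i y, i ≠ 0 ∧ ((crystal l).tensor (crystal 1)).e i (b, b') = some y
  · obtain ⟨i, ⟨c, c'⟩, hi, hy⟩ := hn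
    have : (6 * l + 6 - height c.1 - height c'.1).toNat < (6 * l + 6 - height b.1 - height b'.1).toNat := by
      have h1 := height_le c
      have h2 := height_le c'
      change Crystal.tensorE _ _ _ _ = _ at hy
      unfold Crystal.tensorE at hy
      split_ifs at hy
      · obtain ⟨d, hd, e⟩ := Option.map_eq_some_iff.mp hy
        obtain ⟨e1, e2⟩ := Prod.mk.inj e
        have : height d.1 = height b.1 + 2 := (height_of_e hi hd).1
        rw [e1] at this
        dsimp only at e2
        rw [← e2] at h2 ⊢
        push_cast at h2
        omega
      · obtain ⟨d, hd, e⟩ := Option.map_eq_some_iff.mp hy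
        obtain ⟨e1, e2⟩ := Prod.mk.inj e
        have : height d.1 = height b'.1 + 2 := (height_of_e hi hd).1
        rw [e2] at this
        dsimp only at e1
        rw [← e1] at h1 ⊢
        push_cast at h2
        omega
    exact (he i _ _ hy).mpr (climb h c c')
  -- `ε i` of the left factor is at most `ε i` of the tensor product, so the left factor is of
  -- highest weight for `e 1` and `e 2`.
  · have hz (i : Fin 3) (hi : i ≠ 0) : (crystal l).ε i b = 0 := by
      have h0 : ((crystal l).tensor (crystal 1)).ε i (b, b') = 0 := Crystal.ε_eq_zero _ (by
        cases hy : ((crystal l).tensor (crystal 1)).e i (b, b') with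
        | none => rfl
        | some y => exact absurd ⟨i, y, hi, hy⟩ hn)
      have := (crystal l).ε_tensor (crystal 1) i b b'
      omega
    obtain ⟨k, hk, rfl, -⟩ := eq_ones_of_highest (hz 1 (by decide)) (hz 2 (by decide))
    obtain ⟨β, rfl⟩ := letterElt_surjective b'
    exact h k hk β
termination_by (6 * l + 6 - height b.1 - height b'.1).toNat

/-- Since `ε 1` and `ε 2` vanish at `ϕ`, these operators act on the left factor; they preserve `s`,
so the ascent ends at `u_l` and not at a shorter row of letters `1`. -/
theorem climb_full (h : P (ones le_rfl, letterElt phi)) (b : Elt l) (hb : b.1.s = l) :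
    P (b, letterElt phi) := by
  by_cases hn : ∃ i c, i ≠ 0 ∧ opE l i b = some c
  · obtain ⟨i, c, hi, hc⟩ := hn
    have h1 := height_of_e hi hc
    have : (6 * l - height c.1).toNat < (6 * l - height b.1).toNat := by
      have := height_le c
      omega
    have h0 : ∀ i, i ≠ 0 → ep i phi = 0 := by decide
    exact (move_left he i hc (by rw [h0 i hi]; exact Nat.zero_le _)).mpr (climb_full h c (by omega))
  · have hz (i : Fin 3) (hi : i ≠ 0) : (crystal l).ε i b = 0 := Crystal.ε_eq_zero _ (by
      cases hy : (crystal l).e i b with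
      | none => rfl
      | some y => exact absurd ⟨i, y, hi, hy⟩ hn)
    obtain ⟨k, hk, rfl, hs⟩ := eq_ones_of_highest (hz 1 (by decide)) (hz 2 (by decide))
    obtain rfl : k = l := by omega
    exact h
termination_by (6 * l - height b.1).toNat

/-- A property that is invariant under the `e i` holds everywhere if it holds at `u_l ⊗ u_1`. -/
theorem tensor_induction (hl : 1 ≤ l) (hu : P (u l, u 1)) (x : Elt l × Elt 1) : P x := by
  -- As `φ 0` vanishes at `u_l`, two applications of `e 0` change the right factor from `1` through
  -- `ϕ` to `1̄`; then `e 0` empties the left factor, and `e 1`, `e 2` take the right one through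
  -- all letters other than `ϕ`.
  have p1 : P (ones le_rfl, letterElt n1) := hu
  have pphi : P (ones le_rfl, letterElt phi) :=
    (move_right he 0 (β := n1) rfl (by rw [φ_ones, show ep 0 n1 = 2 from rfl]; omega)).mp p1
  have pm1 : P (ones le_rfl, letterElt m1) :=
    (move_right he 0 (β := phi) rfl (by rw [φ_ones, show ep 0 phi = 1 from rfl]; omega)).mp pphi
  have z1 := (descend he l le_rfl (by rw [show ep 0 m1 = 0 from rfl]; omega) le_rfl).mp pm1
  have cl {i : Fin 3} (hi : i ≠ 0) {β γ : Letter} (h : e1 i β = some γ) (hp : 0 < ep i β) :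
      P (ones (Nat.zero_le l), letterElt β) ↔ P (ones (Nat.zero_le l), letterElt γ) :=
    move_right he i h (by rw [φ_ones_zero i hi]; exact hp)
  have z2 := (cl (i := 1) (by decide) (β := m1) (γ := m2) rfl (by decide)).mp z1
  have z3 := (cl (i := 2) (by decide) (β := m2) (γ := m3) rfl (by decide)).mp z2
  have z4 := (cl (i := 1) (by decide) (β := m3) (γ := n0) rfl (by decide)).mp z3
  have z5 := (cl (i := 1) (by decide) (β := n0) (γ := n3) rfl (by decide)).mp z4
  have z6 := (cl (i := 2) (by decide) (β := n3) (γ := n2) rfl (by decide)).mp z5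
  have z7 := (cl (i := 1) (by decide) (β := n2) (γ := n1) rfl (by decide)).mp z6
  -- The right factor `ϕ` is not reached in this way. Instead the empty left factor is filled with
  -- letters `1̄` by `e 0`, and then `climb_full` leads to `u_l ⊗ ϕ`.
  have z8 : P (ones (Nat.zero_le l), letterElt phi) :=
    (ascend he le_rfl hl).mpr (climb_full he pphi _ (by simp [bars, Coord.s]))
  have zero (β : Letter) : P (ones (Nat.zero_le l), letterElt β) := by
    cases β <;> assumption
  refine climb he (fun k hk β => ?_) x.1 x.2
  by_cases hβ : ep 0 β + k ≤ l
  · exact (descend he k hk hβ le_rfl).mpr (zero β)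
  -- If the descent is obstructed, `e 0` acts on the right factor first and gives a letter with
  -- smaller `ε 0`, from which the descent is possible.
  have hp : (crystal l).φ 0 (ones hk) < ep 0 β := by
    rw [φ_ones]
    omega
  cases β
  case n1 =>
    rcases hk.eq_or_lt with rfl | hk'
    · exact p1
    · exact (move_right he 0 rfl hp).mpr ((descend he k hk
        (by rw [show ep 0 phi = 1 from rfl]; omega) le_rfl).mpr z8)
  case n2 =>
    exact (move_right he 0 rfl hp).mpr ((descend he k hk
        (by rw [show ep 0 m3 = 0 from rfl]; omega) le_rfl).mpr z3)
  case n3 =>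
    exact (move_right he 0 rfl hp).mpr ((descend he k hk
        (by rw [show ep 0 m2 = 0 from rfl]; omega) le_rfl).mpr z2)
  case phi =>
    exact (move_right he 0 rfl hp).mpr ((descend he k hk
        (by rw [show ep 0 m1 = 0 from rfl]; omega) le_rfl).mpr z1)
  all_goals exact absurd (by rw [show ep 0 _ = 0 from rfl]; omega) hβ
end

/-! ### The element `u_l ⊗ u_1` as the maximum of `ε 0` -/

/-- Each of the six partial sums is estimated separately. As `x₁ ≤ l`, the value `2l` forces `x₁ =
l`, hence `b = u l`. -/
theorem ε_le {l : ℕ} (b : Elt l) : ((crystal l).ε 0 b : ℤ) ≤ l + b.1.x1 := by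
  rw [ε_eq_epsFun]
  have hb := mem_iff.mp b.2
  have hs := two_mul_s b.2
  have hk := two_mul_z4 b.2
  have p1 : b.1.z1 = b.1.y1 - b.1.x1 := rfl
  have p2 : b.1.z2 = b.1.y2 - b.1.y3 := rfl
  have p3 : b.1.z3 = b.1.x3 - b.1.x2 := rfl
  have ht : top 0 b.1 ≤ b.1.x1 + b.1.s + (2 * b.1.z1 + b.1.z2 + 3 * b.1.z4 + b.1.z3) := by
    refine max_le ?_ (max_le ?_ (max_le ?_ (max_le ?_ (max_le ?_ ?_)))) <;> omega
  simp only [epsFun]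
  omega

theorem ε_le_two_mul {l : ℕ} (b : Elt l) : (crystal l).ε 0 b ≤ 2 * l := by
  have := ε_le b
  have := mem_iff.mp b.2
  have := two_mul_s b.2
  omega

theorem eq_u_of_ε {l : ℕ} {b : Elt l} (h : (crystal l).ε 0 b = 2 * l) : b = u l := by
  have := ε_le b
  have := mem_iff.mp b.2
  have := two_mul_s b.2
  exact Subtype.ext (Coord.ext (show b.1.x1 = l by omega) (show b.1.x2 = 0 by omega)
    (show b.1.x3 = 0 by omega) (show b.1.y3 = 0 by omega) (show b.1.y2 = 0 by omega)
    (show b.1.y1 = 0 by omega))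

theorem ε_u (l : ℕ) : (crystal l).ε 0 (u l) = 2 * l := by
  have : epsFun l 0 (u l).1 = l + l := epsFun_ones le_rfl
  have := (ε_eq_epsFun 0 (u l)).trans this
  omega

theorem φ_u (l : ℕ) : (crystal l).φ 0 (u l) = 0 :=
  (φ_ones le_rfl).trans (Nat.sub_self l)

theorem ε_tensor_u (l m : ℕ) : ((crystal l).tensor (crystal m)).ε 0 (u l, u m) = 2 * l + 2 * m := by
  have := (crystal l).ε_tensor (crystal m) 0 (u l) (u m)
  rw [ε_u, ε_u, φ_u] at this
  omega

/-- By `ε_tensor`, `ε 0` of a product is at most the sum of the `ε 0` of its factors, so both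
factors are maximal. Any map preserving `ε 0` thus fixes the base point of the induction. -/
theorem eq_u_of_ε_tensor {l m : ℕ} {x : Elt l × Elt m}
    (h : ((crystal l).tensor (crystal m)).ε 0 x = 2 * l + 2 * m) : x = (u l, u m) := by
  have h' : ((crystal l).tensor (crystal m)).ε 0 (x.1, x.2) = 2 * l + 2 * m := h
  have := (crystal l).ε_tensor (crystal m) 0 x.1 x.2
  have := ε_le_two_mul x.1
  have := ε_le_two_mul x.2
  exact Prod.ext (eq_u_of_ε (by omega)) (eq_u_of_ε (by omega))

instance (l : ℕ) : Finite (Elt l) := by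
  refine Finite.of_injective (fun b : Elt l => fun x => (⟨conf b x, ?_⟩ : Fin (l + 1))) fun b c h => ?_
  · have h := length_runs b
    have hx := conf_eq_mult b x
    have := List.count_le_length (a := x) (l := runs (conf b) B1)
    rw [mult_eq] at hx
    split_ifs at hx
    · subst x
      omega
    · omega
  · exact conf_injective l (funext fun x => congrArg Fin.val (congrFun h x))

/-! ### The combinatorial `R` matrix -/

theorem matches_u {l : ℕ} (hl : 1 ≤ l) {y : Elt 1 × Elt l} {H : ℤ} (h : Matches (u l, u 1) y H) :
    H = 0 := by
  obtain ⟨β, α, hβ, -, h⟩ := h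
  obtain rfl : n1 = β := letterElt_injective hβ
  have c1 : conf (u l) n1 = l := rfl
  have c0 : ∀ x, x ≠ n1 → conf (u l) x = 0 := by
    intro x hx
    cases x
    case n1 => exact absurd rfl hx
    case phi =>
      change ((l : ℤ) - (l + 0 + (0 + 0) / 2 + 0 + 0)).toNat = 0
      omega
    all_goals rfl
  -- Only the letter `1` occurs, so all questions except the last on this path are answered in the
  -- negative and the leaf has energy zero.
  simp only [shape, DTree.Result, c1, c0 phi (by decide), c0 m1 (by decide), c0 m2 (by decide),
    c0 m3 (by decide), c0 n0 (by decide), c0 n3 (by decide), c0 n2 (by decide), hl,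
    show ¬ 1 ≤ 0 by decide, if_true, if_false] at h
  exact h.2.1

theorem exists_matches {l : ℕ} (hl : 1 ≤ l) (x : Elt l × Elt 1) : ∃ (y : Elt 1 × Elt l) (H : ℤ),
    Matches x y H ∧ algorithm l (row x.1.1) (row x.2.1) = some (H, y.1, y.2) := by
  obtain ⟨b, b'⟩ := x
  obtain ⟨β, rfl⟩ := letterElt_surjective b'
  obtain ⟨α, c, H, h1, h2⟩ := algorithm_shape hl b β
  exact ⟨(letterElt α, c), H, ⟨β, α, rfl, rfl, h1⟩, h2⟩

section
variable {l : ℕ} {ι : Elt l × Elt 1 → Elt 1 × Elt l} {H : Elt l × Elt 1 → ℤ}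

theorem comm_e (hl : 1 ≤ l) (hm : ∀ x, Matches x (ι x) (H x)) (i : Fin 3) (x : Elt l × Elt 1) :
    ((crystal 1).tensor (crystal l)).e i (ι x) =
      (((crystal l).tensor (crystal 1)).e i x).map ι := by
  cases hx : ((crystal l).tensor (crystal 1)).e i x with
  | none => exact (hm x).e_none hl hx
  | some x' => exact ((hm x).e_some hl (hm x') hx).1

/-- The property "no other element has the same image" holds at `u_l ⊗ u_1`, which `ε 0` singles
out, and is carried along the arrows of the connected graph. -/
theorem injective_of_matches (hl : 1 ≤ l) (hm : ∀ x, Matches x (ι x) (H x)) :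
    Function.Injective ι := by
  have hc := comm_e hl hm
  have hε (i : Fin 3) := Crystal.ε_eq_of_comm _ _ (hc i)
  suffices ∀ x y, ι y = ι x → y = x from fun y x => this x y
  refine tensor_induction (fun i x x' hx => ⟨fun h y hy => ?_, fun h y hy => ?_⟩) hl fun y hy => ?_
  -- `ι` preserves `ε i` and the weight, hence `φ i`. Since `φ i x'` is positive, so is `φ i y`, and
  -- `y` has a predecessor `y'`; its image is that of `x`.
  · have h1 : ((crystal l).tensor (crystal 1)).φ i y = ((crystal l).tensor (crystal 1)).φ i x' := by
      have w1 := (hm x').weight i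
      have w2 := (hm y).weight i
      have e1 := hε i x'
      have e2 := hε i y
      rw [hy] at w2 e2
      omega
    have h2 := Crystal.φ_e _ hx
    obtain ⟨y', hy'⟩ := Crystal.exists_f_of_pos _ (i := i) (b := y) (by rw [h1, h2]; exact Nat.succ_pos _)
    have e := (Crystal.inverse _ i y y').mp hy'
    have e1 := hc i y'
    have e2 := hc i x
    rw [e] at e1
    rw [hx] at e2
    have f1 := (Crystal.inverse _ i _ _).mpr e1
    have f2 := (Crystal.inverse _ i _ _).mpr e2
    rw [hy] at f1
    obtain rfl := h y' (Option.some.inj (f1.symm.trans f2))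
    exact Option.some.inj (e.symm.trans hx)
  · have e := hc i y
    rw [hy, hc i x, hx] at e
    obtain ⟨y', hy', e⟩ := Option.map_eq_some_iff.mp e.symm
    obtain rfl := h y' e
    exact Option.some.inj (((Crystal.inverse _ i _ _).mpr hy').symm.trans
      ((Crystal.inverse _ i _ _).mpr hx))
  · refine eq_u_of_ε_tensor ?_
    rw [← hε 0 y, hy, hε, ε_tensor_u]

theorem isIso_of_matches (hl : 1 ≤ l) (hm : ∀ x, Matches x (ι x) (H x)) :
    (crystal l).IsIso (crystal 1) ι := by
  have hc := comm_e hl hm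
  have hinj := injective_of_matches hl hm
  have hbij : Function.Bijective ι := by
    -- Exchanging the factors makes `ι` an injective map of a finite set to itself.
    have h := Finite.injective_iff_bijective.mp (Prod.swap_injective.comp hinj)
    exact (Function.Bijective.of_comp_iff' Prod.swap_bijective ι).mp h
  refine ⟨hbij, fun i x => ⟨hc i x, ?_⟩⟩
  cases hx : ((crystal l).tensor (crystal 1)).f i x with
  | some y =>
    have h := hc i y
    rw [(Crystal.inverse _ i x y).mp hx] at h
    exact (Crystal.inverse _ i _ _).mpr h
  | none =>
    cases hz : ((crystal 1).tensor (crystal l)).f i (ι x) with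
    | none => rfl
    | some z =>
      -- A value of `f i` at `ι x` is some `ι y`; then `e i` takes `y` to `x`, contrary to `f i x =
      -- 0`.
      obtain ⟨y, rfl⟩ := hbij.2 z
      have h := (Crystal.inverse _ i _ _).mp hz
      rw [hc i y] at h
      obtain ⟨x', hx', e⟩ := Option.map_eq_some_iff.mp h
      obtain rfl := hinj e
      rw [(Crystal.inverse _ i _ _).mpr hx'] at hx
      cases hx

theorem isEnergy_of_matches (hl : 1 ≤ l) (hm : ∀ x, Matches x (ι x) (H x)) :
    (crystal l).IsEnergy (crystal 1) 0 ι H := by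
  intro i x y hxy
  rw [((hm x).e_some hl (hm y) hxy).2]
  unfold eRule
  by_cases hi : i = 0
  · subst hi
    by_cases h1 : (crystal 1).ε 0 x.2 ≤ (crystal l).φ 0 x.1 <;>
    by_cases h2 : (crystal l).ε 0 (ι x).2 ≤ (crystal 1).φ 0 (ι x).1 <;>
    simp [h1, h2, Nat.not_lt.mpr, Nat.not_le.mp]
  · simp [hi]

/-- There is at most one isomorphism and at most one normalized energy function for it. -/
theorem combinatorialR_unique (hl : 1 ≤ l) {ι' : Elt l × Elt 1 → Elt 1 × Elt l}
    {H' : Elt l × Elt 1 → ℤ} (h1 : (crystal l).IsIso (crystal 1) ι)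
    (h2 : (crystal l).IsEnergy (crystal 1) 0 ι H) (h1' : (crystal l).IsIso (crystal 1) ι')
    (h2' : (crystal l).IsEnergy (crystal 1) 0 ι' H') (h0 : H (u l, u 1) = H' (u l, u 1))
    (x : Elt l × Elt 1) : ι x = ι' x ∧ H x = H' x := by
  refine tensor_induction (P := fun x => ι x = ι' x ∧ H x = H' x) (fun i x y hxy => ?_) hl ?_ x
  · have e1 := (h1.2 i x).1
    have e2 := (h1'.2 i x).1
    have f1 := (h1.2 i y).2
    have f2 := (h1'.2 i y).2
    rw [hxy] at e1 e2
    rw [(Crystal.inverse _ i y x).mpr hxy] at f1 f2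
    have g1 := h2 i x y hxy
    have g2 := h2' i x y hxy
    refine ⟨fun h => ?_, fun h => ?_⟩
    · rw [← h.1] at e2 g2
      refine ⟨Option.some.inj (e1.symm.trans e2), ?_⟩
      rw [g1, g2, h.2]
    · rw [← h.1] at f2
      have e := Option.some.inj (f1.symm.trans f2)
      refine ⟨e, ?_⟩
      -- The change of the energy depends only on `i`, `x` and the common image of `x`, so it
      -- cancels.
      rw [← e, ← h.2, g1] at g2
      split_ifs at g2 <;> omega
  -- Every isomorphism preserves `ε 0` and so sends `u_l ⊗ u_1` to `u_1 ⊗ u_l`.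
  · have e1 := Crystal.ε_eq_of_comm _ _ (fun x => (h1.2 0 x).1) (u l, u 1)
    have e2 := Crystal.ε_eq_of_comm _ _ (fun x => (h1'.2 0 x).1) (u l, u 1)
    rw [ε_tensor_u, add_comm] at e1 e2
    exact ⟨(eq_u_of_ε_tensor e1).trans (eq_u_of_ε_tensor e2).symm, h0⟩

end

end D43

theorem mainTheorem2 (l : ℕ) (hl : 1 ≤ l) :
    ∃ R : D43.Aff (D43.Elt l) × D43.Aff (D43.Elt 1) → D43.Aff (D43.Elt 1) × D43.Aff (D43.Elt l),
      (∀ x, D43.algorithmR l x = some (R x)) ∧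
      D43.IsNormalizedCombinatorialR (D43.crystal l) (D43.crystal 1) 0 (D43.u l, D43.u 1) R ∧
      ∀ R', D43.IsNormalizedCombinatorialR (D43.crystal l) (D43.crystal 1) 0 (D43.u l, D43.u 1) R' →
        R' = R := by
  choose ι H hm ha using D43.exists_matches hl
  have h1 := D43.isIso_of_matches hl hm
  have h2 := D43.isEnergy_of_matches hl hm
  have h0 := D43.matches_u hl (hm _)
  refine ⟨D43.affineMap ι H, fun x => ?_, ⟨ι, H, h1, h2, h0, rfl⟩, ?_⟩
  · have := ha (x.1.2, x.2.2)
    dsimp only at this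
    rw [D43.algorithmR, this]
    rfl
  · rintro R' ⟨ι', H', h1', h2', h0', rfl⟩
    have h := D43.combinatorialR_unique hl h1' h2' h1 h2 (h0'.trans h0.symm)
    obtain rfl : ι' = ι := funext fun x => (h x).1
    obtain rfl : H' = H := funext fun x => (h x).2
    rfl
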